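/- All graphs are finite and simple, and $|G|$ denotes the number of vertices of $G$. Two disjoint sets of vertices are anticomplete if there is no edge between them; $G$ is $(\gamma,\delta)$-coherent if there is no anticomplete pair $A,B\subseteq V(G)$ with $|A|\ge\gamma$ and $|B|\ge\delta$. If $P$ is an induced path of $H$ of length at least two (length is the number of edges) whose internal vertices all have degree two in $H$, then $H$ is obtained by adding the handle $P$ to the graph got from $H$ by deleting the internal vertices of $P$. A graph is $\beta$-buildable if it can be constructed from a two-vertex graph with no edges by repeatedly adding a handle of length at least $\beta$. A blockade in $G$ is a family $\mathcal{A}=(A_i:i\in I)$ of nonempty, pairwise disjoint subsets of $V(G)$ (its blocks), where $I$ is a set of integers. Its length is $|I|$; its width is $\min_{i\in I}|A_i|$; its shrinkage is the number $s$ such that its width is $|G|^{1-s}$; and its linkage is the maximum, over all distinct $i,j\in I$ and all $v\in A_i$, of the number of neighbours of $v$ in $A_j$ divided by $|A_j|$ (or zero, if $|I|\le 1$). An $\mathcal{A}$-rainbow copy of $H$ is an induced subgraph $J$ of $G$, isomorphic to $H$, with $V(J)\subseteq\bigcup_{i\in I}A_i$, such that each block contains at most one vertex of $J$. For integers $N,K>0$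 and real numbers $\sigma,\lambda,c>0$, we say that $(N,K,\sigma,\lambda,c)$ forces $H$ if for every $(|G|^{1-c},|G|^{1-c})$-coherent graph $G$ with $|G|\ge N$, and every blockade $\mathcal{A}$ in $G$ of length $K$, shrinkage at most $\sigma$ and linkage at most $\lambda$, there is an $\mathcal{A}$-rainbow copy of $H$. **Theorem.** Let $\beta\ge 6$ be an integer, and let $c>1/\lfloor(\beta-3)/3\rfloor$. For every $\beta$-buildable graph $H$ and every $\sigma>0$ with $c-\sigma>1/\lfloor(\beta-3)/3\rfloor$, there exist integers $N,K>0$ and a real number $\lambda>0$ such that $(N,K,\sigma,\lambda,c)$ forces $H$. -/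

import Mathlib

universe u v

namespace PurePairs

/-! ### Anticomplete pairs and coherence -/

/-- `A` and `B` are disjoint and there are no edges between them. -/
def Anticomplete {V : Type u} (G : SimpleGraph V) (A B : Finset V) : Prop :=
  Disjoint A B ∧ ∀ a ∈ A, ∀ b ∈ B, ¬ G.Adj a b

/-- `G` is `(γ, δ)`-coherent: there is no anticomplete pair `A, B` with `|A| ≥ γ` and `|B| ≥ δ`. -/
def Coherent {V : Type u} (G : SimpleGraph V) (γ δ : ℝ) : Prop :=
  ¬ ∃ A B : Finset V, Anticomplete G A B ∧ γ ≤ (A.card : ℝ) ∧ δ ≤ (B.card : ℝ)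

/-! ### Handles and buildable graphs -/

/-- The set of internal vertices of an induced path of length `ℓ` in `H`; such a path is given as an
isomorphism of the path graph on the `ℓ + 1` vertices `0, …, ℓ` onto an induced subgraph of `H`. -/
def pathInterior {W : Type v} {H : SimpleGraph W} {ℓ : ℕ}
    (P : SimpleGraph.pathGraph (ℓ + 1) ↪g H) : Set W :=
  {w | ∃ i : Fin (ℓ + 1), i ≠ 0 ∧ i ≠ Fin.last ℓ ∧ P i = w}

/-- The induced path `P` is a handle of `H`: it has length at least two and every internal vertex of
`P` has degree two in `H`. Then `H` is obtained from the subgraph induced on the complement of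
`pathInterior P` by adding the handle `P`. -/
def IsHandle {W : Type v} (H : SimpleGraph W) {ℓ : ℕ}
    (P : SimpleGraph.pathGraph (ℓ + 1) ↪g H) : Prop :=
  2 ≤ ℓ ∧ ∀ w ∈ pathInterior P, (H.neighborSet w).ncard = 2

/-- `H` is `β`-buildable: it can be constructed from a two-vertex graph with no edges by repeatedly
adding a handle of length at least `β`. -/
inductive IsBuildable (β : ℕ) : ∀ {W : Type v}, SimpleGraph W → Prop
  | base {W : Type v} (H : SimpleGraph W) (hcard : Nat.card W = 2)
      (hedge : ∀ x y : W, ¬ H.Adj x y) : IsBuildable β H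
  | handle {W : Type v} (H : SimpleGraph W) (ℓ : ℕ) (hℓ : β ≤ ℓ)
      (P : SimpleGraph.pathGraph (ℓ + 1) ↪g H) (hP : IsHandle H P)
      (hH : IsBuildable β (H.induce (pathInterior P)ᶜ)) : IsBuildable β H

/-! ### Blockades -/

/-- A blockade in a graph with vertex set `V`: a family of nonempty pairwise disjoint sets of
vertices (the blocks), indexed by a finite set of integers. (The values of `block` outside `index`
are irrelevant; the index set of a blockade in a finite graph is always finite.) -/
structure Blockade (V : Type u) where
  index : Finset ℤ
  block : ℤ → Finset V
  block_nonempty : ∀ i ∈ index, (block i).Nonempty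
  block_disjoint : ∀ i ∈ index, ∀ j ∈ index, i ≠ j → Disjoint (block i) (block j)

namespace Blockade

variable {V : Type u}

/-- The number of blocks. -/
def length (B : Blockade V) : ℕ := B.index.card

/-- The minimum cardinality of a block. -/
noncomputable def width (B : Blockade V) : ℕ :=
  sInf ((fun i => (B.block i).card) '' (B.index : Set ℤ))

/-- The number `σ` such that the width is `|G| ^ (1 - σ)`, where `|G|` is the number of vertices. -/
noncomputable def shrinkage [Fintype V] (B : Blockade V) : ℝ :=
  1 - Real.logb (Fintype.card V : ℝ) (B.width : ℝ)

theorem width_pos (B : Blockade V) (h : 0 < B.length) : 0 < B.width := by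
  have hne : ((fun i => (B.block i).card) '' (B.index : Set ℤ)).Nonempty :=
    Set.Nonempty.image _ (Finset.coe_nonempty.mpr (Finset.card_pos.mp h))
  obtain ⟨i, hi, hw⟩ := Nat.sInf_mem hne
  have hpos := Finset.card_pos.mpr (B.block_nonempty i hi)
  unfold width
  rw [← hw]
  exact hpos

/-- The shrinkage is indeed the unique `σ` such that the width is `|G| ^ (1 - σ)`. -/
theorem width_eq_iff [Fintype V] (B : Blockade V) (h : 0 < B.length) (hV : 1 < Fintype.card V)
    (σ : ℝ) : (B.width : ℝ) = (Fintype.card V : ℝ) ^ (1 - σ) ↔ σ = B.shrinkage := by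
  have hw : (0 : ℝ) < B.width := by exact_mod_cast B.width_pos h
  have hV' : (1 : ℝ) < Fintype.card V := by exact_mod_cast hV
  unfold shrinkage
  constructor
  · intro e
    rw [e, Real.logb_rpow (by linarith) (by linarith)]
    ring
  · intro e
    rw [e, sub_sub_cancel, Real.rpow_logb (by linarith) (by linarith) hw]

open Classical in
/-- The maximum, over `v ∈ X`, of the number of neighbours of `v` in `Y`. -/
noncomputable def maxDegree (G : SimpleGraph V) (X Y : Finset V) : ℕ :=
  X.sup fun v => (Y.filter fun w => G.Adj v w).card

/-- The maximum, over all distinct indices `i, j`, of the max-degree from block `i` to block `j`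
divided by the size of block `j`; it is zero if there is at most one block. -/
noncomputable def linkage (G : SimpleGraph V) (B : Blockade V) : NNReal :=
  B.index.offDiag.sup fun p =>
    (maxDegree G (B.block p.1) (B.block p.2) : NNReal) / ((B.block p.2).card : NNReal)

/-- The subgraph induced on `J` is rainbow: `J` is a subset of the union of the blocks, and each
block contains at most one member of `J`. -/
def IsRainbow (B : Blockade V) (J : Set V) : Prop :=
  (∀ x ∈ J, ∃ i ∈ B.index, x ∈ B.block i) ∧
    ∀ i ∈ B.index, ∀ x ∈ J, ∀ y ∈ J, x ∈ B.block i → y ∈ B.block i → x = y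

/-- There is a rainbow copy of `H`: a rainbow induced subgraph of `G` isomorphic to `H`. -/
def HasRainbowCopy (G : SimpleGraph V) (B : Blockade V) {W : Type v} (H : SimpleGraph W) : Prop :=
  ∃ J : Set V, B.IsRainbow J ∧ Nonempty (H ≃g G.induce J)

end Blockade

/-- `(N, K, σ, lam, c)` forces `H`: for every finite `(|G| ^ (1-c), |G| ^ (1-c))`-coherent graph `G`
with `|G| ≥ N`, and every blockade in `G` of length `K`, shrinkage at most `σ` and linkage at most
`lam`, there is a rainbow copy of `H`. -/
def Forces (N K : ℕ) (σ lam c : ℝ) {W : Type v} (H : SimpleGraph W) : Prop :=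
  ∀ (V : Type u) [Fintype V] (G : SimpleGraph V),
    Coherent G ((Fintype.card V : ℝ) ^ (1 - c)) ((Fintype.card V : ℝ) ^ (1 - c)) →
    N ≤ Fintype.card V →
    ∀ A : Blockade V, A.length = K → A.shrinkage ≤ σ → (A.linkage G : ℝ) ≤ lam →
      A.HasRainbowCopy G H

end PurePairs

/-! Induct on the construction of `H`. Put t = ⌊(β-3)/3⌋, so that handles have length ℓ ≥ 3t+3, and
write n = |G|, γ = n^(1-c). For the handle step it is enough to find many blocks and not much
smaller subsets A_i of them, still of small linkage, such that any two nonadjacent vertices of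
distinct A_i, A_j are joined by an induced rainbow path of length exactly ℓ whose interior lies in
other blocks and is anticomplete to the remaining A_k (`Linked`). The inductive hypothesis gives a
rainbow copy of the smaller graph in the A_i, and one such path supplies the handle
(`Linked.hasRainbowCopy`). Sets may shrink by a small power of n, because the inductive hypothesis
is available for slightly larger σ.

Exact length is the difficulty. After a little deletion, coherence makes sets of size at most γ
expand by a factor of at least n^(1/t) (`exists_expanding`). An induced tree with one block per
level therefore fills a constant fraction of a block by depth t, and it can then be continued to any
prescribed depth (`exists_tree`). Two trees of depth t with a common root give walks of length 2t
from a large set Λ to a large set Z (`exists_alt`). Subsets of Λ cover large pieces of many further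
blocks (`Alt.exists_of_large`), so every vertex of such a piece has an induced path to a fixed z ∈
Z, of unknown length d ≤ 2t+1. By pigeonhole d can be made constant over large parts of many pieces.
A tree grown from z to depth ℓ-2-d ≥ t (this is where ℓ ≥ 3t+3 is needed) has a top level Q and
misses one of the pieces, P; nonadjacent vertices of P and Q are then joined by induced paths of
length ℓ-2 (`Connector`). Finally the remaining blocks are covered both from P and from Q
(`TwoSource.exists_covers`), which adds one edge at each end.

The covers rest on degree regularity: with q = n^ε, `exists_regular` makes the degrees from several
blocks into P lie between D/q and D, robustly under passing to subsets of P, and `exists_cover` then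
covers a q^(-2) fraction of one block while sparing most of the others. -/

namespace PurePairs

open Finset
open scoped Classical

/-! ### Neighbourhoods, degrees and coherence. -/

section Basics

variable {V : Type u}

/-- The vertices of `B` with a neighbour in `X`. -/
noncomputable def nbrs (G : SimpleGraph V) (X B : Finset V) : Finset V :=
  B.filter fun w => ∃ x ∈ X, G.Adj x w

/-- The number of neighbours of `w` in `X`, as a real number. -/
noncomputable def deg (G : SimpleGraph V) (w : V) (X : Finset V) : ℝ :=
  ((X.filter fun x => G.Adj w x).card : ℝ)

/-- There is no anticomplete pair of sets both of size at least `γ`. -/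
def Coh (G : SimpleGraph V) (γ : ℝ) : Prop :=
  ∀ A B : Finset V, Disjoint A B → (∀ a ∈ A, ∀ b ∈ B, ¬ G.Adj a b) →
    γ ≤ (A.card : ℝ) → γ ≤ (B.card : ℝ) → False

variable {G : SimpleGraph V}

theorem mem_nbrs {X B : Finset V} {w : V} :
    w ∈ nbrs G X B ↔ w ∈ B ∧ ∃ x ∈ X, G.Adj x w := by
  simp [nbrs]

theorem nbrs_subset (X B : Finset V) : nbrs G X B ⊆ B := filter_subset _ _

theorem nbrs_mono {X Y B C : Finset V} (h : X ⊆ Y) (h' : B ⊆ C) : nbrs G X B ⊆ nbrs G Y C := by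
  intro w hw
  obtain ⟨hw, x, hx, hxw⟩ := mem_nbrs.1 hw
  exact mem_nbrs.2 ⟨h' hw, x, h hx, hxw⟩

theorem nbrs_union (X Y B : Finset V) : nbrs G (X ∪ Y) B = nbrs G X B ∪ nbrs G Y B := by
  ext w
  simp only [mem_nbrs, mem_union]
  constructor
  · rintro ⟨h, x, hx | hx, a⟩
    · exact Or.inl ⟨h, x, hx, a⟩
    · exact Or.inr ⟨h, x, hx, a⟩
  · rintro (⟨h, x, hx, a⟩ | ⟨h, x, hx, a⟩)
    · exact ⟨h, x, Or.inl hx, a⟩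
    · exact ⟨h, x, Or.inr hx, a⟩

theorem card_nbrs_union_le (X Y B : Finset V) :
    ((nbrs G (X ∪ Y) B).card : ℝ) ≤ (nbrs G X B).card + (nbrs G Y B).card := by
  rw [nbrs_union]
  exact_mod_cast card_union_le _ _

theorem card_mono {X Y : Finset V} (h : X ⊆ Y) : (X.card : ℝ) ≤ Y.card := by
  exact_mod_cast card_le_card h

theorem card_add_sdiff_nbrs (X B : Finset V) :
    ((nbrs G X B).card : ℝ) + ((B \ nbrs G X B).card : ℝ) = B.card := by
  have := card_sdiff_add_card_eq_card (nbrs_subset (G := G) X B)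
  rw [add_comm]
  exact_mod_cast this

theorem not_adj_of_mem_sdiff_nbrs {X B : Finset V} {w x : V} (hw : w ∈ B \ nbrs G X B)
    (hx : x ∈ X) : ¬ G.Adj x w := by
  intro h
  rw [mem_sdiff, mem_nbrs] at hw
  exact hw.2 ⟨hw.1, x, hx, h⟩

theorem deg_nonneg (w : V) (X : Finset V) : 0 ≤ deg G w X := Nat.cast_nonneg _

theorem deg_mono {w : V} {X Y : Finset V} (h : X ⊆ Y) : deg G w X ≤ deg G w Y :=
  card_mono (filter_subset_filter _ h)

theorem deg_le_card (w : V) (X : Finset V) : deg G w X ≤ X.card := card_mono (filter_subset _ _)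

theorem deg_eq_zero_of_lt_one {w : V} {X : Finset V} (h : deg G w X < 1) :
    ∀ x ∈ X, ¬ G.Adj w x := by
  have h0 : (X.filter fun x => G.Adj w x).card = 0 := by
    unfold deg at h
    have : (X.filter fun x => G.Adj w x).card < 1 := by exact_mod_cast h
    omega
  rw [card_eq_zero, filter_eq_empty_iff] at h0
  exact fun x hx => h0 hx

theorem deg_add_deg_sdiff {w : V} {X Y : Finset V} (h : Y ⊆ X) :
    deg G w Y + deg G w (X \ Y) = deg G w X := by
  unfold deg
  rw [← Nat.cast_add, ← card_union_of_disjoint, ← filter_union, union_sdiff_of_subset h]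
  exact disjoint_filter_filter disjoint_sdiff

theorem sum_deg_comm (X Y : Finset V) : ∑ v ∈ X, deg G v Y = ∑ w ∈ Y, deg G w X := by
  unfold deg
  rw [← Nat.cast_sum, ← Nat.cast_sum]
  congr 1
  have := sum_card_bipartiteAbove_eq_sum_card_bipartiteBelow (s := X) (t := Y)
    (fun a b => G.Adj a b)
  simp only [bipartiteAbove, bipartiteBelow] at this
  rw [this]
  refine sum_congr rfl fun w _ => ?_
  congr 1
  exact filter_congr fun x _ => G.adj_comm _ _

theorem card_nbrs_singleton (v : V) (B : Finset V) : ((nbrs G {v} B).card : ℝ) = deg G v B := by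
  simp [nbrs, deg]

theorem card_nbrs_le_sum (X B : Finset V) : ((nbrs G X B).card : ℝ) ≤ ∑ x ∈ X, deg G x B := by
  have : nbrs G X B ⊆ X.biUnion fun x => B.filter fun w => G.Adj x w := by
    intro w hw
    obtain ⟨hw, x, hx, hxw⟩ := mem_nbrs.1 hw
    exact mem_biUnion.2 ⟨x, hx, mem_filter.2 ⟨hw, hxw⟩⟩
  have h := (card_le_card this).trans card_biUnion_le
  unfold deg
  exact_mod_cast h

/-- A set of size `γ` covers all but at most `γ` of every disjoint set. -/
theorem Coh.card_sdiff_nbrs_lt {γ : ℝ} (hG : Coh G γ) {X B : Finset V} (hd : Disjoint X B)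
    (hX : γ ≤ X.card) : ((B \ nbrs G X B).card : ℝ) < γ := by
  by_contra h
  push Not at h
  refine hG X (B \ nbrs G X B) (hd.mono_right sdiff_subset) ?_ hX h
  intro a ha b hb
  exact not_adj_of_mem_sdiff_nbrs hb ha

/-- Few vertices of `S` have many neighbours in `B`, if vertices of `B` have few in `S`. -/
theorem card_heavy_le {B S : Finset V} {a b : ℝ} (hB : B.Nonempty)
    (h : ∀ w ∈ B, deg G w S ≤ a * S.card) :
    b * ((S.filter fun v => b * B.card < deg G v B).card : ℝ) ≤ a * S.card := by
  have hBpos : (0 : ℝ) < B.card := by exact_mod_cast hB.card_pos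
  have h1 : ∑ v ∈ S.filter (fun v => b * B.card < deg G v B), b * (B.card : ℝ)
      ≤ ∑ v ∈ S, deg G v B := by
    refine le_trans (sum_le_sum (g := fun v => deg G v B) ?_)
      (sum_le_sum_of_subset_of_nonneg (filter_subset _ _) fun _ _ _ => deg_nonneg _ _)
    intro v hv
    exact (mem_filter.1 hv).2.le
  have h2 : ∑ v ∈ S, deg G v B ≤ B.card * (a * S.card) := by
    rw [sum_deg_comm]
    refine le_trans (sum_le_sum h) ?_
    simp
  rw [sum_const, nsmul_eq_mul] at h1
  have h3 := h1.trans h2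
  have : (b * ((S.filter fun v => b * B.card < deg G v B).card : ℝ)) * B.card
      ≤ (a * S.card) * B.card := by nlinarith
  exact le_of_mul_le_mul_right this hBpos

theorem card_filter_add_not {S : Finset V} (p : V → Prop) [DecidablePred p]
    [∀ v, Decidable (¬ p v)] :
    ((S.filter p).card : ℝ) + ((S.filter fun v => ¬ p v).card : ℝ) = S.card := by
  exact_mod_cast card_filter_add_card_filter_not (s := S) p

/-- At least half of the vertices of `S` have few neighbours in `B`. -/
theorem half_le_card_light {B S : Finset V} {a : ℝ} (ha : 0 < a) (hB : B.Nonempty)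
    (h : ∀ w ∈ B, deg G w S ≤ a * S.card) :
    (S.card : ℝ) / 2 ≤ (S.filter fun v => deg G v B ≤ 2 * a * B.card).card := by
  have h1 := card_heavy_le (b := 2 * a) hB h
  have h2 := card_filter_add_not (S := S) fun v => deg G v B ≤ 2 * a * B.card
  simp only [not_le] at h2
  have : a * ((S.filter fun v => 2 * a * B.card < deg G v B).card : ℝ) ≤ a * (S.card / 2) := by
    linarith
  have := le_of_mul_le_mul_left this ha
  linarith

/-- Robust lower bound on the degrees from `B` to `P`: for each large subset `P'` of `P`, few
vertices of `B` have fewer than `D / q` neighbours in `P'`. -/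
def LowerStable (G : SimpleGraph V) (q : ℝ) (P B : Finset V) (D η : ℝ) : Prop :=
  ∀ P' ⊆ P, η * P.card ≤ P'.card →
    ((B.filter fun w => q * deg G w P' < D).card : ℝ) ≤ η * B.card

/-- The threshold `D` survives shrinking both sets; only the tolerance worsens, by the reciprocal of
the shrinking factor `θ`. -/
theorem LowerStable.mono {q D η η' θ : ℝ} {P B P' B' : Finset V} (h : LowerStable G q P B D η)
    (hθ : η ≤ η' * θ) (hη' : 0 ≤ η') (hP : P' ⊆ P) (hB : B' ⊆ B)
    (hPc : θ * P.card ≤ P'.card) (hBc : θ * B.card ≤ B'.card) :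
    LowerStable G q P' B' D η' := by
  intro R hR hRc
  have h1 : η * P.card ≤ R.card := by
    have : η' * (θ * P.card) ≤ η' * P'.card := mul_le_mul_of_nonneg_left hPc hη'
    have h2 : η * P.card ≤ η' * θ * P.card := mul_le_mul_of_nonneg_right hθ (Nat.cast_nonneg _)
    linarith
  have h2 := h R (hR.trans hP) h1
  have h3 := card_mono (filter_subset_filter (fun w => q * deg G w R < D) hB)
  have h4 : η' * (θ * B.card) ≤ η' * B'.card := mul_le_mul_of_nonneg_left hBc hη'
  have h5 : η * B.card ≤ η' * θ * B.card := mul_le_mul_of_nonneg_right hθ (Nat.cast_nonneg _)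
  linarith

end Basics

/-! ### Covering one set while sparing others. -/

section Cover

variable {V : Type u} {G : SimpleGraph V}

theorem card_nbrs_insert (v : V) (X T : Finset V) :
    ((nbrs G (insert v X) T).card : ℝ) = (nbrs G X T).card + deg G v (T \ nbrs G X T) := by
  have : nbrs G (insert v X) T =
      nbrs G X T ∪ (T \ nbrs G X T).filter fun w => G.Adj v w := by
    ext w
    simp only [mem_nbrs, mem_insert, mem_union, mem_filter, mem_sdiff]
    constructor
    · rintro ⟨h, x, rfl | hx, a⟩
      · by_cases h' : ∃ y ∈ X, G.Adj y w
        · exact Or.inl ⟨h, h'⟩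
        · exact Or.inr ⟨⟨h, fun h'' => h' h''.2⟩, a⟩
      · exact Or.inl ⟨h, x, hx, a⟩
    · rintro (⟨h, x, hx, a⟩ | ⟨⟨h, -⟩, a⟩)
      · exact ⟨h, x, Or.inr hx, a⟩
      · exact ⟨h, v, Or.inl rfl, a⟩
  rw [this, card_union_of_disjoint]
  · push_cast
    rfl
  · exact (disjoint_sdiff).mono_right (filter_subset _ _)

/-- If all degrees into `G₀` are about the same, then some subset of `G₀` covers a substantial part
of the target `T` but only a small part of each of the protected sets `S k`. -/
theorem exists_cover {α : Type*} {q D κ : ℝ} {G₀ T : Finset V} {J : Finset α} {S : α → Finset V}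
    (hq : 8 ≤ q) (hD : 0 < D) (hκ : 0 < κ) (hqJ : 8 * ((J.card : ℝ) + 1) ≤ κ * q)
    (hT : ∀ w ∈ T, D ≤ q * deg G w G₀) (hT' : ∀ w ∈ T, deg G w G₀ ≤ D)
    (hS : ∀ k ∈ J, ∀ w ∈ S k, deg G w G₀ ≤ D)
    (hl : ∀ v ∈ G₀, ∀ k ∈ J, 2 * ((J.card : ℝ) + 1) * deg G v (S k) ≤ κ * (S k).card)
    (hne : ∀ k ∈ J, (S k).Nonempty) :
    ∃ X ⊆ G₀, (T.card : ℝ) ≤ q ^ 2 * (nbrs G X T).card ∧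
      ∀ k ∈ J, ((nbrs G X (S k)).card : ℝ) ≤ κ * (S k).card := by
  -- The weight of `v` is the total proportion of the protected sets that it sees, so a set of total
  -- weight at most `κ` covers at most a fraction `κ` of each of them.
  set wt : V → ℝ := fun v => ∑ k ∈ J, deg G v (S k) / (S k).card with hwt
  have hpos : ∀ k ∈ J, (0 : ℝ) < (S k).card := fun k hk => by exact_mod_cast (hne k hk).card_pos
  have hwt0 : ∀ v, 0 ≤ wt v := fun v =>
    sum_nonneg fun k _ => div_nonneg (deg_nonneg _ _) (Nat.cast_nonneg _)
  have hJ0 : (0 : ℝ) ≤ J.card := Nat.cast_nonneg _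
  have hT0 : (0 : ℝ) ≤ T.card := Nat.cast_nonneg _
  -- Double counting bounds the total weight by |J|·D. This `M` makes the vertices outside `Gd`
  -- account for at most half of the lower bound |T|·D/q on the number of edges to `T`.
  set M : ℝ := 2 * (J.card + 1) * q with hM
  have hMpos : 0 < M := by positivity
  set Gd := G₀.filter fun v => wt v * T.card ≤ M * deg G v T with hGd
  have h1 : ∑ v ∈ G₀, wt v ≤ J.card * D := by
    rw [hwt, sum_comm]
    have : ∀ k ∈ J, ∑ v ∈ G₀, deg G v (S k) / (S k).card ≤ D := by
      intro k hk
      rw [← sum_div, sum_deg_comm, div_le_iff₀ (hpos k hk)]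
      refine (sum_le_sum (hS k hk)).trans ?_
      simp [mul_comm]
    refine (sum_le_sum this).trans ?_
    simp
  have h2 : (T.card : ℝ) * D ≤ 2 * q * ∑ v ∈ Gd, deg G v T := by
    have e1 : (T.card : ℝ) * D ≤ q * ∑ v ∈ G₀, deg G v T := by
      rw [sum_deg_comm, mul_sum]
      refine le_trans ?_ (sum_le_sum hT)
      simp
    have e2 : M * ∑ v ∈ G₀.filter (fun v => ¬ wt v * T.card ≤ M * deg G v T), deg G v T
        ≤ T.card * (J.card * D) := by
      rw [mul_sum]
      calc _ ≤ ∑ v ∈ G₀.filter (fun v => ¬ wt v * T.card ≤ M * deg G v T), wt v * T.card := by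
            refine sum_le_sum fun v hv => ?_
            have := (mem_filter.1 hv).2
            push Not at this
            exact this.le
        _ ≤ ∑ v ∈ G₀, wt v * T.card :=
            sum_le_sum_of_subset_of_nonneg (filter_subset _ _) fun v _ _ =>
              mul_nonneg (hwt0 v) hT0
        _ = (∑ v ∈ G₀, wt v) * T.card := by rw [sum_mul]
        _ ≤ _ := by nlinarith
    have e3 := sum_filter_add_sum_filter_not G₀ (fun v => wt v * T.card ≤ M * deg G v T)
      fun v => deg G v T
    rw [← e3] at e1
    set a := ∑ v ∈ Gd, deg G v T
    set b := ∑ v ∈ G₀.filter (fun v => ¬ wt v * T.card ≤ M * deg G v T), deg G v T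
    have e4 : (J.card + 1 : ℝ) * (2 * q * b) ≤ (J.card + 1) * (T.card * D) := by
      have : (0 : ℝ) ≤ T.card * D := by positivity
      nlinarith
    have e5 := le_of_mul_le_mul_left e4 (by linarith)
    nlinarith
  -- A maximal `X` with little overlap in `T` and total weight at most `κ`. If its weight exceeds
  -- κ/2, then it covers much of `T`, because its members have weight at most proportional to their
  -- degree into `T`.
  obtain ⟨X, hX, hmax⟩ := exists_max_image
    (Gd.powerset.filter fun X => ∑ v ∈ X, deg G v T ≤ 2 * (nbrs G X T).card ∧ ∑ v ∈ X, wt v ≤ κ)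
    (fun X => X.card) ⟨∅, by simp [hκ.le]⟩
  simp only [mem_filter, mem_powerset] at hX hmax
  obtain ⟨hXG, hX1, hX2⟩ := hX
  have hXG₀ : X ⊆ G₀ := hXG.trans (filter_subset _ _)
  have hN0 : (0 : ℝ) ≤ (nbrs G X T).card := Nat.cast_nonneg _
  refine ⟨X, hXG₀, ?_, ?_⟩
  · by_cases hc : κ / 2 < ∑ v ∈ X, wt v
    · have e1 : (∑ v ∈ X, wt v) * T.card ≤ M * ∑ v ∈ X, deg G v T := by
        rw [sum_mul, mul_sum]
        exact sum_le_sum fun v hv => (mem_filter.1 (hXG hv)).2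
      have e2 : κ / 2 * T.card ≤ M * (2 * (nbrs G X T).card) :=
        le_trans (mul_le_mul_of_nonneg_right hc.le hT0)
          (e1.trans (mul_le_mul_of_nonneg_left hX1 hMpos.le))
      have e3 : κ * T.card ≤ κ * (q ^ 2 * (nbrs G X T).card) := by
        have : 8 * ((J.card : ℝ) + 1) * (q * (nbrs G X T).card)
          ≤ κ * q * (q * (nbrs G X T).card) := mul_le_mul_of_nonneg_right hqJ (by positivity)
        rw [hM] at e2
        nlinarith
      exact le_of_mul_le_mul_left e3 hκ
    · push Not at hc
      -- A single vertex weighs at most κ/2, so the weight does not prevent adding `v`; overlap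
      -- must, so half of the neighbours of `v` in `T` are already covered. Counting edges into the
      -- covered part, at most `D` per vertex, shows that this part is large.
      have key : ∀ v ∈ Gd, deg G v T ≤ 2 * deg G v (nbrs G X T) := by
        intro v hv
        by_cases hvX : v ∈ X
        · have : deg G v T ≤ deg G v (nbrs G X T) := by
            refine card_mono fun w hw => ?_
            rw [mem_filter] at hw ⊢
            exact ⟨mem_nbrs.2 ⟨hw.1, v, hvX, hw.2⟩, hw.2⟩
          have := deg_nonneg (G := G) v (nbrs G X T)
          linarith
        · have hnv : ¬ (∑ v ∈ insert v X, deg G v T ≤ 2 * (nbrs G (insert v X) T).card ∧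
              ∑ v ∈ insert v X, wt v ≤ κ) := by
            intro h
            have := hmax (insert v X) ⟨insert_subset hv hXG, h⟩
            rw [card_insert_of_notMem hvX] at this
            omega
          rw [sum_insert hvX, sum_insert hvX, card_nbrs_insert] at hnv
          have hwv : wt v ≤ κ / 2 := by
            have : ∀ k ∈ J, deg G v (S k) / (S k).card ≤ κ / (2 * (J.card + 1)) := by
              intro k hk
              rw [div_le_div_iff₀ (hpos k hk) (by positivity)]
              have := hl v (filter_subset _ _ hv) k hk
              linarith
            refine (sum_le_sum this).trans ?_
            rw [sum_const, nsmul_eq_mul, mul_div_assoc', div_le_div_iff₀ (by positivity) (by norm_num)]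
            nlinarith
          have := not_and'.1 hnv (by linarith)
          have e := deg_add_deg_sdiff (G := G) (w := v) (nbrs_subset (G := G) X T)
          push Not at this
          linarith
      have e1 : ∑ v ∈ Gd, deg G v T ≤ 2 * ∑ v ∈ Gd, deg G v (nbrs G X T) := by
        rw [mul_sum]; exact sum_le_sum key
      have e2 : ∑ v ∈ Gd, deg G v (nbrs G X T) ≤ (nbrs G X T).card * D := by
        rw [sum_deg_comm]
        have : ∀ w ∈ nbrs G X T, deg G w Gd ≤ D := fun w hw =>
          (deg_mono (filter_subset _ _)).trans (hT' w (nbrs_subset _ _ hw))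
        refine (sum_le_sum this).trans ?_
        simp
      have e3 : D * (T.card : ℝ) ≤ D * (q ^ 2 * (nbrs G X T).card) := by
        have : 4 * q * ((nbrs G X T).card * D) ≤ q * q * ((nbrs G X T).card * D) :=
          mul_le_mul_of_nonneg_right (by nlinarith) (by positivity)
        have : 2 * q * ∑ v ∈ Gd, deg G v T ≤ 2 * q * (2 * ((nbrs G X T).card * D)) :=
          mul_le_mul_of_nonneg_left (by linarith) (by linarith)
        nlinarith
      exact le_of_mul_le_mul_left e3 hD
  · intro k hk
    refine (card_nbrs_le_sum X (S k)).trans ?_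
    have : ∑ v ∈ X, deg G v (S k) / (S k).card ≤ κ := by
      refine le_trans (sum_le_sum fun v _ => ?_) hX2
      exact single_le_sum (f := fun k => deg G v (S k) / (S k).card)
        (fun k _ => div_nonneg (deg_nonneg _ _) (Nat.cast_nonneg _)) hk
    rwa [← sum_div, div_le_iff₀ (hpos k hk)] at this

end Cover

/-! ### Making degrees regular. -/

section Regularize

variable {V : Type u} {G : SimpleGraph V}

/-- Where stability fails at `b`, there are large subsets of `P` and `S b` with all degrees below
q^(e b - 1). Passing to them lowers `e b` by one, so the sum of the exponents bounds the number of
rounds. An exponent 0 cannot fail: the degrees would be below 1, hence zero, and the two subsets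
would be a large anticomplete pair. -/
theorem exists_regular_of_sum_le {γ q η : ℝ} (hG : Coh G γ) (hq : 1 ≤ q) (hη : 0 < η) (hη1 : η ≤ 1)
    (I : Finset ℤ) (F : ℕ) : ∀ (P : Finset V) (S : ℤ → Finset V) (e : ℤ → ℕ),
    ∑ b ∈ I, e b ≤ F → (∀ b ∈ I, Disjoint P (S b)) →
    (∀ b ∈ I, ∀ w ∈ S b, deg G w P ≤ q ^ e b) → γ ≤ η ^ (F + 1) * P.card →
    (∀ b ∈ I, γ ≤ η ^ (F + 1) * (S b).card) →
    ∃ P' ⊆ P, ∃ (S' : ℤ → Finset V) (e' : ℤ → ℕ), (∀ b, S' b ⊆ S b) ∧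
      η ^ F * P.card ≤ P'.card ∧ ∀ b ∈ I, η ^ F * (S b).card ≤ (S' b).card ∧ e' b ≤ e b ∧
        (∀ w ∈ S' b, deg G w P' ≤ q ^ e' b) ∧ LowerStable G q P' (S' b) (q ^ e' b) η := by
  induction F with
  | zero =>
    intro P S e hF hd hdeg hP hS
    refine ⟨P, Subset.rfl, S, e, fun b => Subset.rfl, by simp, fun b hb => ⟨by simp, le_rfl,
      hdeg b hb, ?_⟩⟩
    have hF0 : e b = 0 := by
      have := single_le_sum (f := e) (fun _ _ => Nat.zero_le _) hb
      omega
    intro R hR hRc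
    by_contra hcon
    push Not at hcon
    refine hG R _ ((hd b hb).mono hR (filter_subset (fun w => q * deg G w R < q ^ e b) (S b)))
      ?_ ?_ ?_
    · intro x hx w hw
      have hw := (mem_filter.1 hw).2
      rw [hF0, pow_zero] at hw
      have h1 : deg G w R < 1 := by nlinarith [deg_nonneg (G := G) w R]
      rw [G.adj_comm]
      exact deg_eq_zero_of_lt_one h1 x hx
    · rw [zero_add, pow_one] at hP
      linarith
    · have := hS b hb
      rw [zero_add, pow_one] at this
      linarith
  | succ F ih =>
    intro P S e hF hd hdeg hP hS
    by_cases hst : ∀ b ∈ I, LowerStable G q P (S b) (q ^ e b) η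
    · have h1 : η ^ (F + 1) ≤ 1 := pow_le_one₀ hη.le hη1
      refine ⟨P, Subset.rfl, S, e, fun b => Subset.rfl, ?_, fun b hb => ⟨?_, le_rfl,
        hdeg b hb, hst b hb⟩⟩
      · exact mul_le_of_le_one_left (Nat.cast_nonneg _) h1
      · exact mul_le_of_le_one_left (Nat.cast_nonneg _) h1
    · unfold LowerStable at hst
      push Not at hst
      obtain ⟨b, hb, R, hR, hRc, hB⟩ := hst
      set B := (S b).filter fun w => q * deg G w R < q ^ e b with hBdef
      have hBS : B ⊆ S b := filter_subset _ _
      rcases Nat.eq_zero_or_pos (e b) with h0 | hpos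
      · exfalso
        have hp : η ^ (F + 1 + 1) ≤ η := by
          calc η ^ (F + 1 + 1) ≤ η ^ 1 := pow_le_pow_of_le_one hη.le hη1 (by omega)
            _ = η := pow_one _
        refine hG R B ((hd b hb).mono hR hBS) ?_ ?_ ?_
        · intro x hx w hw
          have hw := (mem_filter.1 hw).2
          rw [h0, pow_zero] at hw
          have h1 : deg G w R < 1 := by nlinarith [deg_nonneg (G := G) w R]
          rw [G.adj_comm]
          exact deg_eq_zero_of_lt_one h1 x hx
        · exact hP.trans ((mul_le_mul_of_nonneg_right hp (Nat.cast_nonneg _)).trans hRc)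
        · exact (hS b hb).trans ((mul_le_mul_of_nonneg_right hp (Nat.cast_nonneg _)).trans hB.le)
      · obtain ⟨k, hk⟩ : ∃ k, e b = k + 1 := ⟨e b - 1, by omega⟩
        have hup : ∀ c, Function.update S b B c ⊆ S c := by
          intro c
          by_cases h : c = b
          · subst h; simpa using hBS
          · simp [h]
        have hupc : ∀ c, η * (S c).card ≤ (Function.update S b B c).card := by
          intro c
          by_cases h : c = b
          · subst h; simpa using hB.le
          · simp only [ne_eq, h, not_false_eq_true, Function.update_of_ne]
            exact mul_le_of_le_one_left (Nat.cast_nonneg _) hη1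
        obtain ⟨P', hP', S', e', hS', hPc, hall⟩ := ih R (Function.update S b B)
          (Function.update e b k) (by
            rw [sum_update_of_mem hb]
            have := sum_sdiff (f := e) (singleton_subset_iff.2 hb)
            rw [sum_singleton] at this
            omega)
          (fun c hc => (hd c hc).mono hR (hup c))
          (by
            intro c hc w hw
            by_cases h : c = b
            · subst h
              simp only [Function.update_self] at hw ⊢
              have := (mem_filter.1 hw).2
              rw [hk, pow_succ'] at this
              exact (lt_of_mul_lt_mul_left this (by linarith)).le
            · simp only [ne_eq, h, not_false_eq_true, Function.update_of_ne] at hw ⊢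
              exact (deg_mono hR).trans (hdeg c hc w hw))
          (by
            refine hP.trans ?_
            rw [pow_succ η (F + 1), mul_assoc]
            exact mul_le_mul_of_nonneg_left hRc (by positivity))
          (by
            intro c hc
            refine (hS c hc).trans ?_
            rw [pow_succ η (F + 1), mul_assoc]
            exact mul_le_mul_of_nonneg_left (hupc c) (by positivity))
        refine ⟨P', hP'.trans hR, S', e', fun c => (hS' c).trans (hup c), ?_, fun c hc => ?_⟩
        · refine le_trans ?_ hPc
          rw [pow_succ η F, mul_assoc]
          exact mul_le_mul_of_nonneg_left hRc (by positivity)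
        · obtain ⟨h1, h2, h3⟩ := hall c hc
          refine ⟨?_, h2.trans ?_, h3⟩
          · refine le_trans ?_ h1
            rw [pow_succ η F, mul_assoc]
            exact mul_le_mul_of_nonneg_left (hupc c) (by positivity)
          · by_cases h : c = b
            · subst h; simp; omega
            · simp [h]

/-- After passing to large subsets, the degrees from many of the sets `S b` into `P` are all
about the same, robustly. -/
theorem exists_regular {γ q η : ℝ} (hG : Coh G γ) (hq : 1 ≤ q) (hη : 0 < η) (hη1 : η ≤ 1)
    {E k N : ℕ} (hN : N = (E + 1) * k * E) {I : Finset ℤ} (hI : (E + 1) * k ≤ I.card)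
    {P : Finset V} {S : ℤ → Finset V} (hd : ∀ b ∈ I, Disjoint P (S b))
    (hdeg : ∀ b ∈ I, ∀ w ∈ S b, deg G w P ≤ q ^ E) (hP : γ ≤ η ^ (N + 1) * P.card)
    (hS : ∀ b ∈ I, γ ≤ η ^ (N + 1) * (S b).card) :
    ∃ I' ⊆ I, I'.card = k ∧ ∃ P' ⊆ P, ∃ (S' : ℤ → Finset V) (D : ℝ), 0 < D ∧ (∀ b, S' b ⊆ S b) ∧
      η ^ N * P.card ≤ P'.card ∧ (∀ b, η ^ N * (S b).card ≤ (S' b).card) ∧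
      ∀ b ∈ I', (∀ w ∈ S' b, deg G w P' ≤ D) ∧ LowerStable G q P' (S' b) D η := by
  obtain ⟨I₀, hI₀, hc⟩ := exists_subset_card_eq hI
  obtain ⟨P', hP', S', e', hS', hPc, hall⟩ := exists_regular_of_sum_le hG hq hη hη1 I₀ N P S
    (fun _ => E) (by simp [hc, hN]) (fun b hb => hd b (hI₀ hb)) (fun b hb => hdeg b (hI₀ hb)) hP
    (fun b hb => hS b (hI₀ hb))
  -- There are E + 1 possible final exponents, so `k` of the (E + 1)k sets share one, and a common
  -- `D` serves them.
  obtain ⟨e, -, he⟩ := exists_le_card_fiber_of_mul_le_card_of_maps_to (s := I₀) (t := range (E + 1))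
    (f := e') (n := k) (fun b hb => mem_range.2 (Nat.lt_succ_of_le (hall b hb).2.1)) (by simp)
    (by simp [hc])
  obtain ⟨I', hI', hc'⟩ := exists_subset_card_eq he
  have hmem : ∀ b ∈ I', b ∈ I₀ ∧ e' b = e := fun b hb => mem_filter.1 (hI' hb)
  refine ⟨I', fun b hb => hI₀ (hmem b hb).1, hc', P', hP', fun b => if b ∈ I₀ then S' b else S b,
    q ^ e, by positivity, ?_, hPc, ?_, ?_⟩
  · intro b
    by_cases h : b ∈ I₀
    · simp [h, hS' b]
    · simp [h]
  · intro b
    by_cases h : b ∈ I₀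
    · simp [h, (hall b h).1]
    · simp only [h, if_false]
      exact mul_le_of_le_one_left (Nat.cast_nonneg _) (pow_le_one₀ hη.le hη1)
  · intro b hb
    obtain ⟨h, rfl⟩ := hmem b hb
    simp only [h, if_true]
    exact (hall b h).2.2

/-- As `exists_regular`, and moreover all sets have small maximum degree into `P`. -/
theorem exists_regular_clean {γ q η a : ℝ} (hG : Coh G γ) (hq : 1 ≤ q) (hη : 0 < η) (hη1 : η ≤ 1)
    (ha : 0 < a) {E k N : ℕ} (hN : N = (E + 1) * k * E) {I U : Finset ℤ}
    (hU : (E + 1) * k ≤ U.card) (hUI : U ⊆ I)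
    {P : Finset V} {S : ℤ → Finset V} (hd : ∀ b ∈ I, Disjoint P (S b)) (hne : P.Nonempty)
    (hdeg : ∀ b ∈ I, ∀ w ∈ S b, deg G w P ≤ q ^ E)
    (hl : ∀ b ∈ I, ∀ v ∈ P, deg G v (S b) ≤ a * (S b).card)
    (hP : γ ≤ η ^ (N + 1) * P.card)
    (hS : ∀ b ∈ I, γ ≤ η ^ (N + 1) / 2 * (S b).card) :
    ∃ U' ⊆ U, U'.card = k ∧ ∃ P' ⊆ P, ∃ (S' : ℤ → Finset V) (D : ℝ), 0 < D ∧ (∀ b, S' b ⊆ S b) ∧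
      η ^ N * P.card ≤ P'.card ∧
      (∀ b ∈ I, η ^ N / 2 * (S b).card ≤ (S' b).card ∧
        ∀ w ∈ S' b, deg G w P' ≤ 2 * a / η ^ N * P'.card) ∧
      ∀ b ∈ U', (∀ w ∈ S' b, deg G w P' ≤ D) ∧ LowerStable G q P' (S' b) D η := by
  -- Vertices heavy towards `P` are removed beforehand, at the cost of half of each set. `P` may
  -- still shrink by η^N afterwards, whence the constant 2a/η^N.
  set T : ℤ → Finset V := fun b => (S b).filter fun w => deg G w P ≤ 2 * a * P.card with hT
  have hTS : ∀ b, T b ⊆ S b := fun b => filter_subset _ _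
  have hTc : ∀ b ∈ I, ((S b).card : ℝ) / 2 ≤ (T b).card := fun b hb =>
    half_le_card_light ha hne (hl b hb)
  have hpw : 0 < η ^ N := by positivity
  obtain ⟨U', hU', hc, P', hP', S', D, hD, hS', hPc, hSc, hall⟩ := exists_regular hG hq hη hη1 hN hU
    (P := P) (S := T) (fun b hb => (hd b (hUI hb)).mono_right (hTS b))
    (fun b hb w hw => hdeg b (hUI hb) w (hTS b hw)) hP (fun b hb => by
      have h1 := hS b (hUI hb)
      have h2 : η ^ (N + 1) * ((S b).card / 2) ≤ η ^ (N + 1) * (T b).card :=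
        mul_le_mul_of_nonneg_left (hTc b (hUI hb)) (by positivity)
      linarith)
  refine ⟨U', hU', hc, P', hP', S', D, hD, fun b => (hS' b).trans (hTS b), hPc, ?_, hall⟩
  intro b hb
  constructor
  · refine le_trans ?_ (hSc b)
    have := mul_le_mul_of_nonneg_left (hTc b hb) hpw.le
    linarith
  · intro w hw
    have h1 := (mem_filter.1 (hS' b hw)).2
    have h2 := deg_mono (G := G) (w := w) hP'
    have h3 : (P.card : ℝ) ≤ P'.card / η ^ N := by
      rw [le_div_iff₀ hpw]; linarith
    have h4 : 2 * a * P.card ≤ 2 * a * (P'.card / η ^ N) :=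
      mul_le_mul_of_nonneg_left h3 (by linarith)
    calc deg G w P' ≤ 2 * a * (P'.card / η ^ N) := by linarith
      _ = _ := by ring

end Regularize

/-! ### Deleting the sets that do not expand. -/

section Expanding

variable {V : Type u} {G : SimpleGraph V}

/-- Deleting a few vertices from each set makes all small sets expand by a factor `g`. -/
theorem exists_expanding {γ g : ℝ} (hG : Coh G γ) (hγ : 0 < γ) (hg : 0 ≤ g) {I : Finset ℤ}
    {S : ℤ → Finset V} (hd : ∀ i ∈ I, ∀ j ∈ I, i ≠ j → Disjoint (S i) (S j))
    (hm : ∀ b ∈ I, (2 * I.card + 2 * g + 1) * γ ≤ (S b).card) :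
    ∃ S' : ℤ → Finset V, (∀ b, S' b ⊆ S b) ∧
      (∀ b ∈ I, ((S b).card : ℝ) - 2 * I.card * γ ≤ (S' b).card) ∧
      ∀ i ∈ I, ∀ j ∈ I, i ≠ j → ∀ X ⊆ S' i, (X.card : ℝ) ≤ γ →
        g * X.card ≤ (nbrs G X (S' j)).card := by
  set R : (ℤ → ℤ → Finset V) → ℤ → Finset V := fun D b => S b \ I.biUnion (D b) with hR
  -- `D i j` collects vertices of `S i` that expand badly into what remains of `S j`. A system of
  -- largest total size is taken; the bound 2γ leaves room to add a set of size at most γ to one of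
  -- size below γ.
  set valid : (ℤ → ℤ → Finset V) → Prop := fun D => ∀ i ∈ I, D i i = ∅ ∧ ∀ j ∈ I, i ≠ j →
    D i j ⊆ S i ∧ ((D i j).card : ℝ) ≤ 2 * γ ∧
      ((nbrs G (D i j) (R D j)).card : ℝ) ≤ g * (D i j).card with hvalid
  have hcard : ∀ D, valid D → ∀ i ∈ I, ∀ j ∈ I, ((D i j).card : ℝ) ≤ 2 * γ := by
    intro D hD i hi j hj
    by_cases h : i = j
    · subst h
      rw [(hD i hi).1]
      simp only [card_empty, Nat.cast_zero]
      linarith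
    · exact ((hD i hi).2 j hj h).2.1
  have hRc : ∀ D, valid D → ∀ b ∈ I, ((S b).card : ℝ) - 2 * I.card * γ ≤ (R D b).card := by
    intro D hD b hb
    have h1 : ((I.biUnion (D b)).card : ℝ) ≤ 2 * I.card * γ := by
      have : ((I.biUnion (D b)).card : ℝ) ≤ ∑ j ∈ I, ((D b j).card : ℝ) := by
        exact_mod_cast card_biUnion_le
      refine this.trans ((sum_le_sum (hcard D hD b hb)).trans ?_)
      rw [sum_const, nsmul_eq_mul]
      linarith
    have h2 : ((S b).card : ℝ) ≤ (R D b).card + (I.biUnion (D b)).card := by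
      have := card_le_card_sdiff_add_card (s := S b) (t := I.biUnion (D b))
      exact_mod_cast this
    linarith
  set meas : (ℤ → ℤ → Finset V) → ℕ := fun D => ∑ i ∈ I, ∑ j ∈ I, (D i j).card with hmeas
  have hbdd : BddAbove {k | ∃ D, valid D ∧ meas D = k} := by
    refine ⟨I.card * (I.card * ⌈2 * γ⌉₊), ?_⟩
    rintro k ⟨D, hD, rfl⟩
    refine (sum_le_sum fun i hi => (sum_le_sum (g := fun _ => ⌈2 * γ⌉₊) fun j hj => ?_)).trans
      (by simp)
    exact_mod_cast (hcard D hD i hi j hj).trans (Nat.le_ceil _)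
  have hne : {k | ∃ D, valid D ∧ meas D = k}.Nonempty :=
    ⟨_, fun _ _ => ∅, fun i hi => ⟨rfl, fun j hj hij => by simp [nbrs, hγ.le]⟩, rfl⟩
  obtain ⟨D, hD, hDm⟩ := Nat.sSup_mem hne hbdd
  have hmax : ∀ D', valid D' → meas D' ≤ meas D := by
    intro D' hD'
    rw [hDm]
    exact le_csSup hbdd ⟨D', hD', rfl⟩
  -- A set of size at least γ covers all but γ of the rest of `S j`, which is more than the bound
  -- g·2γ on its neighbours allows.
  have hsmall : ∀ i ∈ I, ∀ j ∈ I, i ≠ j → ((D i j).card : ℝ) < γ := by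
    intro i hi j hj hij
    by_contra hcon
    push Not at hcon
    obtain ⟨h1, h2, h3⟩ := (hD i hi).2 j hj hij
    have hdis : Disjoint (D i j) (R D j) := (hd i hi j hj hij).mono h1 sdiff_subset
    have h4 := hG.card_sdiff_nbrs_lt hdis hcon
    have h5 := card_add_sdiff_nbrs (G := G) (D i j) (R D j)
    have h6 := hRc D hD j hj
    have h7 := hm j hj
    have h8 : g * (D i j).card ≤ g * (2 * γ) := mul_le_mul_of_nonneg_left h2 hg
    linarith
  refine ⟨R D, fun b => sdiff_subset, hRc D hD, ?_⟩
  intro i hi j hj hij X hX hXc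
  by_contra hcon
  push Not at hcon
  have hXS : X ⊆ S i := hX.trans sdiff_subset
  have hXD : Disjoint (D i j) X := by
    rw [disjoint_left]
    intro x hx hx'
    exact (mem_sdiff.1 (hX hx')).2 (mem_biUnion.2 ⟨j, hj, hx⟩)
  -- A small `X` that fails to expand can be added to `D i j`: the remaining sets only shrink, so no
  -- other condition is spoiled. This contradicts maximality.
  set D' : ℤ → ℤ → Finset V := fun a b => if a = i ∧ b = j then D i j ∪ X else D a b with hD'
  have hDD' : ∀ a b, D a b ⊆ D' a b := by
    intro a b
    by_cases h : a = i ∧ b = j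
    · obtain ⟨rfl, rfl⟩ := h
      simp [hD']
    · simp [hD', h]
  have hRR' : ∀ b, R D' b ⊆ R D b := fun b =>
    sdiff_subset_sdiff Subset.rfl (biUnion_mono fun a _ => hDD' b a)
  have hv : valid D' := by
    intro a ha
    refine ⟨?_, fun b hb hab => ?_⟩
    · have : ¬ (a = i ∧ a = j) := fun h => hij (h.1.symm.trans h.2)
      simp only [hD', this, if_false]
      exact (hD a ha).1
    · obtain ⟨h1, h2, h3⟩ := (hD a ha).2 b hb hab
      by_cases h : a = i ∧ b = j
      · obtain ⟨rfl, rfl⟩ := h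
        simp only [hD', and_self, if_true]
        have hcu : ((D a b ∪ X).card : ℝ) = (D a b).card + X.card := by
          exact_mod_cast card_union_of_disjoint hXD
        refine ⟨union_subset h1 hXS, ?_, ?_⟩
        · have := hsmall a ha b hb hab
          linarith
        · refine (card_nbrs_union_le _ _ _).trans ?_
          have e1 := card_mono (nbrs_mono (G := G) (Subset.refl (D a b)) (hRR' b))
          have e2 := card_mono (nbrs_mono (G := G) (Subset.refl X) (hRR' b))
          rw [hcu, mul_add]
          linarith
      · simp only [hD', h, if_false]
        exact ⟨h1, h2, (card_mono (nbrs_mono Subset.rfl (hRR' b))).trans h3⟩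
  have hlt : meas D < meas D' := by
    refine sum_lt_sum (fun a _ => sum_le_sum fun b _ => card_le_card (hDD' a b)) ⟨i, hi, ?_⟩
    refine sum_lt_sum (fun b _ => card_le_card (hDD' i b)) ⟨j, hj, ?_⟩
    simp only [hD', and_self, if_true]
    rw [card_union_of_disjoint hXD]
    have : X.card ≠ 0 := by
      intro h0
      rw [h0] at hcon
      simp only [Nat.cast_zero, mul_zero] at hcon
      exact absurd hcon (not_lt.2 (Nat.cast_nonneg _))
    omega
  exact absurd (hmax D' hv) (not_le.2 hlt)

end Expanding

/-! ### Growing induced rainbow trees. -/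

section Tree

variable {V : Type u} {G : SimpleGraph V}

/-- `f 0, …, f L` are the vertices in order of an induced path. -/
def IsIndPath (G : SimpleGraph V) (f : ℕ → V) (L : ℕ) : Prop :=
  (∀ a ≤ L, ∀ b ≤ L, f a = f b → a = b) ∧
    ∀ a ≤ L, ∀ b ≤ L, G.Adj (f a) (f b) ↔ (a + 1 = b ∨ b + 1 = a)

/-- There is an induced rainbow path of length `i` from `z` to `y`, with all vertices
except `y` in `R`. -/
def TreePath (G : SimpleGraph V) (col : V → ℤ) (z : V) (R : Finset V) (i : ℕ) (y : V) : Prop :=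
  ∃ f : ℕ → V, IsIndPath G f i ∧ f 0 = z ∧ f i = y ∧ (∀ j < i, f j ∈ R) ∧
    ∀ j ≤ i, ∀ k ≤ i, col (f j) = col (f k) → j = k

theorem TreePath.extend {col : V → ℤ} {z : V} {R X : Finset V} {i : ℕ} {x w : V}
    (h : TreePath G col z R i x) (hx : x ∈ X) (hxw : G.Adj x w) (hR : ∀ v ∈ R, ¬ G.Adj v w)
    (hc : ∀ v ∈ R, col v ≠ col w) (hcx : col x ≠ col w) : TreePath G col z (R ∪ X) (i + 1) w := by
  obtain ⟨f, ⟨hinj, hadj⟩, h0, hi, hfR, hcol⟩ := h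
  have hlow : ∀ j ≤ i, (if j ≤ i then f j else w) = f j := fun j hj => if_pos hj
  have htop : (if i + 1 ≤ i then f (i + 1) else w) = w := if_neg (by omega)
  have hcw : ∀ j ≤ i, col (f j) ≠ col w := by
    intro j hj
    rcases hj.lt_or_eq with h | rfl
    · exact hc _ (hfR j h)
    · rw [hi]; exact hcx
  have hcol' : ∀ j ≤ i + 1, ∀ k ≤ i + 1, col (if j ≤ i then f j else w) =
      col (if k ≤ i then f k else w) → j = k := by
    intro j hj k hk he
    rcases Nat.le_succ_iff.1 hj with hj | rfl <;> rcases Nat.le_succ_iff.1 hk with hk | rfl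
    · rw [hlow j hj, hlow k hk] at he
      exact hcol j hj k hk he
    · rw [hlow j hj, htop] at he
      exact absurd he (hcw j hj)
    · rw [hlow k hk, htop] at he
      exact absurd he.symm (hcw k hk)
    · rfl
  have hadjw : ∀ j ≤ i, G.Adj (f j) w ↔ j = i := by
    intro j hj
    constructor
    · intro h
      by_contra hne
      exact hR _ (hfR j (by omega)) h
    · rintro rfl
      rw [hi]; exact hxw
  refine ⟨fun j => if j ≤ i then f j else w, ⟨?_, ?_⟩, ?_, htop, ?_, hcol'⟩
  · intro j hj k hk he
    exact hcol' j hj k hk (congrArg col he)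
  · intro j hj k hk
    simp only
    rcases Nat.le_succ_iff.1 hj with hj | rfl <;> rcases Nat.le_succ_iff.1 hk with hk | rfl
    · rw [hlow j hj, hlow k hk]
      exact hadj j hj k hk
    · rw [hlow j hj, htop, hadjw j hj]
      omega
    · rw [hlow k hk, htop, G.adj_comm, hadjw k hk]
      omega
    · simp
  · simp [h0]
  · intro j hj
    have hji : j ≤ i := by omega
    simp only [hji, if_true, mem_union]
    rcases hji.lt_or_eq with h | rfl
    · exact Or.inl (hfR j h)
    · rw [hi]; exact Or.inr hx

/-- A partially grown tree of depth `i`, rooted at `z`: `Low` is the union of its lower levels, and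
`Top` is its top level. -/
structure TreeState (G : SimpleGraph V) (col : V → ℤ) (z : V) (I : Finset ℤ) (S : ℤ → Finset V)
    (κ : ℝ) (i : ℕ) (used : Finset ℤ) (Low Top : Finset V) : Prop where
  used_subset : used ⊆ I
  card_used : used.card = i
  low : ∀ v ∈ Low, v = z ∨ ∃ b ∈ used, v ∈ S b
  path : ∀ y ∈ Top, TreePath G col z Low i y
  cover : ∀ b ∈ I, b ∉ used → ((nbrs G Low (S b)).card : ℝ) ≤ κ * 4 ^ i * (S b).card

/-- The new top level consists of the vertices with a neighbour in `X` but none in the lower levels,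
so the extended paths stay induced. The factor 4^i absorbs the recursion, since κ4^i + (2κ4^i + κ) ≤
κ4^(i+1). -/
theorem TreeState.extend {col : V → ℤ} {z : V} {I : Finset ℤ} {S : ℤ → Finset V} {κ : ℝ} {i : ℕ}
    {used : Finset ℤ} {Low Top : Finset V} (h : TreeState G col z I S κ i used Low Top)
    (hcol : ∀ b ∈ I, ∀ v ∈ S b, col v = b) (hz : col z ∉ I) {X : Finset V} (hX : X ⊆ Top)
    (hTop : ∀ v ∈ Top, v = z ∨ ∃ b ∈ used, v ∈ S b) {b : ℤ} (hb : b ∈ I) (hbu : b ∉ used)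
    (hκ : 0 < κ)
    (hc : ∀ b' ∈ I, b' ∉ used → ((nbrs G X (S b')).card : ℝ) ≤ (2 * κ * 4 ^ i + κ) * (S b').card) :
    TreeState G col z I S κ (i + 1) (insert b used) (Low ∪ X)
      (nbrs G X (S b) \ nbrs G Low (S b)) where
  used_subset := insert_subset hb h.used_subset
  card_used := by rw [card_insert_of_notMem hbu, h.card_used]
  low := by
    have aux : ∀ v, (v = z ∨ ∃ b ∈ used, v ∈ S b) → (v = z ∨ ∃ c ∈ insert b used, v ∈ S c) := by
      rintro v (h | ⟨c, hc, h⟩)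
      · exact Or.inl h
      · exact Or.inr ⟨c, mem_insert_of_mem hc, h⟩
    intro v hv
    rcases mem_union.1 hv with hv | hv
    · exact aux v (h.low v hv)
    · exact aux v (hTop v (hX hv))
  path := by
    intro w hw
    obtain ⟨hw1, hw2⟩ := mem_sdiff.1 hw
    obtain ⟨hwS, x, hx, hxw⟩ := mem_nbrs.1 hw1
    have aux : ∀ v, (v = z ∨ ∃ b ∈ used, v ∈ S b) → col v ≠ col w := by
      rintro v hv he
      rw [hcol b hb w hwS] at he
      rcases hv with rfl | ⟨c, hc, hv⟩
      · exact hz (he ▸ hb)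
      · rw [hcol c (h.used_subset hc) v hv] at he
        exact hbu (he ▸ hc)
    refine (h.path x (hX hx)).extend hx hxw ?_ (fun v hv => aux v (h.low v hv))
      (aux x (hTop x (hX hx)))
    intro v hv hvw
    exact hw2 (mem_nbrs.2 ⟨hwS, v, hv, hvw⟩)
  cover := by
    intro b' hb' hbu'
    rw [mem_insert, not_or] at hbu'
    have h1 := h.cover b' hb' hbu'.2
    have h2 := hc b' hb' hbu'.2
    have h3 := card_nbrs_union_le (G := G) Low X (S b')
    have h4 : κ * 4 ^ i + (2 * κ * 4 ^ i + κ) ≤ κ * 4 ^ (i + 1) := by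
      have : (1 : ℝ) ≤ 4 ^ i := one_le_pow₀ (by norm_num)
      rw [pow_succ]
      nlinarith
    have h5 := mul_le_mul_of_nonneg_right h4 (Nat.cast_nonneg (α := ℝ) (S b').card)
    linarith

/-- Growing an induced tree from the root `z` to depth exactly `i`, through expanding sets `S b`
(`b ∈ I`); the tree may also pass through the sets `S b` with `b ∈ J`. -/
theorem exists_tree {γ g κ : ℝ} (hG : Coh G γ) (hγ : 0 < γ) {col : V → ℤ} {z : V}
    {I J : Finset ℤ} {S : ℤ → Finset V} (hcol : ∀ b ∈ I ∪ J, ∀ v ∈ S b, col v = b)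
    (hz : col z ∉ I ∪ J) {s t : ℕ} (ht : 1 ≤ t) (hκ : 0 < κ) (hκs : κ * 4 ^ (s + 1) ≤ 1)
    (hlk : ∀ a ∈ I ∪ J, ∀ b ∈ I ∪ J, a ≠ b → ∀ v ∈ S a, deg G v (S b) ≤ κ * (S b).card)
    (hlkz : ∀ b ∈ I ∪ J, deg G z (S b) ≤ κ * (S b).card)
    (hexp : ∀ a ∈ I, ∀ b ∈ I, a ≠ b → ∀ X ⊆ S a, (X.card : ℝ) ≤ γ →
      (g + s) * X.card ≤ (nbrs G X (S b)).card)
    (hexpz : ∀ b ∈ I, g + s ≤ deg G z (S b)) (hg : 1 ≤ g) (hgt : γ ≤ g ^ (t - 1))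
    (hsz : ∀ b ∈ I ∪ J, γ ≤ κ * (S b).card) (hI : s < I.card) :
    ∀ i ≤ s, ∃ used Low Top, TreeState G col z (I ∪ J) S κ i used Low Top ∧
      ((∃ b ∈ used, Top ⊆ S b ∧ κ * (S b).card ≤ Top.card) ∨
        (i < t ∧ ((i = 0 ∧ Top = {z}) ∨ ∃ b ∈ used, b ∈ I ∧ Top ⊆ S b) ∧ g ^ i ≤ Top.card ∧
          ∀ b ∈ I, b ∉ used → ((nbrs G Low (S b)).card : ℝ) ≤ i * Top.card)) := by
  have hnep : ∀ b ∈ I ∪ J, (0 : ℝ) < (S b).card := by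
    intro b hb
    have := hsz b hb
    by_contra hc
    have : κ * (S b).card ≤ 0 := mul_nonpos_of_nonneg_of_nonpos hκ.le (not_lt.1 hc)
    linarith
  intro i
  induction i with
  | zero =>
    intro _
    refine ⟨∅, ∅, {z}, ⟨by simp, by simp, by simp, ?_, ?_⟩, Or.inr ⟨by omega, Or.inl ⟨rfl, rfl⟩,
      by simp, ?_⟩⟩
    · intro y hy
      rw [mem_singleton] at hy
      subst hy
      refine ⟨fun _ => y, ⟨?_, ?_⟩, rfl, rfl, by simp, by simp⟩
      · intro a ha b hb _
        omega
      · intro a ha b hb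
        simp only [SimpleGraph.irrefl, false_iff]
        omega
    · intro b hb _
      simp only [nbrs, notMem_empty, false_and, exists_false, filter_false, card_empty,
        Nat.cast_zero]
      positivity
    · intro b hb _
      simp [nbrs]
  | succ i ih =>
    intro his
    obtain ⟨used, Low, Top, hst, hphase⟩ := ih (by omega)
    have hTop : ∀ v ∈ Top, v = z ∨ ∃ b ∈ used, v ∈ S b := by
      intro v hv
      rcases hphase with ⟨b, hb, hT, -⟩ | ⟨-, ⟨-, hT⟩ | ⟨b, hb, -, hT⟩, -⟩
      · exact Or.inr ⟨b, hb, hT hv⟩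
      · rw [hT, mem_singleton] at hv
        exact Or.inl hv
      · exact Or.inr ⟨b, hb, hT hv⟩
    have hdegTop : ∀ v ∈ Top, ∀ b ∈ I ∪ J, b ∉ used → deg G v (S b) ≤ κ * (S b).card := by
      intro v hv b hb hbu
      rcases hTop v hv with rfl | ⟨c, hc, hvc⟩
      · exact hlkz b hb
      · exact hlk c (hst.used_subset hc) b hb (by rintro rfl; exact hbu hc) v hvc
    have h4i : (1 : ℝ) ≤ 4 ^ i := one_le_pow₀ (by norm_num)
    have hτ : 4 * (κ * 4 ^ i) ≤ 1 := by
      have : (4 : ℝ) ^ (i + 1) ≤ 4 ^ (s + 1) := pow_le_pow_right₀ (by norm_num) (by omega)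
      have := mul_le_mul_of_nonneg_left this hκ.le
      rw [pow_succ] at this
      linarith
    -- If the top covers much of some unused set, the next level can be made a fixed fraction of a
    -- set. Otherwise coherence forces the top below γ, so the tree is still in its small phase and
    -- expansion applies.
    by_cases hcase : ∃ b ∈ I ∪ J, b ∉ used ∧
        2 * κ * 4 ^ i * (S b).card ≤ (nbrs G Top (S b)).card
    · obtain ⟨b₀, hb₀, hbu₀, hb₀'⟩ := hcase
      -- Minimality over all unused sets simultaneously: without one vertex, `X` is below the
      -- threshold everywhere, and that vertex contributes at most κ. Hence the chosen level covers
      -- little of every unused set.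
      obtain ⟨X, hX, hmin⟩ := exists_min_image
        (Top.powerset.filter fun X => ∃ b ∈ I ∪ J, b ∉ used ∧
          2 * κ * 4 ^ i * (S b).card ≤ (nbrs G X (S b)).card) (fun X => X.card)
        ⟨Top, by simp only [mem_filter, mem_powerset, Subset.refl, true_and]
                 exact ⟨b₀, hb₀, hbu₀, hb₀'⟩⟩
      simp only [mem_filter, mem_powerset] at hX hmin
      obtain ⟨hXT, b, hb, hbu, hbX⟩ := hX
      have hXne : X.Nonempty := by
        rw [nonempty_iff_ne_empty]
        rintro rfl
        simp only [nbrs, notMem_empty, false_and, exists_false, filter_false, card_empty,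
          Nat.cast_zero] at hbX
        have := hnep b hb
        have : 0 < 2 * κ * 4 ^ i * (S b).card := by positivity
        linarith
      obtain ⟨x, hx⟩ := hXne
      have hXc : ∀ b' ∈ I ∪ J, b' ∉ used →
          ((nbrs G X (S b')).card : ℝ) ≤ (2 * κ * 4 ^ i + κ) * (S b').card := by
        intro b' hb' hbu'
        have h1 : ((nbrs G (X.erase x) (S b')).card : ℝ) < 2 * κ * 4 ^ i * (S b').card := by
          by_contra hcon
          have := hmin (X.erase x) ⟨(erase_subset _ _).trans hXT, b', hb', hbu', not_lt.1 hcon⟩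
          rw [card_erase_of_mem hx] at this
          have := card_pos.2 ⟨x, hx⟩
          omega
        have h2 := card_nbrs_union_le (G := G) {x} (X.erase x) (S b')
        rw [← insert_eq, insert_erase hx, card_nbrs_singleton] at h2
        have h3 := hdegTop x (hXT hx) b' hb' hbu'
        linarith
      refine ⟨_, _, _, hst.extend hcol hz hXT hTop hb hbu hκ hXc, Or.inl ⟨b, mem_insert_self _ _,
        sdiff_subset.trans (nbrs_subset _ _), ?_⟩⟩
      have h1 := hst.cover b hb hbu
      have h2 : ((nbrs G X (S b)).card : ℝ) ≤
          (nbrs G X (S b) \ nbrs G Low (S b)).card + (nbrs G Low (S b)).card := by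
        exact_mod_cast card_le_card_sdiff_add_card
      have h3 : κ * (S b).card ≤ κ * 4 ^ i * (S b).card :=
        mul_le_mul_of_nonneg_right (by nlinarith) (Nat.cast_nonneg _)
      linarith
    · push Not at hcase
      obtain ⟨b₁, hb₁, hbu₁⟩ : ∃ b ∈ I, b ∉ used := by
        by_contra hcon
        push Not at hcon
        have := card_le_card (show I ⊆ used from hcon)
        rw [hst.card_used] at this
        omega
      have hdis : ∀ b ∈ I ∪ J, b ∉ used → Disjoint Top (S b) := by
        intro b hb hbu
        rw [disjoint_left]
        intro v hv hvb
        have e1 := hcol b hb v hvb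
        rcases hTop v hv with rfl | ⟨c, hc, hvc⟩
        · exact hz (e1 ▸ hb)
        · have e2 := hcol c (hst.used_subset hc) v hvc
          exact hbu (by rw [← e1, e2]; exact hc)
      have hTlt : (Top.card : ℝ) < γ := by
        by_contra hcon
        have hb₁' := mem_union_left J hb₁
        have h1 := hG.card_sdiff_nbrs_lt (hdis b₁ hb₁' hbu₁) (not_lt.1 hcon)
        have h2 := card_add_sdiff_nbrs (G := G) Top (S b₁)
        have h3 := hcase b₁ hb₁' hbu₁
        have h4 := hsz b₁ hb₁'
        have h5 := mul_le_mul_of_nonneg_right hτ (Nat.cast_nonneg (α := ℝ) (S b₁).card)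
        have h6 := mul_le_mul_of_nonneg_right (mul_le_mul_of_nonneg_left h4i hκ.le)
          (Nat.cast_nonneg (α := ℝ) (S b₁).card)
        nlinarith
      rcases hphase with ⟨b, hb, hT, hTc⟩ | ⟨hit, hT, hgT, hL⟩
      · have := hsz b (hst.used_subset hb)
        linarith
      · have hit' : i + 1 < t := by
          by_contra hcon
          have : i = t - 1 := by omega
          rw [← this] at hgt
          linarith
        -- Taking the set that receives most new neighbours keeps the number of neighbours of the
        -- lower levels in any unused set of `I` at most i times the size of the top. The extra `s`
        -- in the expansion factor pays for deleting them.
        obtain ⟨b, hbmem, hbmax⟩ := exists_max_image (I \ used)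
          (fun b => (nbrs G Top (S b) \ nbrs G Low (S b)).card) ⟨b₁, mem_sdiff.2 ⟨hb₁, hbu₁⟩⟩
        obtain ⟨hb, hbu⟩ := mem_sdiff.1 hbmem
        have hT0 : (0 : ℝ) ≤ Top.card := Nat.cast_nonneg _
        have hexpand : (g + s) * Top.card ≤ (nbrs G Top (S b)).card := by
          rcases hT with ⟨-, rfl⟩ | ⟨c, hc, hcI, hTc⟩
          · rw [card_nbrs_singleton]
            simpa using hexpz b hb
          · exact hexp c hcI b hb (by rintro rfl; exact hbu hc) Top hTc hTlt.le
        have hTop' : g * Top.card ≤ (nbrs G Top (S b) \ nbrs G Low (S b)).card := by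
          have h2 : ((nbrs G Top (S b)).card : ℝ) ≤
              (nbrs G Top (S b) \ nbrs G Low (S b)).card + (nbrs G Low (S b)).card := by
            exact_mod_cast card_le_card_sdiff_add_card
          have h3 := hL b hb hbu
          have h4 : (i : ℝ) * Top.card ≤ s * Top.card :=
            mul_le_mul_of_nonneg_right (by exact_mod_cast (by omega : i ≤ s)) hT0
          linarith
        refine ⟨_, _, _, hst.extend hcol hz Subset.rfl hTop (mem_union_left J hb) hbu hκ ?_,
          Or.inr ⟨hit', Or.inr ⟨b, mem_insert_self _ _, hb,
            sdiff_subset.trans (nbrs_subset _ _)⟩, ?_, ?_⟩⟩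
        · intro b' hb' hbu'
          have h1 := hcase b' hb' hbu'
          have h2 : (0 : ℝ) ≤ κ * (S b').card := by positivity
          linarith
        · rw [pow_succ']
          exact (mul_le_mul_of_nonneg_left hgT (by linarith)).trans hTop'
        · intro b' hb' hbu'
          rw [mem_insert, not_or] at hbu'
          have h1 := hL b' hb' hbu'.2
          have h2 : ((nbrs G Top (S b') \ nbrs G Low (S b')).card : ℝ) ≤
              (nbrs G Top (S b) \ nbrs G Low (S b)).card := by
            exact_mod_cast hbmax b' (mem_sdiff.2 ⟨hb', hbu'.2⟩)
          have h3 : ((nbrs G (Low ∪ Top) (S b')).card : ℝ) ≤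
              (nbrs G Low (S b')).card + (nbrs G Top (S b') \ nbrs G Low (S b')).card := by
            rw [nbrs_union, ← union_sdiff_self_eq_union]
            exact_mod_cast card_union_le _ _
          have h4 : (Top.card : ℝ) ≤ (nbrs G Top (S b) \ nbrs G Low (S b)).card := by
            nlinarith
          have h5 := mul_le_mul_of_nonneg_left h4 (Nat.cast_nonneg (α := ℝ) i)
          push_cast
          linarith

end Tree

/-! ### Covering blocks from two sources at once. -/

section Final

variable {V : Type u} {G : SimpleGraph V}

/-- Most vertices of `P` have few neighbours in each of the sets `S k`. -/
theorem half_le_card_all_light {α : Type*} {a b : ℝ} {P : Finset V} {J : Finset α}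
    {S : α → Finset V} (hb : 0 < b) (hab : 2 * J.card * a ≤ b) (hne : ∀ k ∈ J, (S k).Nonempty)
    (h : ∀ k ∈ J, ∀ w ∈ S k, deg G w P ≤ a * P.card) :
    (P.card : ℝ) / 2 ≤ (P.filter fun v => ∀ k ∈ J, deg G v (S k) ≤ b * (S k).card).card := by
  have h1 := card_filter_add_not (S := P) fun v => ∀ k ∈ J, deg G v (S k) ≤ b * (S k).card
  have h2 : ((P.filter fun v => ¬ ∀ k ∈ J, deg G v (S k) ≤ b * (S k).card).card : ℝ) ≤
      ∑ k ∈ J, ((P.filter fun v => b * (S k).card < deg G v (S k)).card : ℝ) := by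
    have : P.filter (fun v => ¬ ∀ k ∈ J, deg G v (S k) ≤ b * (S k).card) ⊆
        J.biUnion fun k => P.filter fun v => b * (S k).card < deg G v (S k) := by
      intro v hv
      obtain ⟨hv, hv'⟩ := mem_filter.1 hv
      push Not at hv'
      obtain ⟨k, hk, hlt⟩ := hv'
      exact mem_biUnion.2 ⟨k, hk, mem_filter.2 ⟨hv, hlt⟩⟩
    exact_mod_cast (card_le_card this).trans card_biUnion_le
  have h3 : b * ∑ k ∈ J, ((P.filter fun v => b * (S k).card < deg G v (S k)).card : ℝ) ≤
      b * (P.card / 2) := by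
    rw [mul_sum]
    refine (sum_le_sum fun k hk => card_heavy_le (hne k hk) (h k hk)).trans ?_
    rw [sum_const, nsmul_eq_mul]
    have := mul_le_mul_of_nonneg_right hab (Nat.cast_nonneg (α := ℝ) P.card)
    linarith
  have := le_of_mul_le_mul_left h3 hb
  linarith

theorem card_sdiff_nbrs_ge {X B : Finset V} {κ : ℝ} (h : ((nbrs G X B).card : ℝ) ≤ κ * B.card) :
    (1 - κ) * B.card ≤ (B \ nbrs G X B).card := by
  have := card_add_sdiff_nbrs (G := G) X B
  linarith

/-- The sets `P` and `Q` look alike from all the sets `S b`, robustly so for `b ∈ U`. -/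
structure TwoSource (G : SimpleGraph V) (q : ℝ) (P Q : Finset V) (DP DQ : ℝ) (U J : Finset ℤ)
    (S : ℤ → Finset V) (η : ℝ) : Prop where
  lk : ∀ a ∈ U ∪ J, ∀ b ∈ U ∪ J, a ≠ b → ∀ v ∈ S a, deg G v (S b) ≤ η * (S b).card
  degP : ∀ b ∈ U ∪ J, ∀ w ∈ S b, deg G w P ≤ DP ∧ deg G w P ≤ η * P.card
  degPQ : ∀ w ∈ Q, deg G w P ≤ DP ∧ deg G w P ≤ η * P.card
  degQ : ∀ b ∈ U ∪ J, ∀ w ∈ S b, deg G w Q ≤ DQ ∧ deg G w Q ≤ η * Q.card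
  lowP : ∀ b ∈ U, LowerStable G q P (S b) DP η
  lowQ : ∀ b ∈ U, LowerStable G q Q (S b) DQ η

-- `X` covers part of `S b` from `P` while sparing half of `Q` and of every other set; then `X'`
-- covers from `Q` part of what `X` covered. Removing the neighbours of `X` from `Q` makes `X`
-- anticomplete to every `X'` chosen later. What is left of `S b` may be only a q^(-5) fraction, so
-- its lower stability is given up and `b` moves from `U` to `J`; upper bounds on degrees are
-- inherited.
set_option maxHeartbeats 1000000 in
theorem TwoSource.step {q DP DQ η : ℝ} {P Q : Finset V} {U J : Finset ℤ} {S : ℤ → Finset V}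
    (h : TwoSource G q P Q DP DQ U J S η) (hDP : 0 < DP) (hDQ : 0 < DQ) (hη : 0 < η) {N : ℕ}
    (hN : (U ∪ J).card = N) (hηN : 16 * ((N : ℝ) + 1) ^ 2 * η ≤ 1) (hq : 16 * ((N : ℝ) + 1) ≤ q)
    (hne : ∀ b ∈ U ∪ J, (S b).Nonempty) (hQ : Q.Nonempty) {b : ℤ} (hb : b ∈ U) :
    ∃ X ⊆ P, ∃ X' ⊆ Q, ∃ Q' ⊆ Q, ∃ S' : ℤ → Finset V, (∀ k, S' k ⊆ S k) ∧
      (∀ k ∈ U ∪ J, ((S k).card : ℝ) ≤ q ^ 5 * (S' k).card) ∧ Q'.Nonempty ∧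
      (∀ w ∈ S' b, (∃ x ∈ X, G.Adj x w) ∧ ∃ x ∈ X', G.Adj x w) ∧
      (∀ k ∈ U ∪ J, k ≠ b → ∀ w ∈ S' k, (∀ x ∈ X, ¬ G.Adj x w) ∧ ∀ x ∈ X', ¬ G.Adj x w) ∧
      (∀ w ∈ Q', ∀ x ∈ X, ¬ G.Adj x w) ∧
      TwoSource G q P Q' DP DQ (U.erase b) (insert b J) S' (8 * η) := by
  have hbUJ : b ∈ U ∪ J := mem_union_left _ hb
  have hN1 : 1 ≤ N := hN ▸ card_pos.2 ⟨b, hbUJ⟩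
  have hNr : (1 : ℝ) ≤ N := by exact_mod_cast hN1
  have hη4 : η ≤ 1 / 64 := by
    have : (64 : ℝ) ≤ 16 * ((N : ℝ) + 1) ^ 2 := by nlinarith
    nlinarith
  have hq0 : (32 : ℝ) ≤ q := by linarith
  set O : Finset ℤ := (U ∪ J).erase b with hO
  have hOc : O.card = N - 1 := by rw [hO, card_erase_of_mem hbUJ, hN]
  have hOr : (O.card : ℝ) = N - 1 := by rw [hOc, Nat.cast_sub hN1]; simp
  -- `none` stands for `Q`, which the first cover must spare as well.
  set F : Option ℤ → Finset V := fun o => o.elim Q S with hF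
  set OO : Finset (Option ℤ) := insertNone O with hOO
  have hOOr : (OO.card : ℝ) = N := by
    rw [hOO, card_insertNone]; push_cast; linarith
  have hOsub : ∀ k ∈ O, k ∈ U ∪ J := fun k hk => mem_of_mem_erase hk
  have hFne : ∀ o ∈ OO, (F o).Nonempty := by
    rintro (_ | k) ho
    · exact hQ
    · exact hne k (hOsub k (some_mem_insertNone.1 ho))
  have hFdeg : ∀ o ∈ OO, ∀ w ∈ F o, deg G w P ≤ DP ∧ deg G w P ≤ η * P.card := by
    rintro (_ | k) ho w hw
    · exact h.degPQ w hw
    · exact h.degP k (hOsub k (some_mem_insertNone.1 ho)) w hw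
  set κ₀ : ℝ := 1 / (8 * (N + 1)) with hκ₀
  have hκ₀pos : 0 < κ₀ := by positivity
  have hκ₀N : κ₀ * (8 * (N + 1)) = 1 := by rw [hκ₀]; field_simp
  have hηκ : 2 * (N : ℝ) * η ≤ κ₀ := by
    rw [hκ₀, le_div_iff₀ (by positivity)]
    nlinarith
  set P₁ := P.filter fun v => ∀ o ∈ OO, deg G v (F o) ≤ κ₀ * (F o).card with hP₁
  have hP₁c : (P.card : ℝ) / 2 ≤ P₁.card :=
    half_le_card_all_light hκ₀pos (by rw [hOOr]; exact hηκ) hFne fun o ho w hw => (hFdeg o ho w hw).2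
  have hP₁P : P₁ ⊆ P := filter_subset _ _
  set Q₁ := Q.filter fun v => ∀ k ∈ O, deg G v (S k) ≤ κ₀ * (S k).card with hQ₁
  have hQ₁c : (Q.card : ℝ) / 2 ≤ Q₁.card :=
    half_le_card_all_light hκ₀pos (by rw [hOr]; nlinarith) (fun k hk => hne k (hOsub k hk))
      fun k hk w hw => (h.degQ k (hOsub k hk) w hw).2
  have hQ₁Q : Q₁ ⊆ Q := filter_subset _ _
  set T := (S b).filter fun w => DP ≤ q * deg G w P₁ ∧ DQ ≤ q * deg G w Q₁ with hT
  have hTc : ((S b).card : ℝ) ≤ 2 * T.card := by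
    have h1 := h.lowP b hb P₁ hP₁P (by nlinarith [Nat.cast_nonneg (α := ℝ) P.card])
    have h2 := h.lowQ b hb Q₁ hQ₁Q (by nlinarith [Nat.cast_nonneg (α := ℝ) Q.card])
    have h3 := card_filter_add_not (S := S b) fun w => DP ≤ q * deg G w P₁ ∧ DQ ≤ q * deg G w Q₁
    have h4 : (((S b).filter fun w => ¬ (DP ≤ q * deg G w P₁ ∧ DQ ≤ q * deg G w Q₁)).card : ℝ) ≤
        ((S b).filter fun w => q * deg G w P₁ < DP).card +
        ((S b).filter fun w => q * deg G w Q₁ < DQ).card := by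
      have : (S b).filter (fun w => ¬ (DP ≤ q * deg G w P₁ ∧ DQ ≤ q * deg G w Q₁)) ⊆
          ((S b).filter fun w => q * deg G w P₁ < DP) ∪
          ((S b).filter fun w => q * deg G w Q₁ < DQ) := by
        intro w hw
        simp only [mem_filter, mem_union, not_and_or, not_le] at hw ⊢
        tauto
      exact_mod_cast (card_le_card this).trans (card_union_le _ _)
    have h5 : (0 : ℝ) ≤ (S b).card := Nat.cast_nonneg _
    nlinarith
  have hTS : T ⊆ S b := filter_subset _ _
  obtain ⟨X, hX, hXT, hXF⟩ := exists_cover (G := G) (q := q) (D := DP) (κ := 1 / 2) (G₀ := P₁)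
    (T := T) (J := OO) (S := F) (by linarith) hDP (by norm_num) (by rw [hOOr]; linarith)
    (fun w hw => (mem_filter.1 hw).2.1)
    (fun w hw => (deg_mono hP₁P).trans (h.degP b hbUJ w (hTS hw)).1)
    (fun o ho w hw => (deg_mono hP₁P).trans (hFdeg o ho w hw).1)
    (fun v hv o ho => by
      have h1 := (mem_filter.1 hv).2 o ho
      have h2 : 2 * ((OO.card : ℝ) + 1) * deg G v (F o) ≤
        2 * ((OO.card : ℝ) + 1) * (κ₀ * (F o).card) := mul_le_mul_of_nonneg_left h1 (by positivity)
      rw [hOOr] at h2 ⊢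
      have h3 : 2 * ((N : ℝ) + 1) * (κ₀ * (F o).card) = 1 / 4 * (F o).card := by
        linear_combination (1 / 4 : ℝ) * (F o).card * hκ₀N
      have h4 : (0 : ℝ) ≤ (F o).card := Nat.cast_nonneg _
      linarith) hFne
  have hXS : ∀ k ∈ O, ((nbrs G X (S k)).card : ℝ) ≤ 1 / 2 * (S k).card := fun k hk =>
    hXF (some k) (some_mem_insertNone.2 hk)
  have hXQ : ((nbrs G X Q).card : ℝ) ≤ 1 / 2 * Q.card := hXF none none_mem_insertNone
  set S₁ : ℤ → Finset V := fun k => S k \ nbrs G X (S k) with hS₁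
  have hS₁c : ∀ k ∈ O, ((S k).card : ℝ) ≤ 2 * (S₁ k).card := by
    intro k hk
    have := card_sdiff_nbrs_ge (hXS k hk)
    linarith
  set T₁ := nbrs G X T with hT₁
  obtain ⟨X', hX', hXT', hXF'⟩ := exists_cover (G := G) (q := q) (D := DQ) (κ := 1 / 2) (G₀ := Q₁)
    (T := T₁) (J := O) (S := S₁) (by linarith) hDQ (by norm_num) (by rw [hOr]; linarith)
    (fun w hw => (mem_filter.1 (nbrs_subset _ _ hw)).2.2)
    (fun w hw => (deg_mono hQ₁Q).trans (h.degQ b hbUJ w (hTS (nbrs_subset _ _ hw))).1)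
    (fun k hk w hw => (deg_mono hQ₁Q).trans (h.degQ k (hOsub k hk) w (sdiff_subset hw)).1)
    (fun v hv k hk => by
      have h1 := (mem_filter.1 hv).2 k hk
      have h0 : deg G v (S₁ k) ≤ deg G v (S k) := deg_mono sdiff_subset
      have h2 : 2 * ((O.card : ℝ) + 1) * deg G v (S₁ k) ≤
        2 * ((O.card : ℝ) + 1) * (κ₀ * (S k).card) :=
          mul_le_mul_of_nonneg_left (h0.trans h1) (by positivity)
      rw [hOr] at h2 ⊢
      have h4 : (0 : ℝ) ≤ (S k).card := Nat.cast_nonneg _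
      have h3 : 2 * ((N : ℝ) - 1 + 1) * (κ₀ * (S k).card) ≤ 1 / 4 * (S k).card := by
        have h5 : κ₀ * (8 * N) ≤ 1 := by linarith
        have h6 := mul_le_mul_of_nonneg_right h5 h4
        linarith
      have := hS₁c k hk
      linarith) (fun k hk => by
        have h1 := hS₁c k hk
        have h2 : (0 : ℝ) < (S k).card := by exact_mod_cast (hne k (hOsub k hk)).card_pos
        have h3 : (0 : ℝ) < (S₁ k).card := by linarith
        exact card_pos.1 (by exact_mod_cast h3))
  set S₂ : ℤ → Finset V := fun k => S₁ k \ nbrs G X' (S₁ k) with hS₂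
  have hS₂c : ∀ k ∈ O, ((S k).card : ℝ) ≤ 4 * (S₂ k).card := by
    intro k hk
    have := card_sdiff_nbrs_ge (hXF' k hk)
    have := hS₁c k hk
    linarith
  set T₂ := nbrs G X' T₁ with hT₂
  have hT₂S : T₂ ⊆ S b := (nbrs_subset _ _).trans ((nbrs_subset _ _).trans hTS)
  have hT₂c : ((S b).card : ℝ) ≤ q ^ 5 * T₂.card := by
    have e1 : (T.card : ℝ) ≤ q ^ 2 * (q ^ 2 * T₂.card) :=
      hXT.trans (mul_le_mul_of_nonneg_left hXT' (by positivity))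
    have e2 : 2 * (q ^ 4 * (T₂.card : ℝ)) ≤ q * (q ^ 4 * T₂.card) :=
      mul_le_mul_of_nonneg_right (by linarith) (mul_nonneg (by positivity) (Nat.cast_nonneg _))
    calc ((S b).card : ℝ) ≤ 2 * (q ^ 4 * (T₂.card : ℝ)) := by linarith
      _ ≤ _ := e2
      _ = _ := by ring
  have hSb0 : (0 : ℝ) < (S b).card := by exact_mod_cast (hne b hbUJ).card_pos
  have hT₂ne : T₂.Nonempty := by
    rw [nonempty_iff_ne_empty]
    intro he
    rw [he] at hT₂c
    simp only [card_empty, Nat.cast_zero, mul_zero] at hT₂c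
    linarith
  -- `T₂` can be a tiny part of `S b`, so small linkage into it is not inherited and heavy vertices
  -- must be dropped. With the two covers, each other set is halved three times: hence 8η.
  set S₃ : ℤ → Finset V := fun k => (S₂ k).filter fun v => deg G v T₂ ≤ 2 * (4 * η) * T₂.card
    with hS₃
  have hS₂S : ∀ k, S₂ k ⊆ S k := fun k => sdiff_subset.trans sdiff_subset
  have hS₃S : ∀ k, S₃ k ⊆ S k := fun k => (filter_subset _ _).trans (hS₂S k)
  have hS₃c : ∀ k ∈ O, ((S k).card : ℝ) ≤ 8 * (S₃ k).card := by
    intro k hk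
    have h1 := half_le_card_light (G := G) (B := T₂) (S := S₂ k) (a := 4 * η) (by linarith) hT₂ne
      (fun w hw => by
        have e1 := h.lk b hbUJ k (hOsub k hk) (ne_of_mem_erase hk).symm w (hT₂S hw)
        have e2 : deg G w (S₂ k) ≤ deg G w (S k) := deg_mono (hS₂S k)
        have e3 := mul_le_mul_of_nonneg_left (hS₂c k hk) hη.le
        linarith)
    have := hS₂c k hk
    linarith
  set S' : ℤ → Finset V := fun k => if k = b then T₂ else S₃ k with hS'
  have hS'b : S' b = T₂ := if_pos rfl
  have hS'k : ∀ k, k ≠ b → S' k = S₃ k := fun k hk => if_neg hk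
  have hmemO : ∀ k ∈ U ∪ J, k ≠ b → k ∈ O := fun k hk hkb => mem_erase.2 ⟨hkb, hk⟩
  have hS'S : ∀ k, S' k ⊆ S k := by
    intro k
    by_cases hk : k = b
    · rw [hk, hS'b]; exact hT₂S
    · rw [hS'k k hk]; exact hS₃S k
  set Q' := Q \ nbrs G X Q with hQ'
  have hQ'c : (Q.card : ℝ) ≤ 2 * Q'.card := by
    have := card_sdiff_nbrs_ge hXQ
    linarith
  have hQ'Q : Q' ⊆ Q := sdiff_subset
  have hUJ' : ∀ k ∈ U.erase b ∪ insert b J, k ∈ U ∪ J := by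
    intro k hk
    simp only [mem_union, mem_erase, mem_insert] at hk ⊢
    rcases hk with ⟨-, h⟩ | rfl | h
    · exact Or.inl h
    · exact Or.inl hb
    · exact Or.inr h
  refine ⟨X, hX.trans hP₁P, X', hX'.trans hQ₁Q, Q', hQ'Q, S', hS'S, ?_, ?_, ?_, ?_, ?_, ?_⟩
  · intro k hk
    by_cases hkb : k = b
    · rw [hkb, hS'b]; exact hT₂c
    · rw [hS'k k hkb]
      refine (hS₃c k (hmemO k hk hkb)).trans (mul_le_mul_of_nonneg_right ?_ (Nat.cast_nonneg _))
      calc (8 : ℝ) ≤ q ^ 1 := by linarith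
        _ ≤ q ^ 5 := pow_le_pow_right₀ (by linarith) (by norm_num)
  · have hQ0 : (0 : ℝ) < Q.card := by exact_mod_cast hQ.card_pos
    have : (0 : ℝ) < Q'.card := by linarith
    exact card_pos.1 (by exact_mod_cast this)
  · intro w hw
    rw [hS'b] at hw
    obtain ⟨hw1, x', hx', ha'⟩ := mem_nbrs.1 hw
    obtain ⟨-, x, hx, ha⟩ := mem_nbrs.1 hw1
    exact ⟨⟨x, hx, ha⟩, x', hx', ha'⟩
  · intro k hk hkb w hw
    rw [hS'k k hkb] at hw
    have hw2 := (mem_filter.1 hw).1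
    exact ⟨fun x hx => not_adj_of_mem_sdiff_nbrs (sdiff_subset hw2) hx,
      fun x hx => not_adj_of_mem_sdiff_nbrs hw2 hx⟩
  · intro w hw x hx
    exact not_adj_of_mem_sdiff_nbrs hw hx
  · have hsz : ∀ k ∈ U ∪ J, k ≠ b → ((S k).card : ℝ) ≤ 8 * (S' k).card := by
      intro k hk hkb
      rw [hS'k k hkb]
      exact hS₃c k (hmemO k hk hkb)
    refine ⟨?_, ?_, ?_, ?_, ?_, ?_⟩
    · intro a ha c hc hac v hv
      have ha' := hUJ' a ha
      have hc' := hUJ' c hc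
      by_cases hcb : c = b
      · subst hcb
        rw [hS'k a hac] at hv
        rw [hS'b]
        have := (mem_filter.1 hv).2
        linarith
      · have e1 := h.lk a ha' c hc' hac v (hS'S a hv)
        have e2 : deg G v (S' c) ≤ deg G v (S c) := deg_mono (hS'S c)
        have e3 := mul_le_mul_of_nonneg_left (hsz c hc' hcb) hη.le
        linarith
    · intro k hk w hw
      obtain ⟨e1, e2⟩ := h.degP k (hUJ' k hk) w (hS'S k hw)
      have e3 : (0 : ℝ) ≤ η * P.card := mul_nonneg hη.le (Nat.cast_nonneg _)
      exact ⟨e1, by linarith⟩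
    · intro w hw
      obtain ⟨e1, e2⟩ := h.degPQ w (hQ'Q hw)
      have e3 : (0 : ℝ) ≤ η * P.card := mul_nonneg hη.le (Nat.cast_nonneg _)
      exact ⟨e1, by linarith⟩
    · intro k hk w hw
      obtain ⟨e1, e2⟩ := h.degQ k (hUJ' k hk) w (hS'S k hw)
      have e0 : deg G w Q' ≤ deg G w Q := deg_mono hQ'Q
      have e3 := mul_le_mul_of_nonneg_left hQ'c hη.le
      have e4 : (0 : ℝ) ≤ η * Q'.card := mul_nonneg hη.le (Nat.cast_nonneg _)
      exact ⟨by linarith, by linarith⟩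
    · intro k hk
      have hkU := mem_of_mem_erase hk
      refine (h.lowP k hkU).mono (θ := 1 / 8) (by linarith) (by linarith) Subset.rfl (hS'S k) ?_ ?_
      · have : (0 : ℝ) ≤ P.card := Nat.cast_nonneg _
        linarith
      · have := hsz k (mem_union_left _ hkU) (ne_of_mem_erase hk)
        linarith
    · intro k hk
      have hkU := mem_of_mem_erase hk
      refine (h.lowQ k hkU).mono (θ := 1 / 8) (by linarith) (by linarith) hQ'Q (hS'S k) ?_ ?_
      · have : (0 : ℝ) ≤ Q'.card := Nat.cast_nonneg _
        linarith
      · have := hsz k (mem_union_left _ hkU) (ne_of_mem_erase hk)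
        linarith

/-- For all `b ∈ U`, a subset of `P` and a subset of `Q` cover a large subset `A b` of `S b`, and
are anticomplete to the other sets. -/
theorem TwoSource.exists_covers {q DP DQ : ℝ} {P : Finset V} (hDP : 0 < DP) (hDQ : 0 < DQ) {N : ℕ}
    (hq : 16 * ((N : ℝ) + 1) ≤ q) (n : ℕ) : ∀ (Q : Finset V) (U J : Finset ℤ) (S : ℤ → Finset V)
    (η : ℝ), U.card = n → TwoSource G q P Q DP DQ U J S η → 0 < η → (U ∪ J).card = N →
    16 * ((N : ℝ) + 1) ^ 2 * (8 ^ n * η) ≤ 1 → (∀ b ∈ U ∪ J, (S b).Nonempty) → Q.Nonempty →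
    ∃ (A X X' : ℤ → Finset V), (∀ k, A k ⊆ S k) ∧
      (∀ k ∈ U ∪ J, ((S k).card : ℝ) ≤ q ^ (5 * n) * (A k).card) ∧
      (∀ a ∈ U ∪ J, ∀ b ∈ U ∪ J, a ≠ b → ∀ v ∈ A a, deg G v (A b) ≤ 8 ^ n * η * (A b).card) ∧
      (∀ b ∈ U, X b ⊆ P ∧ X' b ⊆ Q ∧
        (∀ w ∈ A b, (∃ x ∈ X b, G.Adj x w) ∧ ∃ x ∈ X' b, G.Adj x w) ∧
        ∀ k ∈ U ∪ J, k ≠ b → ∀ w ∈ A k, (∀ x ∈ X b, ¬ G.Adj x w) ∧ ∀ x ∈ X' b, ¬ G.Adj x w) ∧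
      ∀ b ∈ U, ∀ c ∈ U, b ≠ c → (∀ x ∈ X b, ∀ y ∈ X' c, ¬ G.Adj x y) ∨
        ∀ x ∈ X c, ∀ y ∈ X' b, ¬ G.Adj x y := by
  induction n with
  | zero =>
    intro Q U J S η hU h hη hN hηN hne hQ
    rw [card_eq_zero] at hU
    subst hU
    refine ⟨S, fun _ => ∅, fun _ => ∅, fun k => Subset.rfl, by simp, ?_, by simp, by simp⟩
    intro a ha b hb hab v hv
    simpa using h.lk a ha b hb hab v hv
  | succ n ih =>
    intro Q U J S η hU h hη hN hηN hne hQ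
    obtain ⟨b, hb⟩ : U.Nonempty := card_pos.1 (by omega)
    have h8 : η ≤ 8 ^ (n + 1) * η := by
      have : (1 : ℝ) ≤ 8 ^ (n + 1) := one_le_pow₀ (by norm_num)
      nlinarith
    obtain ⟨Xb, hXb, Xb', hXb', Q', hQ', S', hS', hsz, hQne, hcov, hanti, hXQ, hst⟩ := h.step hDP hDQ
      hη hN (le_trans (mul_le_mul_of_nonneg_left h8 (by positivity)) hηN) hq hne hQ hb
    have hq0 : 0 < q := by
      have : (0 : ℝ) ≤ N := Nat.cast_nonneg _
      linarith
    have hUJ : U.erase b ∪ insert b J = U ∪ J := by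
      ext k
      simp only [mem_union, mem_erase, mem_insert]
      by_cases hk : k = b
      · subst hk; simp [hb]
      · simp [hk]
    obtain ⟨A, X, X', hA, hAc, hlk, hX, hor⟩ := ih Q' (U.erase b) (insert b J) S' (8 * η)
      (by rw [card_erase_of_mem hb]; omega) hst (by linarith) (by rw [hUJ]; exact hN)
      (by
        have e : (8 : ℝ) ^ (n + 1) = 8 ^ n * 8 := pow_succ _ _
        rw [e] at hηN
        linarith) (by
        rw [hUJ]
        intro k hk
        have h1 := hsz k hk
        have h2 : (0 : ℝ) < (S k).card := by exact_mod_cast (hne k hk).card_pos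
        rw [nonempty_iff_ne_empty]
        intro he
        rw [he] at h1
        simp only [card_empty, Nat.cast_zero, mul_zero] at h1
        linarith) hQne
    rw [hUJ] at hAc hlk hX
    have hXc : ∀ c, c ≠ b → Function.update X b Xb c = X c := fun c hc =>
      Function.update_of_ne hc _ _
    have hXc' : ∀ c, c ≠ b → Function.update X' b Xb' c = X' c := fun c hc =>
      Function.update_of_ne hc _ _
    refine ⟨A, Function.update X b Xb, Function.update X' b Xb', fun k => (hA k).trans (hS' k), ?_,
      ?_, ?_, ?_⟩
    · intro k hk
      refine (hsz k hk).trans ?_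
      calc q ^ 5 * ((S' k).card : ℝ) ≤ q ^ 5 * (q ^ (5 * n) * (A k).card) :=
            mul_le_mul_of_nonneg_left (hAc k hk) (by positivity)
        _ = _ := by ring
    · intro a ha c hc hac v hv
      refine (hlk a ha c hc hac v hv).trans (le_of_eq ?_)
      ring
    · intro c hc
      by_cases hcb : c = b
      · subst hcb
        simp only [Function.update_self]
        exact ⟨hXb, hXb', fun w hw => hcov w (hA c hw), fun k hk hkc w hw =>
          hanti k hk hkc w (hA k hw)⟩
      · rw [hXc c hcb, hXc' c hcb]
        obtain ⟨h1, h2, h3, h4⟩ := hX c (mem_erase.2 ⟨hcb, hc⟩)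
        exact ⟨h1, h2.trans hQ', h3, h4⟩
    -- Of two indices, the one treated first has its `X` anticomplete to the other's `X'`, which was
    -- chosen inside the reduced `Q`.
    · intro c hc d hd hcd
      by_cases hcb : c = b
      · subst hcb
        rw [Function.update_self, hXc' d hcd.symm]
        refine Or.inl fun x hx y hy => hXQ y ((hX d (mem_erase.2 ⟨hcd.symm, hd⟩)).2.1 hy) x hx
      · by_cases hdb : d = b
        · subst hdb
          rw [hXc' c hcd, Function.update_self d Xb X]
          exact Or.inr fun x hx y hy => hXQ y ((hX c (mem_erase.2 ⟨hcd, hc⟩)).2.1 hy) x hx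
        · rw [hXc c hcb, hXc' c hcb, hXc d hdb, hXc' d hdb]
          exact hor c (mem_erase.2 ⟨hcb, hc⟩) d (mem_erase.2 ⟨hdb, hd⟩) hcd

end Final

/-! ### Shortening, joining and prolonging induced paths. -/

section Paths

variable {V : Type u} {G : SimpleGraph V}

/-- Take a shortest walk among those with the same ends and all vertices on the given walk: a
repeated vertex or a chord would give a shorter one. Since no new vertices appear, colours and
nonadjacencies are inherited. -/
theorem exists_indPath_of_walk {f : ℕ → V} {L : ℕ} (hf : ∀ a < L, G.Adj (f a) (f (a + 1))) :
    ∃ d ≤ L, ∃ g : ℕ → V, IsIndPath G g d ∧ g 0 = f 0 ∧ g d = f L ∧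
      ∀ a ≤ d, ∃ i ≤ L, g a = f i := by
  have hex : ∃ d, ∃ g : ℕ → V, (∀ a < d, G.Adj (g a) (g (a + 1))) ∧ g 0 = f 0 ∧ g d = f L ∧
      ∀ a ≤ d, ∃ i ≤ L, g a = f i := ⟨L, f, hf, rfl, rfl, fun a ha => ⟨a, ha, rfl⟩⟩
  have hmin := fun d' h => Nat.find_min' hex (m := d') h
  have hle : Nat.find hex ≤ L := hmin L ⟨f, hf, rfl, rfl, fun a ha => ⟨a, ha, rfl⟩⟩
  obtain ⟨g, hg, h0, hd, hgf⟩ := Nat.find_spec hex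
  set d := Nat.find hex
  have hinj : ∀ a b, a < b → b ≤ d → g a ≠ g b := by
    intro a b hab hb he
    have := hmin (d - (b - a)) ⟨fun j => if j ≤ a then g j else g (j + (b - a)), ?_, ?_, ?_, ?_⟩
    · omega
    · intro j hj
      beta_reduce
      rcases lt_trichotomy j a with h | h | h
      · rw [if_pos h.le, if_pos (by omega)]
        exact hg j (by omega)
      · subst h
        rw [if_pos le_rfl, if_neg (by omega), he, show j + 1 + (b - j) = b + 1 by omega]
        exact hg b (by omega)
      · rw [if_neg (by omega), if_neg (by omega), show j + 1 + (b - a) = j + (b - a) + 1 by omega]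
        exact hg _ (by omega)
    · beta_reduce
      rw [if_pos (Nat.zero_le _), h0]
    · beta_reduce
      by_cases h : d - (b - a) ≤ a
      · rw [if_pos h, show d - (b - a) = a by omega, he, show b = d by omega, hd]
      · rw [if_neg h, show d - (b - a) + (b - a) = d by omega, hd]
    · intro j hj
      by_cases h : j ≤ a
      · simp only [h, if_true]
        exact hgf j (by omega)
      · simp only [h, if_false]
        exact hgf _ (by omega)
  have hnadj : ∀ a b, a + 1 < b → b ≤ d → ¬ G.Adj (g a) (g b) := by
    intro a b hab hb he
    have := hmin (d - (b - a - 1)) ⟨fun j => if j ≤ a then g j else g (j + (b - a - 1)), ?_, ?_, ?_,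
      ?_⟩
    · omega
    · intro j hj
      beta_reduce
      rcases lt_trichotomy j a with h | h | h
      · rw [if_pos h.le, if_pos (by omega)]
        exact hg j (by omega)
      · subst h
        rw [if_pos le_rfl, if_neg (by omega), show j + 1 + (b - j - 1) = b by omega]
        exact he
      · rw [if_neg (by omega), if_neg (by omega),
          show j + 1 + (b - a - 1) = j + (b - a - 1) + 1 by omega]
        exact hg _ (by omega)
    · beta_reduce
      rw [if_pos (Nat.zero_le _), h0]
    · beta_reduce
      rw [if_neg (by omega), show d - (b - a - 1) + (b - a - 1) = d by omega, hd]
    · intro j hj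
      by_cases h : j ≤ a
      · simp only [h, if_true]
        exact hgf j (by omega)
      · simp only [h, if_false]
        exact hgf _ (by omega)
  refine ⟨d, hle, g, ⟨?_, ?_⟩, h0, hd, hgf⟩
  · intro a ha b hb he
    rcases lt_trichotomy a b with h | h | h
    · exact absurd he (hinj a b h hb)
    · exact h
    · exact absurd he.symm (hinj b a h ha)
  · intro a ha b hb
    constructor
    · intro h
      by_contra hc
      rcases lt_trichotomy a b with h' | h' | h'
      · exact hnadj a b (by omega) hb h
      · subst h'
        exact G.irrefl h
      · exact hnadj b a (by omega) ha h.symm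
    · rintro (rfl | rfl)
      · exact hg a (by omega)
      · exact (hg b (by omega)).symm

theorem IsIndPath.append {h f : ℕ → V} {d s : ℕ} (hh : IsIndPath G h d) (hf : IsIndPath G f s)
    (he : h d = f 0) (hn : ∀ a < d, ∀ b, 0 < b → b ≤ s → h a ≠ f b ∧ ¬ G.Adj (h a) (f b)) :
    ∃ g : ℕ → V, IsIndPath G g (d + s) ∧ (∀ a ≤ d, g a = h a) ∧ ∀ b ≤ s, g (d + b) = f b := by
  have h1 : ∀ a ≤ d, (if a ≤ d then h a else f (a - d)) = h a := fun a ha => if_pos ha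
  have h2 : ∀ a, d ≤ a → (if a ≤ d then h a else f (a - d)) = f (a - d) := by
    intro a ha
    rcases ha.lt_or_eq with h' | rfl
    · exact if_neg (by omega)
    · rw [if_pos le_rfl, he, Nat.sub_self]
  refine ⟨fun a => if a ≤ d then h a else f (a - d), ⟨?_, ?_⟩, h1, ?_⟩
  · intro a ha b hb hab
    simp only at hab
    rcases lt_or_ge a d with had | had <;> rcases lt_or_ge b d with hbd | hbd
    · rw [h1 a had.le, h1 b hbd.le] at hab
      exact hh.1 a had.le b hbd.le hab
    · rcases hbd.lt_or_eq with hbd | rfl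
      · rw [h1 a had.le, h2 b hbd.le] at hab
        exact absurd hab (hn a had (b - d) (by omega) (by omega)).1
      · rw [h1 a had.le, h1 d le_rfl] at hab
        exact hh.1 a had.le d le_rfl hab
    · rcases had.lt_or_eq with had | rfl
      · rw [h1 b hbd.le, h2 a had.le] at hab
        exact absurd hab.symm (hn b hbd (a - d) (by omega) (by omega)).1
      · rw [h1 b hbd.le, h1 d le_rfl] at hab
        exact hh.1 d le_rfl b hbd.le hab
    · rw [h2 a had, h2 b hbd] at hab
      have := hf.1 (a - d) (by omega) (b - d) (by omega) hab
      omega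
  · intro a ha b hb
    simp only
    rcases lt_or_ge a d with had | had <;> rcases lt_or_ge b d with hbd | hbd
    · rw [h1 a had.le, h1 b hbd.le]
      exact hh.2 a had.le b hbd.le
    · rcases hbd.lt_or_eq with hbd | rfl
      · rw [h1 a had.le, h2 b hbd.le]
        have := (hn a had (b - d) (by omega) (by omega)).2
        simp only [this, false_iff]
        omega
      · rw [h1 a had.le, h1 d le_rfl]
        exact hh.2 a had.le d le_rfl
    · rcases had.lt_or_eq with had | rfl
      · rw [h1 b hbd.le, h2 a had.le, G.adj_comm]
        have := (hn b hbd (a - d) (by omega) (by omega)).2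
        simp only [this, false_iff]
        omega
      · rw [h1 b hbd.le, h1 d le_rfl]
        exact hh.2 d le_rfl b hbd.le
    · rw [h2 a had, h2 b hbd, hf.2 (a - d) (by omega) (b - d) (by omega)]
      omega
  · intro b hb
    simp only
    rw [h2 _ (by omega), Nat.add_sub_cancel_left]

theorem IsIndPath.reverse {f : ℕ → V} {L : ℕ} (hf : IsIndPath G f L) :
    IsIndPath G (fun a => f (L - a)) L := by
  constructor
  · intro a ha b hb h
    have := hf.1 _ (Nat.sub_le _ _) _ (Nat.sub_le _ _) h
    omega
  · intro a ha b hb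
    simp only
    rw [hf.2 _ (Nat.sub_le _ _) _ (Nat.sub_le _ _)]
    omega

theorem isIndPath_edge {u x : V} (h : G.Adj u x) : IsIndPath G (fun a => if a = 0 then u else x) 1 := by
  constructor
  · intro a ha b hb he
    rcases Nat.le_one_iff_eq_zero_or_eq_one.1 ha with rfl | rfl <;>
      rcases Nat.le_one_iff_eq_zero_or_eq_one.1 hb with rfl | rfl
    · rfl
    · simp at he; exact absurd he h.ne
    · simp at he; exact absurd he h.ne'
    · rfl
  · intro a ha b hb
    rcases Nat.le_one_iff_eq_zero_or_eq_one.1 ha with rfl | rfl <;>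
      rcases Nat.le_one_iff_eq_zero_or_eq_one.1 hb with rfl | rfl
    · simp
    · simpa using h
    · simpa using h.symm
    · simp

/-- Every two nonadjacent vertices of `P` and `Q` are joined by a rainbow induced path of length
`L` with interior in `R` and with colours in `C`. -/
def Connector (G : SimpleGraph V) (col : V → ℤ) (P Q R : Finset V) (C : Finset ℤ) (L : ℕ) : Prop :=
  ∀ x ∈ P, ∀ y ∈ Q, ¬ G.Adj x y → ∃ f : ℕ → V, IsIndPath G f L ∧ f 0 = x ∧ f L = y ∧
    (∀ a, 0 < a → a < L → f a ∈ R) ∧ (∀ a ≤ L, ∀ b ≤ L, col (f a) = col (f b) → a = b) ∧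
    ∀ a ≤ L, col (f a) ∈ C

theorem Connector.symm {col : V → ℤ} {P Q R : Finset V} {C : Finset ℤ} {L : ℕ}
    (h : Connector G col P Q R C L) : Connector G col Q P R C L := by
  intro y hy x hx hyx
  obtain ⟨f, hf, h0, hL, hR, hinj, hC⟩ := h x hx y hy fun h => hyx h.symm
  refine ⟨fun a => f (L - a), hf.reverse, by simpa using hL, by simpa using h0, ?_, ?_, ?_⟩
  · intro a ha hal
    exact hR _ (by omega) (by omega)
  · intro a ha b hb he
    have := hinj _ (Nat.sub_le _ _) _ (Nat.sub_le _ _) he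
    omega
  · intro a ha
    exact hC _ (Nat.sub_le _ _)

/-- Every two nonadjacent vertices of distinct sets `A i`, `A j` with `i, j ∈ M` are joined by a
rainbow induced path of length `L`, with interior anticomplete to the other sets and with the
colours of its interior in `C \ M`. -/
def Linked (G : SimpleGraph V) (col : V → ℤ) (C M : Finset ℤ) (A : ℤ → Finset V) (L : ℕ) : Prop :=
  ∀ i ∈ M, ∀ j ∈ M, i ≠ j → ∀ u ∈ A i, ∀ v ∈ A j, ¬ G.Adj u v → ∃ f : ℕ → V, IsIndPath G f L ∧
    f 0 = u ∧ f L = v ∧ (∀ a ≤ L, ∀ b ≤ L, col (f a) = col (f b) → a = b) ∧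
    ∀ a, 0 < a → a < L → col (f a) ∈ C ∧ col (f a) ∉ M ∧
      ∀ k ∈ M, k ≠ i → k ≠ j → ∀ w ∈ A k, ¬ G.Adj (f a) w

theorem Linked.mono {col : V → ℤ} {C C' M : Finset ℤ} {A : ℤ → Finset V} {L : ℕ}
    (h : Linked G col C M A L) (hC : C ⊆ C') : Linked G col C' M A L := by
  intro i hi j hj hij u hu v hv huv
  obtain ⟨f, hf, h0, hL, hc, hint⟩ := h i hi j hj hij u hu v hv huv
  exact ⟨f, hf, h0, hL, hc, fun a ha0 ha => ⟨hC (hint a ha0 ha).1, (hint a ha0 ha).2⟩⟩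

theorem Connector.exists_path {col : V → ℤ} {P Q R : Finset V} {C : Finset ℤ} {L : ℕ}
    (h : Connector G col P Q R C L) (hL : 0 < L) {x y u v : V} (hx : x ∈ P) (hy : y ∈ Q)
    (hxy : ¬ G.Adj x y) (hux : G.Adj u x) (hvy : G.Adj v y) (huv : ¬ G.Adj u v)
    (huy : ¬ G.Adj u y) (hvx : ¬ G.Adj v x) (huR : ∀ r ∈ R, ¬ G.Adj u r)
    (hvR : ∀ r ∈ R, ¬ G.Adj v r) (huC : col u ∉ C) (hvC : col v ∉ C) (hne : col u ≠ col v) :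
    ∃ f : ℕ → V, IsIndPath G f (L + 2) ∧ f 0 = u ∧ f (L + 2) = v ∧
      (∀ a ≤ L + 2, ∀ b ≤ L + 2, col (f a) = col (f b) → a = b) ∧
      ∀ a, 0 < a → a < L + 2 → col (f a) ∈ C ∧ (f a = x ∨ f a = y ∨ f a ∈ R) := by
  obtain ⟨f, hf, h0, hfL, hR, hinj, hC⟩ := h x hx y hy hxy
  have hfb : ∀ b ≤ L, f b = x ∧ b = 0 ∨ f b = y ∧ b = L ∨ f b ∈ R := by
    intro b hb
    rcases Nat.eq_zero_or_pos b with rfl | hb0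
    · exact Or.inl ⟨h0, rfl⟩
    · rcases hb.lt_or_eq with hb | rfl
      · exact Or.inr (Or.inr (hR b hb0 hb))
      · exact Or.inr (Or.inl ⟨hfL, rfl⟩)
  have hfu : ∀ b, 0 < b → b ≤ L → ¬ G.Adj u (f b) := by
    intro b hb0 hb
    rcases hfb b hb with ⟨-, h⟩ | ⟨h, -⟩ | h
    · omega
    · rw [h]; exact huy
    · exact huR _ h
  have hfv : ∀ b < L, ¬ G.Adj v (f b) := by
    intro b hb
    rcases hfb b hb.le with ⟨h, -⟩ | ⟨-, h⟩ | h
    · rw [h]; exact hvx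
    · omega
    · exact hvR _ h
  obtain ⟨g, hg, hg1, hg2⟩ := (isIndPath_edge hux).append hf (by simp [h0]) (by
    intro a ha b hb0 hb
    obtain rfl : a = 0 := by omega
    simp only [if_true]
    refine ⟨fun he => huC (he ▸ hC b hb), hfu b hb0 hb⟩)
  have hg0 : g 0 = u := by simpa using hg1 0 (by omega)
  have hgs : ∀ b, 0 < b → b ≤ L + 1 → g b = f (b - 1) := by
    intro b hb0 hb
    have := hg2 (b - 1) (by omega)
    rwa [show 1 + (b - 1) = b by omega] at this
  rw [show 1 + L = L + 1 by omega] at hg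
  obtain ⟨p, hp, hp1, hp2⟩ := hg.append (isIndPath_edge hvy.symm) (by
    rw [hgs (L + 1) (by omega) le_rfl]; simp [hfL]) (by
    intro a ha b hb0 hb
    obtain rfl : b = 1 := by omega
    simp only [one_ne_zero, if_false]
    rcases Nat.eq_zero_or_pos a with rfl | ha0
    · rw [hg0]
      exact ⟨fun he => hne (congrArg col he), huv⟩
    · rw [hgs a ha0 ha.le]
      exact ⟨fun he => hvC (he ▸ hC _ (by omega)), fun h => hfv _ (by omega) h.symm⟩)
  have e0 : p 0 = u := by rw [hp1 0 (by omega), hg0]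
  have e1 : ∀ b, 0 < b → b < L + 2 → p b = f (b - 1) := fun b hb0 hb => by
    rw [hp1 b (by omega), hgs b hb0 (by omega)]
  have e2 : p (L + 2) = v := by simpa using hp2 1 le_rfl
  have hcases : ∀ a ≤ L + 2, a = 0 ∧ col (p a) = col u ∨ a = L + 2 ∧ col (p a) = col v ∨
      (0 < a ∧ a < L + 2 ∧ p a = f (a - 1) ∧ col (p a) ∈ C) := by
    intro a ha
    rcases Nat.eq_zero_or_pos a with rfl | ha0
    · exact Or.inl ⟨rfl, by rw [e0]⟩
    · rcases ha.lt_or_eq with ha | rfl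
      · exact Or.inr (Or.inr ⟨ha0, ha, e1 a ha0 ha, by rw [e1 a ha0 ha]; exact hC _ (by omega)⟩)
      · exact Or.inr (Or.inl ⟨rfl, by rw [e2]⟩)
  refine ⟨p, hp, e0, e2, ?_, ?_⟩
  · intro a ha b hb he
    rcases hcases a ha with ⟨a0, ac⟩ | ⟨a0, ac⟩ | ⟨a0, a1, af, ac⟩ <;>
      rcases hcases b hb with ⟨b0, bc⟩ | ⟨b0, bc⟩ | ⟨b0, b1, bf, bc⟩
    · omega
    · rw [ac, bc] at he; exact absurd he hne
    · rw [← he, ac] at bc; exact absurd bc huC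
    · rw [ac, bc] at he; exact absurd he.symm hne
    · omega
    · rw [← he, ac] at bc; exact absurd bc hvC
    · rw [he, bc] at ac; exact absurd ac huC
    · rw [he, bc] at ac; exact absurd ac hvC
    · rw [af, bf] at he
      have := hinj _ (by omega) _ (by omega) he
      omega
  · intro a ha0 ha
    rw [e1 a ha0 ha]
    refine ⟨hC _ (by omega), ?_⟩
    rcases hfb (a - 1) (by omega) with ⟨h, -⟩ | ⟨h, -⟩ | h
    · exact Or.inl h
    · exact Or.inr (Or.inl h)
    · exact Or.inr (Or.inr h)

/-- From `u` step to a neighbour x in its cover, follow the connector to y, and step to `v`. Covers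
are anticomplete to foreign blocks, so the only possible chord to rule out inside the connector is
xy. The disjunction `hor` suffices because either end may be the one reached through `P`. -/
theorem Connector.linked {col : V → ℤ} {P Q R : Finset V} {C M : Finset ℤ} {L : ℕ}
    {A X X' : ℤ → Finset V} (h : Connector G col P Q R C L) (hL : 0 < L)
    (hcol : ∀ b ∈ M, ∀ v ∈ A b, col v = b) (hC : Disjoint C M)
    (hR : ∀ b ∈ M, ∀ w ∈ A b, ∀ r ∈ R, ¬ G.Adj r w)
    (hX : ∀ b ∈ M, X b ⊆ P ∧ X' b ⊆ Q ∧
      (∀ w ∈ A b, (∃ x ∈ X b, G.Adj x w) ∧ ∃ x ∈ X' b, G.Adj x w) ∧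
      ∀ k ∈ M, k ≠ b → ∀ w ∈ A k, (∀ x ∈ X b, ¬ G.Adj x w) ∧ ∀ x ∈ X' b, ¬ G.Adj x w)
    (hor : ∀ b ∈ M, ∀ c ∈ M, b ≠ c → (∀ x ∈ X b, ∀ y ∈ X' c, ¬ G.Adj x y) ∨
      ∀ x ∈ X c, ∀ y ∈ X' b, ¬ G.Adj x y) : Linked G col C M A (L + 2) := by
  have aux : ∀ i ∈ M, ∀ j ∈ M, i ≠ j → (∀ x ∈ X i, ∀ y ∈ X' j, ¬ G.Adj x y) → ∀ u ∈ A i, ∀ v ∈ A j,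
      ¬ G.Adj u v → ∃ f : ℕ → V, IsIndPath G f (L + 2) ∧ f 0 = u ∧ f (L + 2) = v ∧
      (∀ a ≤ L + 2, ∀ b ≤ L + 2, col (f a) = col (f b) → a = b) ∧
      ∀ a, 0 < a → a < L + 2 → col (f a) ∈ C ∧ col (f a) ∉ M ∧
        ∀ k ∈ M, k ≠ i → k ≠ j → ∀ w ∈ A k, ¬ G.Adj (f a) w := by
    intro i hi j hj hij hxy u hu v hv huv
    obtain ⟨hXP, -, hci, hai⟩ := hX i hi
    obtain ⟨-, hXQ, hcj, haj⟩ := hX j hj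
    obtain ⟨x, hx, hxu⟩ := (hci u hu).1
    obtain ⟨y, hy, hyv⟩ := (hcj v hv).2
    have hM : ∀ b ∈ M, b ∉ C := fun b hb hbC => (disjoint_left.1 hC) hbC hb
    obtain ⟨f, hf, h0, h1, hinj, hint⟩ := h.exists_path hL (hXP hx) (hXQ hy) (hxy x hx y hy) hxu.symm
      hyv.symm huv (fun e => (haj i hi hij u hu).2 y hy e.symm)
      (fun e => (hai j hj hij.symm v hv).1 x hx e.symm) (fun r hr e => hR i hi u hu r hr e.symm)
      (fun r hr e => hR j hj v hv r hr e.symm) (by rw [hcol i hi u hu]; exact hM i hi)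
      (by rw [hcol j hj v hv]; exact hM j hj) (by rw [hcol i hi u hu, hcol j hj v hv]; exact hij)
    refine ⟨f, hf, h0, h1, hinj, ?_⟩
    intro a ha0 ha
    obtain ⟨hc, hp⟩ := hint a ha0 ha
    refine ⟨hc, fun hm => hM _ hm hc, ?_⟩
    intro k hk hki hkj w hw
    rcases hp with e | e | e
    · rw [e]; exact (hai k hk hki w hw).1 x hx
    · rw [e]; exact (haj k hk hkj w hw).2 y hy
    · exact hR k hk w hw _ e
  intro i hi j hj hij u hu v hv huv
  rcases hor i hi j hj hij with ho | ho
  · exact aux i hi j hj hij ho u hu v hv huv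
  · obtain ⟨f, hf, h0, h1, hinj, hint⟩ := aux j hj i hi hij.symm ho v hv u hu fun e => huv e.symm
    refine ⟨fun a => f (L + 2 - a), hf.reverse, by simpa using h1, by simpa using h0, ?_, ?_⟩
    · intro a ha b hb he
      have := hinj _ (Nat.sub_le _ _) _ (Nat.sub_le _ _) he
      omega
    · intro a ha0 ha
      obtain ⟨h1, h2, h3⟩ := hint (L + 2 - a) (by omega) (by omega)
      exact ⟨h1, h2, fun k hk hki hkj => h3 k hk hkj hki⟩

end Paths

/-! ### From a connector to linked blocks. -/

section Finish

variable {V : Type u} {G : SimpleGraph V}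

/-- The family of sets has linkage at most `η`. -/
def Lk (G : SimpleGraph V) (I : Finset ℤ) (S : ℤ → Finset V) (η : ℝ) : Prop :=
  ∀ a ∈ I, ∀ b ∈ I, a ≠ b → ∀ v ∈ S a, deg G v (S b) ≤ η * (S b).card

theorem Lk.mono {I I' : Finset ℤ} {S S' : ℤ → Finset V} {η η' θ : ℝ} (h : Lk G I S η) (hI : I' ⊆ I)
    (hS : ∀ b ∈ I', S' b ⊆ S b) (hθ : η ≤ η' * θ) (hη' : 0 ≤ η')
    (hc : ∀ b ∈ I', θ * (S b).card ≤ (S' b).card) : Lk G I' S' η' := by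
  intro a ha b hb hab v hv
  have h1 := h a (hI ha) b (hI hb) hab v (hS a ha hv)
  have h2 : deg G v (S' b) ≤ deg G v (S b) := deg_mono (hS b hb)
  have h3 := mul_le_mul_of_nonneg_left (hc b hb) hη'
  have h4 := mul_le_mul_of_nonneg_right hθ (Nat.cast_nonneg (α := ℝ) (S b).card)
  linarith

/-- Degrees into `P` are already regular; those into `Q` are regularised here, and then the
two-source covers apply. The asymmetric hypothesis `hPQ`, that `Q` sees `P` no more densely than the
blocks do, is what allows covers taken from `P` to spare `Q`. -/
theorem Connector.exists_linked {γ q η η₁ η' DP : ℝ} (hG : Coh G γ) (hγ : 0 < γ) {E m N : ℕ}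
    (hN : N = (E + 1) * m * E) (hm : 1 ≤ m) (hη₁ : 0 < η₁) (hη : 0 < η)
    (hηη : 4 * η ≤ η₁ ^ (N + 1)) (hη₁m : 16 * ((m : ℝ) + 1) ^ 2 * (8 ^ m * η₁) ≤ 1)
    (hη' : 8 ^ m * η₁ ≤ η') (hqm : 16 * ((m : ℝ) + 1) ≤ q) (hqη : 2 ≤ q * η₁ ^ N)
    {U : Finset ℤ} (hU : (E + 1) * m ≤ U.card) {S : ℤ → Finset V} {col : V → ℤ}
    (hcol : ∀ b ∈ U, ∀ v ∈ S b, col v = b) {P Q R : Finset V} {C : Finset ℤ} {L : ℕ} (hL : 0 < L)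
    (hcon : Connector G col P Q R C L) (hC : Disjoint C U)
    (hR : ∀ b ∈ U, ∀ w ∈ S b, ∀ r ∈ R, ¬ G.Adj r w) (hDP : 0 < DP) (hlk : Lk G U S η)
    (hP : ∀ b ∈ U, ∀ w ∈ S b, deg G w P ≤ DP ∧ deg G w P ≤ η * P.card)
    (hPQ : ∀ w ∈ Q, deg G w P ≤ DP ∧ deg G w P ≤ η * P.card)
    (hlow : ∀ b ∈ U, LowerStable G q P (S b) DP η) (hd : ∀ b ∈ U, Disjoint Q (S b))
    (hQ : ∀ b ∈ U, ∀ v ∈ Q, deg G v (S b) ≤ η * (S b).card) (hQc : ∀ w, deg G w Q ≤ q ^ E)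
    (hQγ : γ ≤ η₁ ^ (N + 1) / 2 * Q.card) (hSγ : ∀ b ∈ U, γ ≤ η₁ ^ (N + 1) / 2 * (S b).card) :
    ∃ M ⊆ U, M.card = m ∧ ∃ A : ℤ → Finset V, (∀ b, A b ⊆ S b) ∧
      (∀ b ∈ M, ((S b).card : ℝ) ≤ q ^ (5 * m + 1) * (A b).card) ∧ Lk G M A η' ∧
      Linked G col C M A (L + 2) := by
  have hm' : (1 : ℝ) ≤ m := by exact_mod_cast hm
  have hη₁1 : η₁ ≤ 1 := by
    have h8 : (1 : ℝ) ≤ 8 ^ m := one_le_pow₀ (by norm_num)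
    have h16 : (1 : ℝ) ≤ 16 * ((m : ℝ) + 1) ^ 2 := by nlinarith
    have : 1 * (1 * η₁) ≤ 16 * ((m : ℝ) + 1) ^ 2 * (8 ^ m * η₁) := by gcongr
    linarith
  have hpN : 0 < η₁ ^ N := by positivity
  have hpN1 : η₁ ^ N ≤ 1 := pow_le_one₀ hη₁.le hη₁1
  have e1 : η₁ ^ (N + 1) = η₁ ^ N * η₁ := pow_succ _ _
  have hηη₁ : η ≤ η₁ * (η₁ ^ N / 2) := by nlinarith
  have hηle : η ≤ η₁ := by nlinarith
  have hq1 : 1 ≤ q := by linarith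
  have hcard0 : ∀ X : Finset V, (0 : ℝ) ≤ X.card := fun X => Nat.cast_nonneg _
  have hQne : Q.Nonempty := by
    rw [nonempty_iff_ne_empty]
    rintro rfl
    simp at hQγ
    linarith
  obtain ⟨M, hMU, hMm, Q', hQ', S', D, hD, hS', hQ'c, hS'c, hreg⟩ := exists_regular_clean hG hq1 hη₁
    hη₁1 hη hN hU Subset.rfl hd hQne (fun b _ w _ => hQc w) hQ (by
      have h1 : 0 ≤ η₁ ^ (N + 1) / 2 * Q.card := by positivity
      linarith) hSγ
  have hS'2 : ∀ b ∈ M, ((S b).card : ℝ) ≤ q * (S' b).card := by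
    intro b hb
    have h1 := (hS'c b (hMU hb)).1
    have h2 : 2 * ((S b).card : ℝ) ≤ q * η₁ ^ N * (S b).card :=
      mul_le_mul_of_nonneg_right hqη (hcard0 _)
    have h3 : q * (η₁ ^ N / 2 * (S b).card) ≤ q * (S' b).card :=
      mul_le_mul_of_nonneg_left h1 (by linarith)
    linarith
  have hSpos : ∀ b ∈ U, (0 : ℝ) < (S b).card := by
    intro b hb
    have h1 := hSγ b hb
    have h2 : 0 < η₁ ^ (N + 1) / 2 := by positivity
    by_contra hc
    have := mul_nonpos_of_nonneg_of_nonpos h2.le (not_lt.1 hc)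
    linarith
  have hclean : 2 * η / η₁ ^ N ≤ η₁ := by
    rw [div_le_iff₀ hpN]
    nlinarith
  have hTS : TwoSource G q P Q' DP D M ∅ S' η₁ := by
    refine ⟨?_, ?_, ?_, ?_, ?_, ?_⟩
    · have := hlk.mono (S' := S') (I' := M) (η' := η₁) (θ := η₁ ^ N / 2) hMU (fun b _ => hS' b)
        hηη₁ hη₁.le fun b hb => (hS'c b (hMU hb)).1
      rw [union_empty]
      exact this
    · intro b hb w hw
      rw [union_empty] at hb
      obtain ⟨h1, h2⟩ := hP b (hMU hb) w (hS' b hw)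
      exact ⟨h1, h2.trans (mul_le_mul_of_nonneg_right hηle (hcard0 _))⟩
    · intro w hw
      obtain ⟨h1, h2⟩ := hPQ w (hQ' hw)
      exact ⟨h1, h2.trans (mul_le_mul_of_nonneg_right hηle (hcard0 _))⟩
    · intro b hb w hw
      rw [union_empty] at hb
      exact ⟨(hreg b hb).1 w hw, ((hS'c b (hMU hb)).2 w hw).trans
        (mul_le_mul_of_nonneg_right hclean (hcard0 _))⟩
    · intro b hb
      refine (hlow b (hMU hb)).mono (θ := η₁ ^ N / 2) hηη₁ hη₁.le Subset.rfl (hS' b) ?_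
        (hS'c b (hMU hb)).1
      have := hcard0 P
      nlinarith
    · intro b hb
      exact (hreg b hb).2
  obtain ⟨A, X, X', hA, hAc, hAlk, hX, hor⟩ := TwoSource.exists_covers hDP hD hqm m Q' M ∅ S' η₁ hMm hTS
    hη₁ (by rw [union_empty, hMm]) hη₁m (by
      intro b hb
      rw [union_empty] at hb
      have h1 := hS'2 b hb
      have h2 := hSpos b (hMU hb)
      rw [nonempty_iff_ne_empty]
      intro he
      rw [he, card_empty, Nat.cast_zero, mul_zero] at h1
      linarith) (by
      rw [nonempty_iff_ne_empty]
      intro he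
      rw [he, card_empty, Nat.cast_zero] at hQ'c
      have h1 : (0 : ℝ) < Q.card := by exact_mod_cast hQne.card_pos
      have := mul_pos hpN h1
      linarith)
  rw [union_empty] at hAc hAlk hX
  have hAS : ∀ b, A b ⊆ S b := fun b => (hA b).trans (hS' b)
  refine ⟨M, hMU, hMm, A, hAS, ?_, ?_, ?_⟩
  · intro b hb
    refine (hS'2 b hb).trans ((mul_le_mul_of_nonneg_left (hAc b hb) (by linarith)).trans
      (le_of_eq ?_))
    ring
  · intro a ha b hb hab v hv
    exact (hAlk a ha b hb hab v hv).trans (mul_le_mul_of_nonneg_right hη' (hcard0 _))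
  · refine (hcon.linked hL (fun b hb v hv => hcol b (hMU hb) v (hAS b hv))
      (hC.mono_right hMU) (fun b hb w hw => hR b (hMU hb) w (hAS b hw)) (fun b hb => ?_) hor)
    obtain ⟨h1, h2, h3, h4⟩ := hX b hb
    exact ⟨h1, h2.trans hQ', h3, h4⟩

end Finish

/-! ### Collecting covered blocks with comparable degrees. -/

section Alternatives

variable {V : Type u} {G : SimpleGraph V}

/-- The sets `S b` for `b ∈ J` are covered by subsets of `Λ` anticomplete to all the other sets
except possibly `S ζ`, and look alike from the sets `S u`, robustly so, for `u ∈ U`. -/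
structure Alt (G : SimpleGraph V) (q : ℝ) (col : V → ℤ) (Λ : Finset V) (D₀ : ℝ) (ζ : ℤ)
    (J U : Finset ℤ) (S X : ℤ → Finset V) (D : ℤ → ℝ) (η : ℝ) : Prop where
  zeta : ζ ∉ J ∪ U
  disj : Disjoint J U
  col : ∀ b ∈ insert ζ (J ∪ U), ∀ v ∈ S b, col v = b
  lk : Lk G (insert ζ (J ∪ U)) S η
  lam : ∀ b ∈ J ∪ U, ∀ w ∈ S b, deg G w Λ ≤ D₀ ∧ deg G w Λ ≤ η * Λ.card
  low : ∀ b ∈ U, LowerStable G q Λ (S b) D₀ η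
  cov : ∀ b ∈ J, X b ⊆ Λ ∧ (∀ w ∈ S b, ∃ x ∈ X b, G.Adj x w) ∧
    ∀ k ∈ J ∪ U, k ≠ b → ∀ w ∈ S k, ∀ x ∈ X b, ¬ G.Adj x w
  pos : ∀ b ∈ J, 0 < D b
  pool : ∀ b ∈ J, ∀ u ∈ U, (∀ w ∈ S u, deg G w (S b) ≤ D b) ∧
    LowerStable G q (S b) (S u) (D b) η
  pair : ∀ b ∈ J, ∀ c ∈ J, b ≠ c → (∀ w ∈ S c, deg G w (S b) ≤ D b) ∨
    ∀ w ∈ S b, deg G w (S c) ≤ D c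

theorem Alt.mono {q D₀ η η' θ : ℝ} {col : V → ℤ} {Λ : Finset V} {ζ : ℤ} {J U J' U' : Finset ℤ}
    {S S' X : ℤ → Finset V} {D : ℤ → ℝ} (h : Alt G q col Λ D₀ ζ J U S X D η) (hJ : J' ⊆ J)
    (hU : U' ⊆ U) (hS : ∀ b, S' b ⊆ S b) (hθ1 : θ ≤ 1) (hη' : 0 ≤ η') (hθ : η ≤ η' * θ)
    (hc : ∀ b ∈ insert ζ (J' ∪ U'), θ * (S b).card ≤ (S' b).card) :
    Alt G q col Λ D₀ ζ J' U' S' X D η' := by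
  have hJU : J' ∪ U' ⊆ J ∪ U := union_subset_union hJ hU
  have hηη : η ≤ η' := hθ.trans (mul_le_of_le_one_right hη' hθ1)
  have hJ'c : ∀ b ∈ J', θ * (S b).card ≤ (S' b).card := fun b hb =>
    hc b (mem_insert_of_mem (mem_union_left _ hb))
  have hU'c : ∀ b ∈ U', θ * (S b).card ≤ (S' b).card := fun b hb =>
    hc b (mem_insert_of_mem (mem_union_right _ hb))
  refine ⟨fun hz => h.zeta (hJU hz), h.disj.mono hJ hU, ?_, ?_, ?_, ?_, ?_, ?_, ?_, ?_⟩
  · exact fun b hb v hv => h.col b (insert_subset_insert _ hJU hb) v (hS b hv)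
  · exact h.lk.mono (insert_subset_insert _ hJU) (fun b _ => hS b) hθ hη' hc
  · intro b hb w hw
    obtain ⟨h1, h2⟩ := h.lam b (hJU hb) w (hS b hw)
    exact ⟨h1, h2.trans (mul_le_mul_of_nonneg_right hηη (Nat.cast_nonneg _))⟩
  · intro b hb
    exact (h.low b (hU hb)).mono hθ hη' Subset.rfl (hS b)
      (mul_le_of_le_one_left (Nat.cast_nonneg _) hθ1) (hU'c b hb)
  · intro b hb
    obtain ⟨h1, h2, h3⟩ := h.cov b (hJ hb)
    exact ⟨h1, fun w hw => h2 w (hS b hw), fun k hk hkb w hw => h3 k (hJU hk) hkb w (hS k hw)⟩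
  · exact fun b hb => h.pos b (hJ hb)
  · intro b hb u hu
    obtain ⟨h1, h2⟩ := h.pool b (hJ hb) u (hU hu)
    exact ⟨fun w hw => (deg_mono (hS b)).trans (h1 w (hS u hw)),
      h2.mono hθ hη' (hS b) (hS u) (hJ'c b hb) (hU'c u hu)⟩
  · intro b hb c hc' hbc
    rcases h.pair b (hJ hb) c (hJ hc') hbc with h1 | h1
    · exact Or.inl fun w hw => (deg_mono (hS b)).trans (h1 w (hS c hw))
    · exact Or.inr fun w hw => (deg_mono (hS c)).trans (h1 w (hS b hw))

/-- The one-source form of the covering argument. `S ζ` is not among the spared sets, since no bound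
on its degrees into `Λ` is maintained. -/
theorem Alt.exists_cover {q D₀ η : ℝ} {col : V → ℤ} {Λ : Finset V} {ζ : ℤ} {J U : Finset ℤ}
    {S X : ℤ → Finset V} {D : ℤ → ℝ} (h : Alt G q col Λ D₀ ζ J U S X D η) (hη : 0 < η) {n : ℕ}
    (hn : (J ∪ U).card = n) (hηn : 8 * ((n : ℝ) + 1) ^ 2 * η ≤ 1) (hq : 16 * ((n : ℝ) + 1) ≤ q)
    (hD₀ : 0 < D₀) (hne : ∀ b ∈ J ∪ U, (S b).Nonempty) {b : ℤ} (hb : b ∈ U) :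
    ∃ Y ⊆ Λ, ∃ P ⊆ S b, (∀ w ∈ P, ∃ x ∈ Y, G.Adj x w) ∧ ((S b).card : ℝ) ≤ 2 * q ^ 2 * P.card ∧
      ∀ k ∈ (J ∪ U).erase b, ((nbrs G Y (S k)).card : ℝ) ≤ 1 / 2 * (S k).card := by
  have hbJU : b ∈ J ∪ U := mem_union_right _ hb
  have hn0 : (0 : ℝ) ≤ n := Nat.cast_nonneg _
  set O := (J ∪ U).erase b with hO
  have hOn : (O.card : ℝ) ≤ n := by rw [← hn]; exact card_mono (erase_subset _ _)
  have hOsub : ∀ k ∈ O, k ∈ J ∪ U := fun k hk => mem_of_mem_erase hk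
  set κ₀ : ℝ := 1 / (4 * (n + 1)) with hκ₀
  have hκ₀pos : 0 < κ₀ := by positivity
  have hκ₀n : κ₀ * (4 * (n + 1)) = 1 := by rw [hκ₀]; field_simp
  have hη2 : η ≤ 1 / 2 := by
    have : (8 : ℝ) ≤ 8 * ((n : ℝ) + 1) ^ 2 := by nlinarith
    nlinarith
  have hab : 2 * (O.card : ℝ) * η ≤ κ₀ := by
    rw [hκ₀, le_div_iff₀ (by positivity)]
    calc 2 * (O.card : ℝ) * η * (4 * (n + 1)) ≤ 2 * (n + 1) * η * (4 * (n + 1)) := by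
          gcongr; linarith
      _ = 8 * ((n : ℝ) + 1) ^ 2 * η := by ring
      _ ≤ 1 := hηn
  set Λ₁ := Λ.filter fun v => ∀ k ∈ O, deg G v (S k) ≤ κ₀ * (S k).card with hΛ₁
  have hΛ₁c : (Λ.card : ℝ) / 2 ≤ Λ₁.card := half_le_card_all_light hκ₀pos hab
    (fun k hk => hne k (hOsub k hk)) fun k hk w hw => (h.lam k (hOsub k hk) w hw).2
  have hΛ₁Λ : Λ₁ ⊆ Λ := filter_subset _ _
  set T := (S b).filter fun w => D₀ ≤ q * deg G w Λ₁ with hT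
  have hTc : ((S b).card : ℝ) ≤ 2 * T.card := by
    have h1 := h.low b hb Λ₁ hΛ₁Λ (by nlinarith [Nat.cast_nonneg (α := ℝ) Λ.card])
    have h2 := card_filter_add_not (S := S b) fun w => D₀ ≤ q * deg G w Λ₁
    simp only [not_le] at h2
    have h3 : (0 : ℝ) ≤ (S b).card := Nat.cast_nonneg _
    nlinarith
  have hTS : T ⊆ S b := filter_subset _ _
  obtain ⟨Y, hY, hYT, hYS⟩ := PurePairs.exists_cover (G := G) (q := q) (D := D₀) (κ := 1 / 2)
    (G₀ := Λ₁) (T := T) (J := O) (S := S) (by linarith) hD₀ (by norm_num) (by linarith)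
    (fun w hw => (mem_filter.1 hw).2)
    (fun w hw => (deg_mono hΛ₁Λ).trans (h.lam b hbJU w (hTS hw)).1)
    (fun k hk w hw => (deg_mono hΛ₁Λ).trans (h.lam k (hOsub k hk) w hw).1)
    (fun v hv k hk => by
      have h1 := (mem_filter.1 hv).2 k hk
      calc 2 * ((O.card : ℝ) + 1) * deg G v (S k) ≤ 2 * ((n : ℝ) + 1) * (κ₀ * (S k).card) := by
            gcongr
            exact deg_nonneg _ _
        _ = 1 / 2 * (κ₀ * (4 * (n + 1))) * (S k).card := by ring
        _ = 1 / 2 * (S k).card := by rw [hκ₀n, mul_one])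
    (fun k hk => hne k (hOsub k hk))
  refine ⟨Y, hY.trans hΛ₁Λ, nbrs G Y T, (nbrs_subset _ _).trans hTS, fun w hw => (mem_nbrs.1 hw).2,
    ?_, hYS⟩
  linarith

/-- A piece `P` of some `S b` is covered from `Λ`, the neighbours of the cover are deleted from the
other sets of `J ∪ U`, and the degrees from the surviving members of `U` into `P` are regularised,
which defines `D b`. `Alt.pair` holds for `b` and an earlier c because `b` was still in `U` when c
was treated, so `S b` already obeys the bound `D c` into `S c`; no bound in the other direction is
needed. -/
theorem Alt.step {γ q D₀ η η' s : ℝ} (hG : Coh G γ) (hγ : 0 < γ) {E k N n : ℕ}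
    (hN : N = (E + 1) * k * E) {col : V → ℤ} {Λ : Finset V} {ζ : ℤ} {J U : Finset ℤ}
    {S X : ℤ → Finset V} {D : ℤ → ℝ} (h : Alt G q col Λ D₀ ζ J U S X D η) (hη : 0 < η)
    (hη'0 : 0 < η') (hη'1 : η' ≤ 1) (hηη' : 4 * η ≤ η' ^ (N + 1)) (hn : (J ∪ U).card = n)
    (hηn : 8 * ((n : ℝ) + 1) ^ 2 * η ≤ 1) (hq : 16 * ((n : ℝ) + 1) ≤ q)
    (hqη : 4 ≤ q * η' ^ (N + 1)) (hD₀ : 0 < D₀) (hdeg : ∀ w X, deg G w X ≤ q ^ E)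
    (hU : (E + 1) * k + 1 ≤ U.card) (hs : ∀ b ∈ insert ζ (J ∪ U), s ≤ (S b).card)
    (hγs : γ * q ^ 3 ≤ s) :
    ∃ b ∈ U, ∃ U' ⊆ U.erase b, U'.card = k ∧ ∃ (S' X' : ℤ → Finset V) (D' : ℤ → ℝ),
      (∀ c, S' c ⊆ S c) ∧ (∀ c ∈ insert ζ (insert b J ∪ U'), s ≤ q ^ 3 * (S' c).card) ∧
      Alt G q col Λ D₀ ζ (insert b J) U' S' X' D' η' := by
  obtain ⟨b, hb⟩ : U.Nonempty := card_pos.1 (by omega)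
  have hbJU : b ∈ J ∪ U := mem_union_right _ hb
  have hbJ : b ∉ J := fun hbJ => (disjoint_left.1 h.disj) hbJ hb
  have hbζ : b ≠ ζ := fun e => h.zeta (e ▸ hbJU)
  have hq1 : 16 ≤ q := by
    have : (0 : ℝ) ≤ n := Nat.cast_nonneg _
    linarith
  have hq0 : 0 < q := by linarith
  have hcard0 : ∀ Y : Finset V, (0 : ℝ) ≤ Y.card := fun Y => Nat.cast_nonneg _
  have hpN : 0 < η' ^ N := by positivity
  have hpN' : 0 < η' ^ (N + 1) := by positivity
  have hpN1 : η' ^ N ≤ 1 := pow_le_one₀ hη'0.le hη'1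
  have e1 : η' ^ (N + 1) = η' ^ N * η' := pow_succ _ _
  have hle : η' ^ (N + 1) ≤ η' ^ N := by nlinarith
  have hs0 : 0 < s := lt_of_lt_of_le (by positivity) hγs
  have hne : ∀ c ∈ insert ζ (J ∪ U), (S c).Nonempty := by
    intro c hc
    have : (0 : ℝ) < (S c).card := hs0.trans_le (hs c hc)
    exact card_pos.1 (by exact_mod_cast this)
  obtain ⟨Y, hY, P, hPS, hYP, hPc, hYS⟩ := h.exists_cover hη hn hηn hq hD₀
    (fun c hc => hne c (mem_insert_of_mem hc)) hb
  set O := (J ∪ U).erase b with hO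
  have hOsub : ∀ c ∈ O, c ∈ J ∪ U := fun c hc => mem_of_mem_erase hc
  have hIsub : ∀ c ∈ insert ζ O, c ∈ insert ζ (J ∪ U) := fun c hc =>
    insert_subset_insert _ (erase_subset _ _) hc
  have hIb : ∀ c ∈ insert ζ O, b ≠ c := by
    intro c hc e
    rcases mem_insert.1 hc with h1 | h1
    · exact hbζ (e.trans h1)
    · exact (ne_of_mem_erase h1) e.symm
  set S₁ : ℤ → Finset V := fun c => if c ∈ O then S c \ nbrs G Y (S c) else S c with hS₁
  have hS₁S : ∀ c, S₁ c ⊆ S c := by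
    intro c
    by_cases hc : c ∈ O
    · simp only [hS₁, hc, if_true]; exact sdiff_subset
    · simp only [hS₁, hc, if_false]; exact Subset.rfl
  have hS₁c : ∀ c, ((S c).card : ℝ) ≤ 2 * (S₁ c).card := by
    intro c
    by_cases hc : c ∈ O
    · simp only [hS₁, hc, if_true]
      have := card_sdiff_nbrs_ge (hYS c hc)
      linarith
    · simp only [hS₁, hc, if_false]
      have := hcard0 (S c)
      linarith
  have hPs : γ * q ≤ 2 * (P.card : ℝ) := by
    have h1 := hs b (mem_insert_of_mem hbJU)
    have h2 : q ^ 2 * (γ * q) ≤ q ^ 2 * (2 * P.card) := by linarith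
    exact le_of_mul_le_mul_left h2 (by positivity)
  have hPγ : γ ≤ η' ^ (N + 1) * P.card := by
    have h1 := mul_le_mul_of_nonneg_left hPs hpN'.le
    have h2 := mul_le_mul_of_nonneg_left hqη hγ.le
    linarith
  have hPne : P.Nonempty := by
    rw [nonempty_iff_ne_empty]
    intro he
    rw [he] at hPs
    simp only [card_empty, Nat.cast_zero, mul_zero] at hPs
    have := mul_pos hγ hq0
    linarith
  have hcold : ∀ c ∈ insert ζ O, Disjoint P (S₁ c) := by
    intro c hc
    rw [disjoint_left]
    intro v hv hv'
    exact hIb c hc ((h.col b (mem_insert_of_mem hbJU) v (hPS hv)).symm.trans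
      (h.col c (hIsub c hc) v (hS₁S c hv')))
  obtain ⟨U', hU', hU'k, P', hP', S₂, Dn, hDn, hS₂, hP'c, hS₂c, hreg⟩ := exists_regular_clean hG
    (by linarith : 1 ≤ q) hη'0 hη'1 (by linarith : 0 < 2 * η) hN (I := insert ζ O) (U := U.erase b)
    (S := S₁) (P := P) (by rw [card_erase_of_mem hb]; omega)
    ((erase_subset_erase _ subset_union_right).trans (subset_insert _ _)) hcold hPne
    (fun c _ w _ => hdeg w P)
    (fun c hc v hv => by
      have h1 := h.lk b (mem_insert_of_mem hbJU) c (hIsub c hc) (hIb c hc) v (hPS hv)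
      have h2 : deg G v (S₁ c) ≤ deg G v (S c) := deg_mono (hS₁S c)
      have h3 := mul_le_mul_of_nonneg_left (hS₁c c) hη.le
      linarith) hPγ (fun c hc => by
      have h1 := hs c (hIsub c hc)
      have h2 := hS₁c c
      have h3 : γ * q ≤ γ * q ^ 3 := by
        refine mul_le_mul_of_nonneg_left ?_ hγ.le
        calc q = q ^ 1 := (pow_one q).symm
          _ ≤ q ^ 3 := pow_le_pow_right₀ (by linarith) (by norm_num)
      have h4 : η' ^ (N + 1) / 4 * (γ * q) ≤ η' ^ (N + 1) / 4 * (2 * (S₁ c).card) :=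
        mul_le_mul_of_nonneg_left (by linarith) (by positivity)
      have h5 := mul_le_mul_of_nonneg_left hqη hγ.le
      linarith)
  set S' : ℤ → Finset V := fun c => if c = b then P' else S₂ c with hS'
  have hS'b : S' b = P' := if_pos rfl
  have hS'c : ∀ c, c ≠ b → S' c = S₂ c := fun c hc => if_neg hc
  have hS'S : ∀ c, S' c ⊆ S c := by
    intro c
    by_cases hc : c = b
    · rw [hc, hS'b]; exact hP'.trans hPS
    · rw [hS'c c hc]; exact (hS₂ c).trans (hS₁S c)
  have hU'U : U' ⊆ U := hU'.trans (erase_subset _ _)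
  have hbU' : b ∉ U' := fun hbU => notMem_erase b U (hU' hbU)
  have hJUO : J ∪ U' ⊆ O := by
    intro c hc
    refine mem_erase.2 ⟨?_, union_subset_union Subset.rfl hU'U hc⟩
    rintro rfl
    rcases mem_union.1 hc with h1 | h1
    · exact hbJ h1
    · exact hbU' h1
  have hIsubO : ∀ c ∈ insert ζ (J ∪ U'), c ∈ insert ζ O := fun c hc => insert_subset_insert _ hJUO hc
  have hθ : ∀ c ∈ insert ζ O, η' ^ N / 4 * ((S c).card : ℝ) ≤ (S' c).card := by
    intro c hc
    rw [hS'c c (hIb c hc).symm]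
    refine le_trans ?_ (hS₂c c hc).1
    have := mul_le_mul_of_nonneg_left (hS₁c c) (by positivity : 0 ≤ η' ^ N / 4)
    linarith
  have hηθ : η ≤ η' * (η' ^ N / 4) := by linarith
  have hA : Alt G q col Λ D₀ ζ J U' S' X D η' := h.mono Subset.rfl hU'U hS'S (by linarith) hη'0.le hηθ
    fun c hc => hθ c (hIsubO c hc)
  have hcases : ∀ c ∈ insert ζ (insert b J ∪ U'), c = b ∨ c ∈ insert ζ (J ∪ U') := by
    intro c hc
    simp only [mem_insert, mem_union] at hc ⊢
    tauto
  have hcases' : ∀ c ∈ insert b J ∪ U', c = b ∨ c ∈ J ∪ U' := by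
    intro c hc
    simp only [mem_insert, mem_union] at hc ⊢
    tauto
  have hXc : ∀ c ∈ J, Function.update X b Y c = X c := fun c hc =>
    Function.update_of_ne (ne_of_mem_of_not_mem hc hbJ) _ _
  have hDc : ∀ c ∈ J, Function.update D b Dn c = D c := fun c hc =>
    Function.update_of_ne (ne_of_mem_of_not_mem hc hbJ) _ _
  refine ⟨b, hb, U', hU', hU'k, S', Function.update X b Y, Function.update D b Dn, hS'S, ?_, ?_⟩
  · intro c hc
    rcases hcases c hc with rfl | hc
    · rw [hS'b]
      have h1 := hs c (mem_insert_of_mem hbJU)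
      have h2 : 4 * (P.card : ℝ) ≤ q * η' ^ N * P.card :=
        mul_le_mul_of_nonneg_right (hqη.trans (mul_le_mul_of_nonneg_left hle hq0.le)) (hcard0 _)
      have h3 := mul_le_mul_of_nonneg_left hP'c hq0.le
      have h4 : q ^ 2 * (4 * (P.card : ℝ)) ≤ q ^ 2 * (q * P'.card) :=
        mul_le_mul_of_nonneg_left (by linarith) (by positivity)
      have h5 : 0 ≤ q ^ 2 * (P.card : ℝ) := mul_nonneg (by positivity) (hcard0 P)
      calc s ≤ q ^ 2 * (4 * (P.card : ℝ)) := by linarith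
        _ ≤ q ^ 2 * (q * P'.card) := h4
        _ = _ := by ring
    · have h1 := hs c (hIsub c (hIsubO c hc))
      have h2 := hθ c (hIsubO c hc)
      have h3 : 4 * ((S c).card : ℝ) ≤ q * η' ^ N * (S c).card :=
        mul_le_mul_of_nonneg_right (hqη.trans (mul_le_mul_of_nonneg_left hle hq0.le)) (hcard0 _)
      have h4 := mul_le_mul_of_nonneg_left h2 hq0.le
      have h5 : q * ((S' c).card : ℝ) ≤ q ^ 3 * (S' c).card := by
        refine mul_le_mul_of_nonneg_right ?_ (hcard0 _)
        calc q = q ^ 1 := (pow_one q).symm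
          _ ≤ q ^ 3 := pow_le_pow_right₀ (by linarith) (by norm_num)
      linarith
  · have hsubc : ∀ c ∈ insert ζ (J ∪ U'), c ∈ insert ζ (J ∪ U) := fun c hc => hIsub c (hIsubO c hc)
    refine ⟨?_, ?_, ?_, ?_, ?_, hA.low, ?_, ?_, ?_, ?_⟩
    · intro hz
      rcases hcases' ζ hz with e | e
      · exact hbζ e.symm
      · exact hA.zeta e
    · rw [disjoint_insert_left]
      exact ⟨hbU', hA.disj⟩
    · intro c hc v hv
      rcases hcases c hc with rfl | hc
      · exact h.col c (mem_insert_of_mem hbJU) v (hS'S c hv)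
      · exact hA.col c hc v hv
    · intro a ha c hc hac v hv
      rcases hcases c hc with rfl | hc₁
      · have ha' : a ∈ insert ζ O := hIsubO a ((hcases a ha).resolve_left hac)
        rw [hS'c a hac] at hv
        rw [hS'b]
        refine ((hS₂c a ha').2 v hv).trans (mul_le_mul_of_nonneg_right ?_ (hcard0 _))
        rw [div_le_iff₀ hpN]
        linarith
      · rcases hcases a ha with rfl | ha
        · have h1 := h.lk a (mem_insert_of_mem hbJU) c (hsubc c hc₁) hac v (hS'S a hv)
          have h2 : deg G v (S' c) ≤ deg G v (S c) := deg_mono (hS'S c)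
          have h3 := mul_le_mul_of_nonneg_left (hθ c (hIsubO c hc₁)) hη'0.le
          have h4 := mul_le_mul_of_nonneg_right hηθ (hcard0 (S c))
          linarith
        · exact hA.lk a ha c hc₁ hac v hv
    · intro c hc w hw
      rcases hcases' c hc with rfl | hc
      · obtain ⟨h1, h2⟩ := h.lam c hbJU w (hS'S c hw)
        refine ⟨h1, h2.trans (mul_le_mul_of_nonneg_right ?_ (hcard0 _))⟩
        nlinarith
      · exact hA.lam c hc w hw
    · intro c hc
      rcases mem_insert.1 hc with rfl | hcJ
      · rw [Function.update_self]
        refine ⟨hY, fun w hw => hYP w (hP' (hS'b ▸ hw)), ?_⟩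
        intro k hk hkc w hw x hx
        have hkO : k ∈ O := hJUO ((hcases' k hk).resolve_left hkc)
        rw [hS'c k hkc] at hw
        have hw1 := hS₂ k hw
        simp only [hS₁, hkO, if_true] at hw1
        exact not_adj_of_mem_sdiff_nbrs hw1 hx
      · rw [hXc c hcJ]
        obtain ⟨h1, h2, h3⟩ := h.cov c hcJ
        refine ⟨h1, fun w hw => h2 w (hS'S c hw), ?_⟩
        intro k hk hkc w hw
        refine h3 k ?_ hkc w (hS'S k hw)
        rcases hcases' k hk with rfl | hk
        · exact hbJU
        · exact hOsub k (hJUO hk)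
    · intro c hc
      rcases mem_insert.1 hc with rfl | hcJ
      · rw [Function.update_self]; exact hDn
      · rw [hDc c hcJ]; exact h.pos c hcJ
    · intro c hc u hu
      have hub : u ≠ b := fun e => hbU' (e ▸ hu)
      rcases mem_insert.1 hc with rfl | hcJ
      · rw [Function.update_self, hS'b, hS'c u hub]
        exact hreg u hu
      · rw [hDc c hcJ]
        exact hA.pool c hcJ u hu
    · intro c hc c' hc' hcc
      rcases mem_insert.1 hc with rfl | hcJ <;> rcases mem_insert.1 hc' with rfl | hcJ'
      · exact absurd rfl hcc
      · rw [hDc c' hcJ']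
        exact Or.inr fun w hw => (deg_mono (hS'S c')).trans ((h.pool c' hcJ' c hb).1 w (hS'S c hw))
      · rw [hDc c hcJ]
        exact Or.inl fun w hw => (deg_mono (hS'S c)).trans ((h.pool c hcJ c' hb).1 w (hS'S c' hw))
      · rw [hDc c hcJ, hDc c' hcJ']
        exact hA.pair c hcJ c' hcJ' hcc

/-- `r` applications of `Alt.step`, each costing a factor q^3. The tolerances are chosen backwards
from the last round, so `K`, `η` and `q₀` do not depend on the graph. -/
theorem Alt.exists_of_large (E : ℕ) (r : ℕ) : ∀ (k : ℕ) (η' : ℝ), 0 < η' → ∃ (K : ℕ) (η q₀ : ℝ),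
    0 < η ∧ ∀ {V : Type u} (G : SimpleGraph V) (γ q s D₀ : ℝ) (col : V → ℤ) (Λ : Finset V) (ζ : ℤ)
    (U : Finset ℤ) (S X : ℤ → Finset V) (D : ℤ → ℝ), Coh G γ → 0 < γ → q₀ ≤ q → 1 ≤ q →
    (∀ w X, deg G w X ≤ q ^ E) → 0 < D₀ → γ * q ^ (3 * r) ≤ s → K ≤ U.card →
    (∀ b ∈ insert ζ U, s ≤ (S b).card) → Alt G q col Λ D₀ ζ ∅ U S X D η →
    ∃ (J U' : Finset ℤ) (S' X' : ℤ → Finset V) (D' : ℤ → ℝ), J.card = r ∧ k ≤ U'.card ∧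
      J ∪ U' ⊆ U ∧ (∀ b, S' b ⊆ S b) ∧
      (∀ b ∈ insert ζ (J ∪ U'), s ≤ q ^ (3 * r) * (S' b).card) ∧
      Alt G q col Λ D₀ ζ J U' S' X' D' η' := by
  induction r with
  | zero =>
    intro k η' hη'
    refine ⟨k, η', 0, hη', ?_⟩
    intro V G γ q s D₀ col Λ ζ U S X D hG hγ hq hq1 hdeg hD₀ hγs hU hs h
    refine ⟨∅, U, S, X, D, card_empty, hU, by simp, fun b => Subset.rfl, ?_, h⟩
    intro b hb
    rw [empty_union] at hb
    simpa using hs b hb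
  | succ r ih =>
    intro k η'' hη''
    set η' := min η'' 1 with hη'def
    have hη'0 : 0 < η' := lt_min hη'' one_pos
    have hη'1 : η' ≤ 1 := min_le_right _ _
    set N := (E + 1) * k * E with hN
    set k' := (E + 1) * k + 1 with hk'
    set n := r + k' with hn
    set η₁ : ℝ := min (η' ^ (N + 1) / 4) (1 / (8 * ((n : ℝ) + 1) ^ 2)) with hη₁
    have hη₁0 : 0 < η₁ := lt_min (by positivity) (by positivity)
    have hη₁a : 4 * η₁ ≤ η' ^ (N + 1) := by
      have : η₁ ≤ η' ^ (N + 1) / 4 := min_le_left _ _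
      linarith
    have hη₁b : 8 * ((n : ℝ) + 1) ^ 2 * η₁ ≤ 1 := by
      have : η₁ ≤ 1 / (8 * ((n : ℝ) + 1) ^ 2) := min_le_right _ _
      rw [le_div_iff₀ (by positivity)] at this
      linarith
    obtain ⟨K, η, q₀, hη, hmain⟩ := ih k' η₁ hη₁0
    refine ⟨K, η, max q₀ (max (16 * ((n : ℝ) + 1)) (4 / η' ^ (N + 1))), hη, ?_⟩
    intro V G γ q s D₀ col Λ ζ U S X D hG hγ hq hq1 hdeg hD₀ hγs hU hs h
    have hqa : q₀ ≤ q := (le_max_left _ _).trans hq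
    have hqb : 16 * ((n : ℝ) + 1) ≤ q := (le_max_left _ _).trans ((le_max_right _ _).trans hq)
    have hqc : 4 ≤ q * η' ^ (N + 1) := by
      have : 4 / η' ^ (N + 1) ≤ q := (le_max_right _ _).trans ((le_max_right _ _).trans hq)
      rwa [div_le_iff₀ (by positivity)] at this
    have hq0 : 0 < q := by linarith
    have e3 : q ^ (3 * (r + 1)) = q ^ 3 * q ^ (3 * r) := by ring
    have hq3 : 1 ≤ q ^ 3 := one_le_pow₀ hq1
    have hq3r : 0 < q ^ (3 * r) := by positivity
    obtain ⟨J, U₁, S₁, X₁, D₁, hJ, hU₁, hJU, hS₁, hS₁c, hA⟩ := hmain G γ q s D₀ col Λ ζ U S X D hG hγ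
      hqa hq1 hdeg hD₀ (by
        rw [e3] at hγs
        have : γ * q ^ (3 * r) * 1 ≤ γ * q ^ (3 * r) * q ^ 3 :=
          mul_le_mul_of_nonneg_left hq3 (by positivity)
        linarith) hU hs h
    -- Trimming to exactly `k'` keeps the number of sets equal to the `n` for which the tolerance
    -- was chosen.
    obtain ⟨U₂, hU₂, hU₂c⟩ := exists_subset_card_eq hU₁
    have hA₂ : Alt G q col Λ D₀ ζ J U₂ S₁ X₁ D₁ η₁ := hA.mono (θ := 1) Subset.rfl hU₂
      (fun _ => Subset.rfl) le_rfl hη₁0.le (by simp) (fun _ _ => by simp)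
    have hcn : (J ∪ U₂).card = n := by
      rw [card_union_of_disjoint hA₂.disj, hJ, hU₂c]
    obtain ⟨b, hb, U', hU', hU'k, S', X', D', hS', hS'c, hA'⟩ := hA₂.step (s := s / q ^ (3 * r)) hG hγ
      hN hη₁0 hη'0 hη'1 hη₁a hcn hη₁b hqb hqc hD₀ hdeg hU₂c.ge (by
        intro b hb
        rw [div_le_iff₀ hq3r]
        have := hS₁c b (insert_subset_insert _ (union_subset_union Subset.rfl hU₂) hb)
        linarith) (by
        rw [le_div_iff₀ hq3r]
        rw [e3] at hγs
        linarith)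
    have hbJ : b ∉ J := fun hbJ => (disjoint_left.1 hA₂.disj) hbJ hb
    refine ⟨insert b J, U', S', X', D', by rw [card_insert_of_notMem hbJ, hJ], hU'k.ge, ?_,
      fun c => (hS' c).trans (hS₁ c), ?_, ?_⟩
    · intro c hc
      simp only [mem_union, mem_insert] at hc
      rcases hc with (rfl | hc) | hc
      · exact hJU (mem_union_right _ (hU₂ hb))
      · exact hJU (mem_union_left _ hc)
      · exact hJU (mem_union_right _ (hU₂ (mem_of_mem_erase (hU' hc))))
    · intro c hc
      have := hS'c c hc
      rw [div_le_iff₀ hq3r] at this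
      rw [e3]
      linarith
    · exact hA'.mono (θ := 1) Subset.rfl Subset.rfl (fun _ => Subset.rfl) le_rfl hη''.le
        (by rw [mul_one]; exact min_le_left _ _) (fun _ _ => by simp)

end Alternatives

/-! ### Two trees with a common root. -/

section Root

variable {V : Type u} {G : SimpleGraph V}

/-- Large sets can be shrunk a little to be expanding. -/
theorem exists_expanding_of_large {γ q s : ℝ} (hG : Coh G γ) (hγ : 0 < γ) {I : Finset ℤ} {e : ℕ}
    (hq : 8 * ((I.card : ℝ) + e + 1) ≤ q) (hγs : γ * q ≤ s) {S : ℤ → Finset V}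
    (hd : ∀ i ∈ I, ∀ j ∈ I, i ≠ j → Disjoint (S i) (S j)) (hs : ∀ b ∈ I, s ≤ (S b).card) :
    ∃ S' : ℤ → Finset V, (∀ b, S' b ⊆ S b) ∧ (∀ b ∈ I, ((S b).card : ℝ) ≤ 2 * (S' b).card) ∧
      ∀ i ∈ I, ∀ j ∈ I, i ≠ j → ∀ X ⊆ S' i, (X.card : ℝ) ≤ γ →
        (s / (γ * q) + e) * X.card ≤ (nbrs G X (S' j)).card := by
  have hn : (0 : ℝ) ≤ I.card := Nat.cast_nonneg _
  have he : (0 : ℝ) ≤ e := Nat.cast_nonneg _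
  have hq0 : 8 ≤ q := by linarith
  have hs0 : 0 < s := lt_of_lt_of_le (by positivity) hγs
  have h1 : s / (γ * q) * γ * q = s := by
    have : q ≠ 0 := by positivity
    field_simp
  have h0 : 0 ≤ s / (γ * q) := by positivity
  have h2 : s / (γ * q) * γ * 8 ≤ s := by
    have := mul_le_mul_of_nonneg_left hq0 (by positivity : 0 ≤ s / (γ * q) * γ)
    linarith
  have h3 := mul_le_mul_of_nonneg_right hq hγ.le
  have h4 : 0 ≤ (I.card : ℝ) * γ := by positivity
  have h5 : 0 ≤ (e : ℝ) * γ := by positivity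
  obtain ⟨S', hS', hc, hexp⟩ := exists_expanding hG hγ (g := s / (γ * q) + e) (by positivity) hd
    (fun b hb => by
      have := hs b hb
      linarith)
  refine ⟨S', hS', fun b hb => ?_, hexp⟩
  have := hs b hb
  have := hc b hb
  linarith

/-- Every vertex of `Λ` is joined to every vertex of `Z` by a rainbow walk of length `L` with
interior in `R` and with colours in `C`. -/
def Walks (G : SimpleGraph V) (col : V → ℤ) (Λ Z R : Finset V) (C : Finset ℤ) (L : ℕ) : Prop :=
  ∀ x ∈ Λ, ∀ z ∈ Z, ∃ f : ℕ → V, (∀ a < L, G.Adj (f a) (f (a + 1))) ∧ f 0 = x ∧ f L = z ∧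
    (∀ a, 0 < a → a < L → f a ∈ R) ∧ (∀ a ≤ L, ∀ b ≤ L, col (f a) = col (f b) → a = b) ∧
    ∀ a ≤ L, col (f a) ∈ C

/-- Down one tree to the root and up the other. Edges between the two trees are not excluded, so
this is only a walk; disjoint colour sets make it rainbow. -/
theorem TreePath.walks {col : V → ℤ} {w : V} {R₁ R₂ T₁ T₂ : Finset V} {t : ℕ} (ht : 1 ≤ t)
    {C₁ C₂ : Finset ℤ} (h₁ : ∀ x ∈ T₁, TreePath G col w R₁ t x)
    (h₂ : ∀ x ∈ T₂, TreePath G col w R₂ t x) (hR₁ : ∀ x ∈ R₁, x = w ∨ col x ∈ C₁)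
    (hR₂ : ∀ x ∈ R₂, x = w ∨ col x ∈ C₂) (hT₁ : ∀ x ∈ T₁, col x ∈ C₁) (hT₂ : ∀ x ∈ T₂, col x ∈ C₂)
    (hC : Disjoint C₁ C₂) (hw₁ : col w ∉ C₁) (hw₂ : col w ∉ C₂) :
    Walks G col T₁ T₂ (R₁ ∪ R₂) (insert (col w) (C₁ ∪ C₂)) (2 * t) := by
  intro x hx z hz
  obtain ⟨f, hf, hf0, hft, hfR, hfc⟩ := h₁ x hx
  obtain ⟨g, hg, hg0, hgt, hgR, hgc⟩ := h₂ z hz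
  have hfC : ∀ a, 0 < a → a ≤ t → col (f a) ∈ C₁ := by
    intro a ha0 ha
    rcases ha.lt_or_eq with ha | rfl
    · refine (hR₁ _ (hfR a ha)).resolve_left fun he => ?_
      have := hf.1 a ha.le 0 (Nat.zero_le _) (he.trans hf0.symm)
      omega
    · rw [hft]; exact hT₁ x hx
  have hgC : ∀ a, 0 < a → a ≤ t → col (g a) ∈ C₂ := by
    intro a ha0 ha
    rcases ha.lt_or_eq with ha | rfl
    · refine (hR₂ _ (hgR a ha)).resolve_left fun he => ?_
      have := hg.1 a ha.le 0 (Nat.zero_le _) (he.trans hg0.symm)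
      omega
    · rw [hgt]; exact hT₂ z hz
  set p : ℕ → V := fun a => if a ≤ t then f (t - a) else g (a - t) with hp
  have hp1 : ∀ a ≤ t, p a = f (t - a) := fun a ha => if_pos ha
  have hp2 : ∀ a, t ≤ a → p a = g (a - t) := by
    intro a ha
    rcases ha.lt_or_eq with h' | rfl
    · exact if_neg (by omega)
    · rw [hp1 t le_rfl, Nat.sub_self, hf0, hg0]
  have hcases : ∀ a ≤ 2 * t, (a < t ∧ col (p a) ∈ C₁) ∨ (a = t ∧ p a = w) ∨
      (t < a ∧ col (p a) ∈ C₂) := by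
    intro a ha
    rcases lt_trichotomy a t with h | rfl | h
    · rw [hp1 a h.le]
      exact Or.inl ⟨h, hfC _ (by omega) (by omega)⟩
    · rw [hp1 a le_rfl, Nat.sub_self]
      exact Or.inr (Or.inl ⟨rfl, hf0⟩)
    · rw [hp2 a h.le]
      exact Or.inr (Or.inr ⟨h, hgC _ (by omega) (by omega)⟩)
  refine ⟨p, ?_, ?_, ?_, ?_, ?_, ?_⟩
  · intro a ha
    rcases lt_or_ge a t with h | h
    · rw [hp1 a h.le, hp1 (a + 1) h, hf.2 _ (Nat.sub_le _ _) _ (Nat.sub_le _ _)]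
      omega
    · rw [hp2 a h, hp2 (a + 1) (by omega), hg.2 _ (by omega) _ (by omega)]
      omega
  · rw [hp1 0 (Nat.zero_le _)]
    exact hft
  · rw [hp2 (2 * t) (by omega), show 2 * t - t = t by omega]
    exact hgt
  · intro a ha0 ha
    rw [mem_union]
    rcases le_or_gt a t with h | h
    · rw [hp1 a h]
      exact Or.inl (hfR _ (by omega))
    · rw [hp2 a h.le]
      exact Or.inr (hgR _ (by omega))
  · intro a ha b hb he
    rcases hcases a ha with ⟨a1, a2⟩ | ⟨a1, a2⟩ | ⟨a1, a2⟩ <;>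
      rcases hcases b hb with ⟨b1, b2⟩ | ⟨b1, b2⟩ | ⟨b1, b2⟩
    · rw [hp1 a a1.le, hp1 b b1.le] at he
      have := hfc _ (Nat.sub_le _ _) _ (Nat.sub_le _ _) he
      omega
    · rw [he, b2] at a2; exact absurd a2 hw₁
    · rw [he] at a2; exact absurd b2 (disjoint_left.1 hC a2)
    · rw [← he, a2] at b2; exact absurd b2 hw₁
    · omega
    · rw [← he, a2] at b2; exact absurd b2 hw₂
    · rw [← he] at b2; exact absurd a2 (disjoint_left.1 hC b2)
    · rw [he, b2] at a2; exact absurd a2 hw₂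
    · rw [hp2 a a1.le, hp2 b b1.le] at he
      have := hgc _ (by omega) _ (by omega) he
      omega
  · intro a ha
    rw [mem_insert, mem_union]
    rcases hcases a ha with ⟨a1, a2⟩ | ⟨a1, a2⟩ | ⟨a1, a2⟩
    · exact Or.inr (Or.inl a2)
    · rw [a2]; exact Or.inl rfl
    · exact Or.inr (Or.inr a2)

/-- Two trees of depth `t` grow from one root through disjoint families of blocks. The top of the
first, once regularised, is `Λ`; the top of the second is `S' ζ`. Nothing is covered yet, so `X` and
`D` are placeholders. -/
theorem exists_alt (t E k : ℕ) (ht : 1 ≤ t) (η' : ℝ) (hη'0 : 0 < η') (hη'1 : η' ≤ 1) :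
    ∃ (K : ℕ) (η q₀ : ℝ), 0 < η ∧ ∀ {V : Type u} (G : SimpleGraph V) (γ q s : ℝ) (col : V → ℤ)
    (I : Finset ℤ) (S : ℤ → Finset V), Coh G γ → 1 ≤ γ → q₀ ≤ q → 1 ≤ q →
    (∀ w X, deg G w X ≤ q ^ E) → γ * q ≤ s → γ ≤ (s / (γ * q)) ^ (t - 1) → K ≤ I.card →
    (∀ b ∈ I, s ≤ (S b).card) → (∀ b ∈ I, ∀ v ∈ S b, col v = b) → Lk G I S η →
    ∃ (Λ Low : Finset V) (C : Finset ℤ) (ζ : ℤ) (U : Finset ℤ) (S' X : ℤ → Finset V) (D : ℤ → ℝ)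
      (D₀ : ℝ), ζ ∈ C ∧ C ⊆ I ∧ Disjoint C U ∧ U ⊆ I ∧ k ≤ U.card ∧ (∀ b, S' b ⊆ S b) ∧
      (∀ b ∈ insert ζ U, s ≤ q * (S' b).card) ∧ 0 < D₀ ∧ Alt G q col Λ D₀ ζ ∅ U S' X D η' ∧
      (∀ b ∈ U, ∀ w ∈ S' b, ∀ v ∈ Low, ¬ G.Adj v w) ∧ Walks G col Λ (S' ζ) Low C (2 * t) := by
  set N := (E + 1) * k * E with hN
  set κ : ℝ := 1 / 4 ^ (t + 1) with hκ
  have hκ0 : 0 < κ := by positivity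
  have hκ4 : κ * 4 ^ (t + 1) = 1 := by rw [hκ]; field_simp
  have hκt : κ * 4 ^ t = 1 / 4 := by
    rw [pow_succ] at hκ4
    linarith
  have hκ1 : κ ≤ 1 := by
    have : (1 : ℝ) ≤ 4 ^ t := one_le_pow₀ (by norm_num)
    nlinarith
  have hpN : 0 < η' ^ N := by positivity
  have hpN1 : η' ^ N ≤ 1 := pow_le_one₀ hη'0.le hη'1
  have e1 : η' ^ (N + 1) = η' ^ N * η' := pow_succ _ _
  have hpN' : 0 < η' ^ (N + 1) := by positivity
  have hle : η' ^ (N + 1) ≤ η' ^ N := by nlinarith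
  set c₀ : ℝ := κ * η' ^ (N + 1) / 8 with hc₀
  have hc₀0 : 0 < c₀ := by positivity
  have hc₀a : 8 * c₀ ≤ η' ^ (N + 1) := by nlinarith
  have hc₀b : 8 * c₀ ≤ κ := by nlinarith
  -- One block for the root, `t` for each tree, a spare because a tree needs more than `t` blocks
  -- available, and (E + 1)k for the regularisation.
  set K := 2 * t + 2 + (E + 1) * k with hK
  refine ⟨K, η' * c₀, max (8 * ((K : ℝ) + t + 1)) (1 / c₀), by positivity, ?_⟩
  intro V G γ q s col I₀ S hG hγ1 hq₀ hq1 hdeg hγs hγt hKI hs₀ hcol₀ hlk₀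
  obtain ⟨I, hI₀, hIK⟩ := exists_subset_card_eq hKI
  have hs : ∀ b ∈ I, s ≤ (S b).card := fun b hb => hs₀ b (hI₀ hb)
  have hcol : ∀ b ∈ I, ∀ v ∈ S b, col v = b := fun b hb => hcol₀ b (hI₀ hb)
  have hlk : Lk G I S (η' * c₀) := fun a ha b hb => hlk₀ a (hI₀ ha) b (hI₀ hb)
  have hγ : 0 < γ := by linarith
  have hq0 : 0 < q := by linarith
  have hqc : 1 ≤ q * c₀ := by
    have : 1 / c₀ ≤ q := (le_max_right _ _).trans hq₀
    rwa [div_le_iff₀ hc₀0] at this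
  have hs0 : 0 < s := lt_of_lt_of_le (by positivity) hγs
  have hγc : γ ≤ c₀ * s := by
    have h1 := mul_le_mul_of_nonneg_left hγs hc₀0.le
    have h2 := mul_le_mul_of_nonneg_left hqc hγ.le
    linarith
  have hsc : s ≤ q * (c₀ * s) := by
    have := mul_le_mul_of_nonneg_right hqc hs0.le
    linarith
  have hcard0 : ∀ Y : Finset V, (0 : ℝ) ≤ Y.card := fun Y => Nat.cast_nonneg _
  obtain ⟨S₁, hS₁, hS₁c, hexp⟩ := exists_expanding_of_large hG hγ (I := I) (e := t)
    (by rw [hIK]; exact (le_max_left _ _).trans hq₀) hγs (fun i hi j hj hij => by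
      rw [disjoint_left]
      intro v hv hv'
      exact hij ((hcol i hi v hv).symm.trans (hcol j hj v hv'))) hs
  have hs₁ : ∀ b ∈ I, s / 2 ≤ (S₁ b).card := by
    intro b hb
    have := hs b hb
    have := hS₁c b hb
    linarith
  have hcol₁ : ∀ b ∈ I, ∀ v ∈ S₁ b, col v = b := fun b hb v hv => hcol b hb v (hS₁ b hv)
  have hlk₁ : ∀ a ∈ I, ∀ b ∈ I, a ≠ b → ∀ v ∈ S₁ a, deg G v (S₁ b) ≤ κ * (S₁ b).card :=
    hlk.mono (θ := 1 / 2) Subset.rfl (fun b _ => hS₁ b) (by nlinarith) hκ0.le fun b hb => by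
      have := hS₁c b hb
      linarith
  set g := s / (γ * q) with hg
  have hg1 : 1 ≤ g := by
    rw [hg, le_div_iff₀ (by positivity)]
    linarith
  have hsz : ∀ b ∈ I, γ ≤ κ * (S₁ b).card := by
    intro b hb
    have h1 := mul_le_mul_of_nonneg_left (hs₁ b hb) hκ0.le
    have h2 := mul_le_mul_of_nonneg_right hc₀b hs0.le
    have h3 : 0 < c₀ * s := by positivity
    linarith
  obtain ⟨ρ, hρ⟩ : I.Nonempty := card_pos.1 (by omega)
  obtain ⟨w, hw⟩ : (S₁ ρ).Nonempty := by
    have : (0 : ℝ) < (S₁ ρ).card := lt_of_lt_of_le (by positivity) (hs₁ ρ hρ)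
    exact card_pos.1 (by exact_mod_cast this)
  have hwρ : col w = ρ := hcol₁ ρ hρ w hw
  have htree : ∀ I' ⊆ I.erase ρ, t < I'.card → ∃ used Low Top,
      TreeState G col w I' S₁ κ t used Low Top ∧
        ∃ b ∈ used, Top ⊆ S₁ b ∧ κ * (S₁ b).card ≤ Top.card := by
    intro I' hI' hI'c
    have hI'I : I' ⊆ I := hI'.trans (erase_subset _ _)
    obtain ⟨used, Low, Top, hst, hT | hT⟩ := exists_tree (g := g) hG hγ (col := col) (z := w) (I := I')
      (J := ∅) (S := S₁) (s := t) (t := t) (κ := κ)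
      (fun b hb => hcol₁ b (hI'I (by simpa using hb)))
      (by rw [hwρ, union_empty]; exact fun h => notMem_erase ρ I (hI' h)) ht hκ0 hκ4.le
      (fun a ha b hb => hlk₁ a (hI'I (by simpa using ha)) b (hI'I (by simpa using hb)))
      (fun b hb => by
        have hb' : b ∈ I' := by simpa using hb
        exact hlk₁ ρ hρ b (hI'I hb') (ne_of_mem_erase (hI' hb')).symm w hw)
      (fun a ha b hb => hexp a (hI'I ha) b (hI'I hb))
      (fun b hb => by
        have := hexp ρ hρ b (hI'I hb) (ne_of_mem_erase (hI' hb)).symm {w}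
          (singleton_subset_iff.2 hw) (by simpa using hγ1)
        rw [card_nbrs_singleton, card_singleton, Nat.cast_one, mul_one] at this
        exact this) hg1 hγt (fun b hb => hsz b (hI'I (by simpa using hb))) hI'c t le_rfl
    · rw [union_empty] at hst
      exact ⟨used, Low, Top, hst, hT⟩
    · exact absurd hT.1 (lt_irrefl _)
  have hIρ : (I.erase ρ).card = 2 * t + 1 + (E + 1) * k := by
    rw [card_erase_of_mem hρ]; omega
  obtain ⟨used₁, Low₁, Top₁, hst₁, b₁, hb₁, hT₁, hT₁c⟩ := htree (I.erase ρ) Subset.rfl (by omega)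
  set I₂ := I.erase ρ \ used₁ with hI₂
  have hI₂c : I₂.card = t + 1 + (E + 1) * k := by
    rw [hI₂, card_sdiff_of_subset hst₁.used_subset, hst₁.card_used]; omega
  obtain ⟨used₂, Low₂, Top₂, hst₂, ζ, hζ, hT₂, hT₂c⟩ := htree I₂ sdiff_subset (by omega)
  set U := I₂ \ used₂ with hU
  have hUc : (E + 1) * k ≤ U.card := by
    rw [hU, card_sdiff_of_subset hst₂.used_subset, hst₂.card_used]; omega
  have hI₂I : I₂ ⊆ I := sdiff_subset.trans (erase_subset _ _)
  have hUI : U ⊆ I := sdiff_subset.trans hI₂I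
  have hu₁I : used₁ ⊆ I := hst₁.used_subset.trans (erase_subset _ _)
  have hu₂I : used₂ ⊆ I := hst₂.used_subset.trans hI₂I
  have hζI : ζ ∈ I := hu₂I hζ
  have hb₁I : b₁ ∈ I := hu₁I hb₁
  have hu₁₂ : Disjoint used₁ used₂ :=
    disjoint_sdiff.mono_right hst₂.used_subset
  have hUρ : ∀ b ∈ U, b ≠ ρ ∧ b ∉ used₁ ∧ b ∉ used₂ := by
    intro b hb
    obtain ⟨h1, h2⟩ := mem_sdiff.1 hb
    obtain ⟨h3, h4⟩ := mem_sdiff.1 h1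
    exact ⟨ne_of_mem_erase h3, h4, h2⟩
  have hUζ : ∀ b ∈ U, b ≠ ζ := fun b hb e => (hUρ b hb).2.2 (e ▸ hζ)
  set Low := Low₁ ∪ Low₂ with hLow
  -- The lower levels of each tree cover at most κ4^t = 1/4 of an unused set, so deleting the
  -- neighbours of both leaves at least half.
  set S₂ : ℤ → Finset V := fun b => if b = ζ then Top₂ else S₁ b \ nbrs G Low (S₁ b) with hS₂
  have hS₂ζ : S₂ ζ = Top₂ := if_pos rfl
  have hS₂b : ∀ b, b ≠ ζ → S₂ b = S₁ b \ nbrs G Low (S₁ b) := fun b hb => if_neg hb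
  have hS₂S : ∀ b, S₂ b ⊆ S b := by
    intro b
    by_cases hb : b = ζ
    · rw [hb, hS₂ζ]; exact hT₂.trans (hS₁ ζ)
    · rw [hS₂b b hb]; exact sdiff_subset.trans (hS₁ b)
  have hS₂c : ∀ b ∈ U, ((S b).card : ℝ) ≤ 4 * (S₂ b).card := by
    intro b hb
    obtain ⟨-, hbu₁, hbu₂⟩ := hUρ b hb
    have h1 := hst₁.cover b (mem_sdiff.1 (mem_sdiff.1 hb).1).1 hbu₁
    have h2 := hst₂.cover b (mem_sdiff.1 hb).1 hbu₂
    have h3 := card_nbrs_union_le (G := G) Low₁ Low₂ (S₁ b)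
    rw [hκt] at h1 h2
    have h4 := card_sdiff_nbrs_ge (G := G) (X := Low) (B := S₁ b) (κ := 1 / 2) (by linarith)
    rw [hS₂b b (hUζ b hb)]
    have := hS₁c b (hUI hb)
    linarith
  have hTop₂c : κ * (S ζ).card ≤ 2 * Top₂.card := by
    have := mul_le_mul_of_nonneg_left (hS₁c ζ hζI) hκ0.le
    linarith
  have hTop₁s : κ * s ≤ 2 * Top₁.card := by
    have := mul_le_mul_of_nonneg_left (hs₁ b₁ hb₁I) hκ0.le
    linarith
  have hTop₁ne : Top₁.Nonempty := by
    rw [nonempty_iff_ne_empty]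
    intro he
    rw [he, card_empty, Nat.cast_zero, mul_zero] at hTop₁s
    have := mul_pos hκ0 hs0
    linarith
  obtain ⟨U', hU', hU'k, Λ, hΛ, S₃, D₀, hD₀, hS₃, hΛc, hS₃c, hreg⟩ := exists_regular_clean hG hq1 hη'0
    hη'1 (by positivity : 0 < 4 * (η' * c₀)) hN hUc Subset.rfl (P := Top₁) (S := S₂)
    (fun b hb => by
      rw [disjoint_left]
      intro v hv hv'
      have h1 := hcol₁ b₁ hb₁I v (hT₁ hv)
      have h2 := hcol b (hUI hb) v (hS₂S b hv')
      exact (hUρ b hb).2.1 (h2 ▸ h1 ▸ hb₁)) hTop₁ne (fun b _ w _ => hdeg w _)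
    (fun b hb v hv => by
      have hne : b₁ ≠ b := fun e => (hUρ b hb).2.1 (e ▸ hb₁)
      have h1 := hlk b₁ hb₁I b (hUI hb) hne v (hS₁ b₁ (hT₁ hv))
      have h2 : deg G v (S₂ b) ≤ deg G v (S b) := deg_mono (hS₂S b)
      have h3 := mul_le_mul_of_nonneg_left (hS₂c b hb) (by positivity : 0 ≤ η' * c₀)
      linarith)
    (by
      have h1 := mul_le_mul_of_nonneg_left hTop₁s hpN'.le
      have h2 : 8 * (c₀ * s) = η' ^ (N + 1) * (κ * s) := by rw [hc₀]; ring
      have h3 : 0 < c₀ * s := by positivity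
      linarith)
    (fun b hb => by
      have h1 := hs b (hUI hb)
      have h2 := hS₂c b hb
      have h3 : 8 * c₀ * s ≤ η' ^ (N + 1) * s := mul_le_mul_of_nonneg_right hc₀a hs0.le
      have h4 : η' ^ (N + 1) * s ≤ η' ^ (N + 1) * (4 * (S₂ b).card) :=
        mul_le_mul_of_nonneg_left (by linarith) hpN'.le
      linarith)
  have hUζ' : ∀ b ∈ U', b ≠ ζ := fun b hb => hUζ b (hU' hb)
  set S' : ℤ → Finset V := fun b => if b = ζ then Top₂ else S₃ b with hS'
  have hS'ζ : S' ζ = Top₂ := if_pos rfl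
  have hS'b : ∀ b, b ≠ ζ → S' b = S₃ b := fun b hb => if_neg hb
  have hS'S : ∀ b, S' b ⊆ S b := by
    intro b
    by_cases hb : b = ζ
    · rw [hb, hS'ζ]; exact hT₂.trans (hS₁ ζ)
    · rw [hS'b b hb]; exact (hS₃ b).trans (hS₂S b)
  have hθ : ∀ b ∈ insert ζ U', c₀ * (S b).card ≤ (S' b).card := by
    intro b hb
    rcases mem_insert.1 hb with rfl | hb
    · rw [hS'ζ]
      have := mul_le_mul_of_nonneg_right hc₀b (hcard0 (S b))
      have := mul_nonneg hc₀0.le (hcard0 (S b))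
      linarith
    · rw [hS'b b (hUζ' b hb)]
      refine le_trans ?_ (hS₃c b (hU' hb)).1
      have h1 := mul_le_mul_of_nonneg_left (hS₂c b (hU' hb)) hc₀0.le
      have h2 := mul_le_mul_of_nonneg_right (hc₀a.trans hle) (hcard0 (S₂ b))
      linarith
  have hIζ : insert ζ U' ⊆ I := insert_subset hζI (hU'.trans hUI)
  refine ⟨Λ, Low, insert (col w) (used₁ ∪ used₂), ζ, U', S', fun _ => ∅, fun _ => 0, D₀,
    mem_insert_of_mem (mem_union_right _ hζ), ?_, ?_, hU'.trans (hUI.trans hI₀), hU'k.ge, hS'S, ?_, hD₀,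
    ?_, ?_, ?_⟩
  · rw [hwρ]
    exact (insert_subset hρ (union_subset hu₁I hu₂I)).trans hI₀
  · rw [disjoint_right, hwρ]
    intro b hb hb'
    obtain ⟨h1, h2, h3⟩ := hUρ b (hU' hb)
    simp only [mem_insert, mem_union] at hb'
    tauto
  · intro b hb
    have h1 := hθ b hb
    have h2 := mul_le_mul_of_nonneg_left (hs b (hIζ hb)) hc₀0.le
    have h3 := mul_le_mul_of_nonneg_left (h2.trans h1) hq0.le
    linarith
  · have hlk' : Lk G (insert ζ U') S' η' := hlk.mono (θ := c₀) hIζ (fun b _ => hS'S b) le_rfl hη'0.le hθ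
    refine ⟨?_, disjoint_empty_left _, ?_, ?_, ?_, ?_, by simp, by simp, by simp, by simp⟩
    · rw [empty_union]
      exact fun h => hUζ' ζ h rfl
    · rw [empty_union]
      exact fun b hb v hv => hcol b (hIζ hb) v (hS'S b hv)
    · rw [empty_union]
      exact hlk'
    · rw [empty_union]
      intro b hb v hv
      rw [hS'b b (hUζ' b hb)] at hv
      refine ⟨(hreg b hb).1 v hv, ((hS₃c b (hU' hb)).2 v hv).trans
        (mul_le_mul_of_nonneg_right ?_ (hcard0 _))⟩
      rw [div_le_iff₀ hpN]
      nlinarith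
    · intro b hb
      rw [hS'b b (hUζ' b hb)]
      exact (hreg b hb).2
  · intro b hb v hv x hx
    rw [hS'b b (hUζ' b hb)] at hv
    have := hS₃ b hv
    rw [hS₂b b (hUζ' b hb)] at this
    exact not_adj_of_mem_sdiff_nbrs this hx
  · rw [hS'ζ]
    have hlow : ∀ used Low : Finset _, used ⊆ I → (∀ v ∈ Low, v = w ∨ ∃ b ∈ used, v ∈ S₁ b) →
        ∀ x ∈ Low, x = w ∨ col x ∈ used := by
      intro used Low hu h x hx
      rcases h x hx with h | ⟨b, hb, hxb⟩
      · exact Or.inl h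
      · rw [hcol₁ b (hu hb) x hxb]
        exact Or.inr hb
    have hwalk := TreePath.walks (G := G) (col := col) ht hst₁.path hst₂.path
      (hlow used₁ Low₁ hu₁I hst₁.low) (hlow used₂ Low₂ hu₂I hst₂.low)
      (fun x hx => by rw [hcol₁ b₁ hb₁I x (hT₁ hx)]; exact hb₁)
      (fun x hx => by rw [hcol₁ ζ hζI x (hT₂ hx)]; exact hζ) hu₁₂
      (by rw [hwρ]; exact fun h => notMem_erase ρ I (hst₁.used_subset h))
      (by rw [hwρ]; exact fun h => notMem_erase ρ I (mem_sdiff.1 (hst₂.used_subset h)).1)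
    exact fun x hx => hwalk x (hΛ hx)

end Root

/-! ### Paths of one exact length between two blocks. -/

section Link

variable {V : Type u} {G : SimpleGraph V}

theorem exists_card_filter_ge {α : Type*} {T : Finset α} {n : ℕ} {p : ℕ → α → Prop}
    (hn : 0 < n) (h : ∀ x ∈ T, ∃ d < n, p d x) : ∃ d < n, T.card ≤ n * (T.filter (p d)).card := by
  have hsub : T ⊆ (range n).biUnion fun d => T.filter (p d) := by
    intro x hx
    obtain ⟨d, hd, hp⟩ := h x hx
    exact mem_biUnion.2 ⟨d, mem_range.2 hd, mem_filter.2 ⟨hx, hp⟩⟩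
  have h1 : T.card ≤ ∑ d ∈ range n, (T.filter (p d)).card :=
    (card_le_card hsub).trans card_biUnion_le
  obtain ⟨d, hd, hmax⟩ := exists_max_image (range n) (fun d => (T.filter (p d)).card)
    ⟨0, mem_range.2 hn⟩
  refine ⟨d, mem_range.1 hd, h1.trans ?_⟩
  have := sum_le_card_nsmul (range n) _ _ hmax
  simpa using this

/-- Prefix `x` to the walk starting at its neighbour in `X`, and shortcut. Only an upper bound on
the resulting length is known, which is why a pigeonhole argument must follow. -/
theorem Walks.exists_indPath {col : V → ℤ} {Λ Z R X : Finset V} {C : Finset ℤ} {L : ℕ}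
    (h : Walks G col Λ Z R C L) (hX : X ⊆ Λ) {x y z : V} (hy : y ∈ X) (hxy : G.Adj y x)
    (hx : col x ∉ C) (hz : z ∈ Z) : ∃ d < L + 2, ∃ f : ℕ → V, IsIndPath G f d ∧ f 0 = x ∧ f d = z ∧
      (∀ a, 0 < a → a < d → f a ∈ X ∪ R) ∧ (∀ a ≤ d, ∀ b ≤ d, col (f a) = col (f b) → a = b) ∧
      ∀ a, 0 < a → a ≤ d → col (f a) ∈ C := by
  obtain ⟨f, hf, hf0, hfL, hfR, hfc, hfC⟩ := h y (hX hy) z hz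
  set p : ℕ → V := fun a => if a = 0 then x else f (a - 1) with hp
  have hp0 : p 0 = x := if_pos rfl
  have hps : ∀ a, 0 < a → p a = f (a - 1) := fun a ha => if_neg (by omega)
  have hpC : ∀ a, 0 < a → a ≤ L + 1 → col (p a) ∈ C := by
    intro a ha0 ha
    rw [hps a ha0]
    exact hfC _ (by omega)
  have hpc : ∀ a ≤ L + 1, ∀ b ≤ L + 1, col (p a) = col (p b) → a = b := by
    intro a ha b hb he
    rcases Nat.eq_zero_or_pos a with rfl | ha0 <;> rcases Nat.eq_zero_or_pos b with rfl | hb0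
    · rfl
    · rw [hp0] at he
      exact absurd (he ▸ hpC b hb0 hb) hx
    · rw [hp0] at he
      exact absurd (he ▸ hpC a ha0 ha) hx
    · rw [hps a ha0, hps b hb0] at he
      have := hfc _ (by omega) _ (by omega) he
      omega
  obtain ⟨d, hd, g, hg, hg0, hgd, hgp⟩ := exists_indPath_of_walk (G := G) (f := p) (L := L + 1) (by
    intro a ha
    rcases Nat.eq_zero_or_pos a with rfl | ha0
    · rw [hp0, hps 1 one_pos, Nat.sub_self, hf0]
      exact hxy.symm
    · rw [hps a ha0, hps (a + 1) (by omega), show a + 1 - 1 = a - 1 + 1 by omega]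
      exact hf _ (by omega))
  refine ⟨d, by omega, g, hg, hg0.trans hp0, ?_, ?_, ?_, ?_⟩
  · rw [hgd, hps _ (by omega), Nat.add_sub_cancel, hfL]
  · intro a ha0 ha
    obtain ⟨i, hi, he⟩ := hgp a ha.le
    have hi0 : i ≠ 0 := by
      rintro rfl
      have := hg.1 a ha.le 0 (Nat.zero_le _) (he.trans hg0.symm)
      omega
    have hiL : i ≠ L + 1 := by
      rintro rfl
      have := hg.1 a ha.le d le_rfl (he.trans hgd.symm)
      omega
    rw [he, hps i (by omega), mem_union]
    by_cases hi1 : i = 1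
    · subst hi1
      rw [Nat.sub_self, hf0]
      exact Or.inl hy
    · exact Or.inr (hfR _ (by omega) (by omega))
  · intro a ha b hb he
    obtain ⟨i, hi, hgi⟩ := hgp a ha
    obtain ⟨j, hj, hgj⟩ := hgp b hb
    rw [hgi, hgj] at he
    have hij := hpc i hi j hj he
    exact hg.1 a ha b hb (by rw [hgi, hgj, hij])
  · intro a ha0 ha
    obtain ⟨i, hi, he⟩ := hgp a ha
    rw [he]
    refine hpC i (Nat.pos_of_ne_zero ?_) hi
    rintro rfl
    have := hg.1 a ha 0 (Nat.zero_le _) (he.trans hg0.symm)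
    omega

/-- The two paths meet at `z`. The tree beyond `z` is anticomplete to the interior of the first
path, and `Λ` is anticomplete to the lower levels of the tree, so the one chord left to exclude is
the edge between the two ends. Hence connectors concern nonadjacent pairs only. -/
theorem connector_of_paths {col : V → ℤ} {Λ Top X R : Finset V} {C used : Finset ℤ} {r : ℤ} {z : V}
    {d s : ℕ} (hs : 0 < s)
    (h₁ : ∀ x ∈ Λ, ∃ f : ℕ → V, IsIndPath G f d ∧ f 0 = x ∧ f d = z ∧
      (∀ a, 0 < a → a < d → f a ∈ X) ∧ (∀ a ≤ d, ∀ b ≤ d, col (f a) = col (f b) → a = b) ∧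
      ∀ a, 0 < a → a ≤ d → col (f a) ∈ C)
    (hr : ∀ x ∈ Λ, col x = r) (hru : r ∉ used) (hCu : Disjoint C used)
    (h₂ : ∀ y ∈ Top, TreePath G col z R s y)
    (hR : ∀ v ∈ R, v = z ∨ col v ∈ used ∧ ∀ x ∈ X, ¬ G.Adj x v)
    (hTop : ∀ y ∈ Top, col y ∈ used ∧ ∀ x ∈ X, ¬ G.Adj x y)
    (hΛ : ∀ x ∈ Λ, ∀ v ∈ R, ¬ G.Adj v x) :
    Connector G col Λ Top (X ∪ R) (insert r (C ∪ used)) (d + s) := by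
  intro x hx y hy hxy
  obtain ⟨h, hh, hh0, hhd, hhX, hhc, hhC⟩ := h₁ x hx
  obtain ⟨f, hf, hf0, hfs, hfR, hfc⟩ := h₂ y hy
  have hfu : ∀ b, 0 < b → b ≤ s → col (f b) ∈ used ∧ ∀ x ∈ X, ¬ G.Adj x (f b) := by
    intro b hb0 hb
    rcases hb.lt_or_eq with hb | rfl
    · refine (hR _ (hfR b hb)).resolve_left fun he => ?_
      have := hf.1 b hb.le 0 (Nat.zero_le _) (he.trans hf0.symm)
      omega
    · rw [hfs]; exact hTop y hy
  have hhu : ∀ a ≤ d, col (h a) ∈ insert r C ∧ col (h a) ∉ used := by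
    intro a ha
    rcases Nat.eq_zero_or_pos a with rfl | ha0
    · rw [hh0, hr x hx]
      exact ⟨mem_insert_self _ _, hru⟩
    · exact ⟨mem_insert_of_mem (hhC a ha0 ha), disjoint_left.1 hCu (hhC a ha0 ha)⟩
  obtain ⟨g, hg, hg1, hg2⟩ := hh.append hf (hhd.trans hf0.symm) (by
    intro a ha b hb0 hb
    refine ⟨fun he => (hhu a ha.le).2 (he ▸ (hfu b hb0 hb).1), ?_⟩
    rcases Nat.eq_zero_or_pos a with rfl | ha0
    · rw [hh0]
      rcases hb.lt_or_eq with hb | rfl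
      · exact fun e => hΛ x hx _ (hfR b hb) e.symm
      · rw [hfs]; exact hxy
    · exact (hfu b hb0 hb).2 _ (hhX a ha0 ha))
  have hcases : ∀ a ≤ d + s, (a ≤ d ∧ g a = h a) ∨ (d < a ∧ g a = f (a - d)) := by
    intro a ha
    rcases le_or_gt a d with h' | h'
    · exact Or.inl ⟨h', hg1 a h'⟩
    · have := hg2 (a - d) (by omega)
      rw [show d + (a - d) = a by omega] at this
      exact Or.inr ⟨h', this⟩
  refine ⟨g, hg, (hg1 0 (Nat.zero_le _)).trans hh0, (hg2 s le_rfl).trans hfs, ?_, ?_, ?_⟩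
  · intro a ha0 ha
    rw [mem_union]
    rcases hcases a ha.le with ⟨h', e⟩ | ⟨h', e⟩ <;> rw [e]
    · rcases h'.lt_or_eq with h' | rfl
      · exact Or.inl (hhX a ha0 h')
      · rw [hhd, ← hf0]
        exact Or.inr (hfR 0 hs)
    · exact Or.inr (hfR _ (by omega))
  · intro a ha b hb he
    rcases hcases a ha with ⟨ha', ea⟩ | ⟨ha', ea⟩ <;> rcases hcases b hb with ⟨hb', eb⟩ | ⟨hb', eb⟩ <;>
      rw [ea, eb] at he
    · exact hhc a ha' b hb' he
    · exact absurd (he ▸ (hfu (b - d) (by omega) (by omega)).1) (hhu a ha').2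
    · exact absurd (he ▸ (hfu (a - d) (by omega) (by omega)).1) (hhu b hb').2
    · have := hfc _ (by omega) _ (by omega) he
      omega
  · intro a ha
    rcases hcases a ha with ⟨ha', ea⟩ | ⟨ha', ea⟩ <;> rw [ea]
    · exact insert_subset_insert _ subset_union_left (hhu a ha').1
    · exact mem_insert_of_mem (mem_union_right _ (hfu _ (by omega) (by omega)).1)

-- Paths of uncontrolled but constant length d from covered sets to a vertex `z` are completed by a
-- tree from `z` whose depth makes up the difference. The tree has at most ℓ levels beyond its root,
-- while more than ℓ covered sets share the same d, so one of them is left for the other end.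
set_option maxHeartbeats 2000000 in
theorem Alt.exists_linked (t ℓ E m : ℕ) (ht : 1 ≤ t) (hℓ : 3 * t + 3 ≤ ℓ) (hm : 1 ≤ m) (η' : ℝ)
    (hη' : 0 < η') : ∃ (K : ℕ) (η q₀ : ℝ), 0 < η ∧ ∀ {V : Type u} (G : SimpleGraph V) (γ q s : ℝ)
    (col : V → ℤ) (Λ : Finset V) (D₀ : ℝ) (ζ : ℤ) (J U : Finset ℤ) (S X : ℤ → Finset V)
    (D : ℤ → ℝ) (Low : Finset V) (C : Finset ℤ), Coh G γ → 1 ≤ γ → q₀ ≤ q → 1 ≤ q →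
    (∀ w X, deg G w X ≤ q ^ E) → γ * q ≤ s → γ ≤ (s / (γ * q)) ^ (t - 1) → K ≤ U.card →
    J.card = (2 * t + 2) * (ℓ + 1) → (∀ b ∈ insert ζ (J ∪ U), s ≤ (S b).card) →
    Alt G q col Λ D₀ ζ J U S X D η → ζ ∈ C → Disjoint C (J ∪ U) →
    (∀ b ∈ J ∪ U, ∀ w ∈ S b, ∀ v ∈ Low, ¬ G.Adj v w) → Walks G col Λ (S ζ) Low C (2 * t) →
    ∃ M ⊆ U, M.card = m ∧ ∃ A : ℤ → Finset V, (∀ b, A b ⊆ S b) ∧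
      (∀ b ∈ M, s ≤ q ^ (5 * m + 2) * (A b).card) ∧ Lk G M A η' ∧ Linked G col (C ∪ (J ∪ U)) M A ℓ := by
  set N := (E + 1) * m * E with hN
  set η₁ : ℝ := min (1 / (16 * ((m : ℝ) + 1) ^ 2 * 8 ^ m)) (η' / 8 ^ m) with hη₁
  have hη₁0 : 0 < η₁ := lt_min (by positivity) (by positivity)
  have hη₁m : 16 * ((m : ℝ) + 1) ^ 2 * (8 ^ m * η₁) ≤ 1 := by
    have : η₁ ≤ 1 / (16 * ((m : ℝ) + 1) ^ 2 * 8 ^ m) := min_le_left _ _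
    rw [le_div_iff₀ (by positivity)] at this
    linarith
  have hη₁' : 8 ^ m * η₁ ≤ η' := by
    have : η₁ ≤ η' / 8 ^ m := min_le_right _ _
    rw [le_div_iff₀ (by positivity)] at this
    linarith
  have hη₁1 : η₁ ≤ 1 := by
    have h8 : (1 : ℝ) ≤ 8 ^ m := one_le_pow₀ (by norm_num)
    have h16 : (1 : ℝ) ≤ 16 * ((m : ℝ) + 1) ^ 2 := by
      have : (0 : ℝ) ≤ m := Nat.cast_nonneg _
      nlinarith
    have : 1 * (1 * η₁) ≤ 16 * ((m : ℝ) + 1) ^ 2 * (8 ^ m * η₁) := by gcongr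
    linarith
  have hpN : 0 < η₁ ^ N := by positivity
  have hpN1 : η₁ ^ N ≤ 1 := pow_le_one₀ hη₁0.le hη₁1
  have hpN' : 0 < η₁ ^ (N + 1) := by positivity
  have hpN'1 : η₁ ^ (N + 1) ≤ 1 := pow_le_one₀ hη₁0.le hη₁1
  have hple : η₁ ^ (N + 1) ≤ η₁ ^ N := by
    rw [pow_succ]
    nlinarith
  set κ : ℝ := 1 / 4 ^ (ℓ + 1) with hκ
  have hκ0 : 0 < κ := by positivity
  have hκ4 : ∀ i ≤ ℓ, κ * 4 ^ (i + 1) ≤ 1 := by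
    intro i hi
    rw [hκ, one_div_mul_eq_div, div_le_one (by positivity)]
    exact pow_le_pow_right₀ (by norm_num) (by omega)
  have hκ1 : 4 * κ ≤ 1 := by
    have := hκ4 0 (Nat.zero_le _)
    rw [zero_add, pow_one] at this
    linarith
  set n : ℝ := 2 * t + 2 with hn
  have ht' : (1 : ℝ) ≤ t := by exact_mod_cast ht
  have hn4 : 4 ≤ n := by linarith
  set η₃ := η₁ ^ (N + 1) / 4 with hη₃
  have hη₃0 : 0 < η₃ := by positivity
  set η₂ := κ * η₃ with hη₂
  have hη₂0 : 0 < η₂ := by positivity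
  have hη₂κ : η₂ ≤ κ := mul_le_of_le_one_right hκ0.le (by linarith)
  set c₀ : ℝ := η₁ ^ (N + 1) * κ / (2 * n) with hc₀
  have hc₀0 : 0 < c₀ := by positivity
  have hc₀n : c₀ * (2 * n) = η₁ ^ (N + 1) * κ := by rw [hc₀]; field_simp
  set K := ℓ + 1 + (E + 1) * m with hK
  refine ⟨K, η₂ / n, max (8 * ((K : ℝ) + 1 + ℓ + 1)) (max (16 * ((m : ℝ) + 1)) (1 / c₀)), by positivity,
    ?_⟩
  intro V G γ q s col Λ D₀ ζ J U₀ S X D Low C hG hγ1 hq₀ hq1 hdeg hγs hγt hKU hJ hs₀ hA₀ hζC hCJU₀ hLow₀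
    hwalk
  obtain ⟨U, hU₀, hUK⟩ := exists_subset_card_eq hKU
  have hA : Alt G q col Λ D₀ ζ J U S X D (η₂ / n) := hA₀.mono (θ := 1) Subset.rfl hU₀
    (fun _ => Subset.rfl) le_rfl (by positivity) (by simp) (fun _ _ => by simp)
  have hJU₀ : J ∪ U ⊆ J ∪ U₀ := union_subset_union Subset.rfl hU₀
  have hs : ∀ b ∈ insert ζ (J ∪ U), s ≤ (S b).card := fun b hb =>
    hs₀ b (insert_subset_insert _ hJU₀ hb)
  have hCJU : Disjoint C (J ∪ U) := hCJU₀.mono_right hJU₀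
  have hLow : ∀ b ∈ J ∪ U, ∀ w ∈ S b, ∀ v ∈ Low, ¬ G.Adj v w := fun b hb => hLow₀ b (hJU₀ hb)
  have hγ : 0 < γ := by linarith
  have hq0 : 0 < q := by linarith
  have hqm : 16 * ((m : ℝ) + 1) ≤ q := (le_max_left _ _).trans ((le_max_right _ _).trans hq₀)
  have hqc : 1 ≤ q * c₀ := by
    have : 1 / c₀ ≤ q := (le_max_right _ _).trans ((le_max_right _ _).trans hq₀)
    rwa [div_le_iff₀ hc₀0] at this
  have hs0 : 0 < s := lt_of_lt_of_le (by positivity) hγs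
  have hγc : γ ≤ c₀ * s := by
    have h1 := mul_le_mul_of_nonneg_left hγs hc₀0.le
    have h2 := mul_le_mul_of_nonneg_left hqc hγ.le
    linarith
  have hsc : s ≤ q * (c₀ * s) := by
    have := mul_le_mul_of_nonneg_right hqc hs0.le
    linarith
  have hcard0 : ∀ Y : Finset V, (0 : ℝ) ≤ Y.card := fun Y => Nat.cast_nonneg _
  have hζU : ζ ∉ U := fun h => hA.zeta (mem_union_right _ h)
  have hζJ : ζ ∉ J := fun h => hA.zeta (mem_union_left _ h)
  have hIU : insert ζ U ⊆ insert ζ (J ∪ U) := insert_subset_insert _ subset_union_right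
  -- expansion
  obtain ⟨S₁, hS₁, hS₁c, hexp⟩ := exists_expanding_of_large hG hγ (I := insert ζ U) (e := ℓ) (S := S)
    (by
      rw [card_insert_of_notMem hζU, hUK]
      push_cast
      exact (le_max_left _ _).trans hq₀) hγs (fun i hi j hj hij => by
      rw [disjoint_left]
      intro v hv hv'
      exact hij ((hA.col i (hIU hi) v hv).symm.trans (hA.col j (hIU hj) v hv')))
    (fun b hb => hs b (hIU hb))
  have hζI : ζ ∈ insert ζ U := mem_insert_self _ _
  obtain ⟨z, hz⟩ : (S₁ ζ).Nonempty := by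
    have h1 := hS₁c ζ hζI
    have h2 := hs ζ (hIU hζI)
    have : (0 : ℝ) < (S₁ ζ).card := by linarith
    exact card_pos.1 (by exact_mod_cast this)
  have hzS : z ∈ S ζ := hS₁ ζ hz
  have hzc : col z = ζ := hA.col ζ (hIU hζI) z hzS
  -- paths of constant length
  set p : ℤ → ℕ → V → Prop := fun b d x => ∃ f : ℕ → V, IsIndPath G f d ∧ f 0 = x ∧ f d = z ∧
      (∀ a, 0 < a → a < d → f a ∈ X b ∪ Low) ∧
      (∀ a ≤ d, ∀ b ≤ d, col (f a) = col (f b) → a = b) ∧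
      ∀ a, 0 < a → a ≤ d → col (f a) ∈ C with hp
  have hdist : ∀ b ∈ J, ∃ d < 2 * t + 2,
      (S b).card ≤ (2 * t + 2) * ((S b).filter (p b d)).card := by
    intro b hb
    refine exists_card_filter_ge (by omega) fun x hx => ?_
    obtain ⟨hXΛ, hcov, -⟩ := hA.cov b hb
    obtain ⟨y, hy, hyx⟩ := hcov x hx
    refine hwalk.exists_indPath hXΛ hy hyx ?_ hzS
    rw [hA.col b (mem_insert_of_mem (mem_union_left _ hb)) x hx]
    exact disjoint_right.1 hCJU (mem_union_left _ hb)
  -- A second pigeonhole, over the sets instead of their vertices: (2t+2)(ℓ+1) sets and 2t+2 lengths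
  -- leave ℓ+1 sets with a common length.
  obtain ⟨d, hd, hJd⟩ := exists_card_filter_ge (T := J) (n := 2 * t + 2) (p := fun d b =>
    (S b).card ≤ (2 * t + 2) * ((S b).filter (p b d)).card) (by omega) hdist
  set J₁ := J.filter fun b => (S b).card ≤ (2 * t + 2) * ((S b).filter (p b d)).card with hJ₁
  have hJ₁c : ℓ + 1 ≤ J₁.card := by
    rw [hJ] at hJd
    refine (Nat.mul_le_mul_left_iff (by omega : 0 < 2 * t + 2)).1 (hJd.trans (le_of_eq ?_))
    congr! 3
  have hJ₁J : J₁ ⊆ J := filter_subset _ _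
  -- Only sets indexed by `J` are cut down to the vertices at the chosen length; those of `insert ζ
  -- U` keep the expansion just arranged.
  set S₂ : ℤ → Finset V := fun b => if b ∈ J then (S b).filter (p b d) else S₁ b with hS₂
  have hS₂J : ∀ b ∈ J, S₂ b = (S b).filter (p b d) := fun b hb => if_pos hb
  have hS₂N : ∀ b, b ∉ J → S₂ b = S₁ b := fun b hb => if_neg hb
  have hUJ : ∀ b ∈ U, b ∉ J := fun b hb => disjoint_right.1 hA.disj hb
  have hS₂S : ∀ b, S₂ b ⊆ S b := by
    intro b
    by_cases hb : b ∈ J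
    · rw [hS₂J b hb]; exact filter_subset _ _
    · rw [hS₂N b hb]; exact hS₁ b
  have hJ₁U : J₁ ∪ U ⊆ J ∪ U := union_subset_union hJ₁J Subset.rfl
  have hS₂c : ∀ b ∈ insert ζ (J₁ ∪ U), ((S b).card : ℝ) ≤ n * (S₂ b).card := by
    have h1 : ∀ b ∈ insert ζ U, ((S b).card : ℝ) ≤ n * (S₁ b).card := by
      intro b hb
      have h1 := hS₁c b hb
      have h2 := mul_le_mul_of_nonneg_right hn4 (hcard0 (S₁ b))
      have := hcard0 (S₁ b)
      linarith
    intro b hb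
    simp only [mem_insert, mem_union] at hb
    rcases hb with rfl | hb | hb
    · rw [hS₂N b hζJ]; exact h1 b hζI
    · rw [hS₂J b (hJ₁J hb), hn]
      exact_mod_cast (mem_filter.1 hb).2
    · rw [hS₂N b (hUJ b hb)]; exact h1 b (mem_insert_of_mem hb)
  have hn0 : 0 < n := by linarith
  have hA₂ : Alt G q col Λ D₀ ζ J₁ U S₂ X D η₂ := hA.mono (θ := 1 / n) hJ₁J Subset.rfl hS₂S
    (by rw [div_le_one hn0]; linarith) hη₂0.le (by rw [mul_one_div]) fun b hb => by
      rw [one_div_mul_eq_div, div_le_iff₀ hn0]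
      linarith [hS₂c b hb]
  have hIJ : ∀ b ∈ J₁ ∪ U, b ∈ insert ζ (J₁ ∪ U) := fun b hb => mem_insert_of_mem hb
  have hIJ' : ∀ b ∈ insert ζ (J₁ ∪ U), b ∈ insert ζ (J ∪ U) := fun b hb =>
    insert_subset_insert _ hJ₁U hb
  have hs₂ : ∀ b ∈ insert ζ (J₁ ∪ U), s ≤ n * (S₂ b).card := fun b hb =>
    (hs b (hIJ' b hb)).trans (hS₂c b hb)
  have hκs : ∀ b ∈ insert ζ (J₁ ∪ U), 2 * (c₀ * s) ≤ η₁ ^ (N + 1) * (κ * (S₂ b).card) := by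
    intro b hb
    have h1 := mul_le_mul_of_nonneg_left (hs₂ b hb) (by positivity : 0 ≤ 2 * c₀)
    have h2 : 2 * c₀ * (n * (S₂ b).card) = η₁ ^ (N + 1) * (κ * (S₂ b).card) := by
      linear_combination ((S₂ b).card : ℝ) * hc₀n
    linarith
  have hzS₂ : z ∈ S₂ ζ := by rw [hS₂N ζ hζJ]; exact hz
  -- the tree
  obtain ⟨i, hi⟩ : ∃ i, ℓ = d + i + 2 := ⟨ℓ - 2 - d, by omega⟩
  -- Two of the ℓ edges are reserved for the final steps into the blocks, and d ≤ 2t+1; so ℓ ≥ 3t+3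
  -- is exactly what this requires.
  have hti : t ≤ i := by omega
  have hg1 : 1 ≤ s / (γ * q) := by
    rw [le_div_iff₀ (by positivity)]
    linarith
  have hiℓ : (i : ℝ) ≤ ℓ := by
    have : i ≤ ℓ := by omega
    exact_mod_cast this
  obtain ⟨used, LowT, Top, hst, hT⟩ := exists_tree (g := s / (γ * q)) hG hγ (col := col) (z := z)
    (I := U) (J := J₁) (S := S₂) (s := i) (t := t) (κ := κ)
    (fun b hb => hA₂.col b (by rw [union_comm] at hb; exact hIJ b hb))
    (by rw [hzc, union_comm]; exact hA₂.zeta) ht hκ0 (hκ4 i (by omega))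
    (fun a ha b hb hab v hv => by
      rw [union_comm] at ha hb
      exact (hA₂.lk a (hIJ a ha) b (hIJ b hb) hab v hv).trans
        (mul_le_mul_of_nonneg_right hη₂κ (hcard0 _)))
    (fun b hb => by
      rw [union_comm] at hb
      exact (hA₂.lk ζ (mem_insert_self _ _) b (hIJ b hb) (ne_of_mem_of_not_mem hb hA₂.zeta).symm z
        hzS₂).trans (mul_le_mul_of_nonneg_right hη₂κ (hcard0 _)))
    (fun a ha b hb hab Y hY hYγ => by
      rw [hS₂N a (hUJ a ha)] at hY
      rw [hS₂N b (hUJ b hb)]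
      refine le_trans (mul_le_mul_of_nonneg_right ?_ (hcard0 _))
        (hexp a (mem_insert_of_mem ha) b (mem_insert_of_mem hb) hab Y hY hYγ)
      linarith)
    (fun b hb => by
      have h1 := hexp ζ hζI b (mem_insert_of_mem hb) (ne_of_mem_of_not_mem hb hζU).symm {z}
          (singleton_subset_iff.2 hz) (by simpa using hγ1)
      rw [card_nbrs_singleton, card_singleton, Nat.cast_one, mul_one] at h1
      rw [hS₂N b (hUJ b hb)]
      linarith) hg1 hγt
    (fun b hb => by
      rw [union_comm] at hb
      have h1 := hκs b (hIJ b hb)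
      have h2 := mul_le_mul_of_nonneg_right hpN'1 (mul_nonneg hκ0.le (hcard0 (S₂ b)))
      have h3 : 0 < c₀ * s := by positivity
      linarith) (by omega) i le_rfl
  -- At depth `t` or more the small phase of the tree is over.
  obtain ⟨b₀, hb₀, hTS, hTc⟩ := hT.resolve_right fun h => absurd h.1 (by omega)
  rw [union_comm] at hst
  have hused : used ⊆ J₁ ∪ U := hst.used_subset
  obtain ⟨r, hr, hru⟩ : ∃ r ∈ J₁, r ∉ used := by
    by_contra hcon
    push Not at hcon
    have := card_le_card (fun r hr => hcon r hr : J₁ ⊆ used)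
    rw [hst.card_used] at this
    omega
  have hrb₀ : r ≠ b₀ := fun e => hru (e ▸ hb₀)
  -- Unused sets lose the neighbours of the tree's lower levels. Used sets other than `b₀` stay as
  -- they are, so that the invariant `Alt` transfers with the single factor `κ`.
  set S₃ : ℤ → Finset V := fun b => if b = b₀ then Top else
    if b ∈ (J₁ ∪ U) \ used then S₂ b \ nbrs G LowT (S₂ b) else S₂ b with hS₃
  have hS₃b₀ : S₃ b₀ = Top := if_pos rfl
  have hS₃d : ∀ b ∈ J₁ ∪ U, b ∉ used → S₃ b = S₂ b \ nbrs G LowT (S₂ b) := by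
    intro b hb hbu
    exact (if_neg (ne_of_mem_of_not_mem hb₀ hbu).symm).trans (if_pos (mem_sdiff.2 ⟨hb, hbu⟩))
  have hS₃o : ∀ b, b ≠ b₀ → b ∉ (J₁ ∪ U) \ used → S₃ b = S₂ b := fun b h1 h2 =>
    (if_neg h1).trans (if_neg h2)
  have hS₃S₂ : ∀ b, S₃ b ⊆ S₂ b := by
    intro b
    by_cases h1 : b = b₀
    · rw [h1, hS₃b₀]; exact hTS
    · by_cases h2 : b ∈ (J₁ ∪ U) \ used
      · rw [hS₃d b (mem_sdiff.1 h2).1 (mem_sdiff.1 h2).2]; exact sdiff_subset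
      · rw [hS₃o b h1 h2]
  have hS₃S : ∀ b, S₃ b ⊆ S b := fun b => (hS₃S₂ b).trans (hS₂S b)
  have hS₃c : ∀ b ∈ insert ζ (J₁ ∪ U), κ * (S₂ b).card ≤ (S₃ b).card := by
    intro b hb
    by_cases h1 : b = b₀
    · rw [h1, hS₃b₀]; exact hTc
    · by_cases h2 : b ∈ (J₁ ∪ U) \ used
      · obtain ⟨h3, h4⟩ := mem_sdiff.1 h2
        have h5 := hst.cover b h3 h4
        have h6 : κ * 4 ^ i ≤ 1 / 4 := by
          have := hκ4 i (by omega)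
          rw [pow_succ] at this
          linarith
        have h7 := card_sdiff_nbrs_ge h5
        have h8 := mul_le_mul_of_nonneg_right h6 (hcard0 (S₂ b))
        have h9 := mul_le_mul_of_nonneg_right hκ1 (hcard0 (S₂ b))
        rw [hS₃d b h3 h4]
        linarith
      · rw [hS₃o b h1 h2]
        have h9 := mul_le_mul_of_nonneg_right hκ1 (hcard0 (S₂ b))
        have := mul_nonneg hκ0.le (hcard0 (S₂ b))
        linarith
  have hA₃ : Alt G q col Λ D₀ ζ J₁ U S₃ X D η₃ := hA₂.mono (θ := κ) Subset.rfl Subset.rfl hS₃S₂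
    (by linarith) hη₃0.le (by rw [hη₂, mul_comm]) hS₃c
  have hs₃ : ∀ b ∈ insert ζ (J₁ ∪ U), γ ≤ η₁ ^ (N + 1) / 2 * (S₃ b).card := by
    intro b hb
    have h1 := hκs b hb
    have h2 := mul_le_mul_of_nonneg_left (hS₃c b hb) hpN'.le
    linarith
  have hb₀JU : b₀ ∈ J₁ ∪ U := hused hb₀
  have hrJU : r ∈ J₁ ∪ U := mem_union_left _ hr
  set U₃ := U \ used with hU₃
  have hU₃U : U₃ ⊆ U := sdiff_subset
  have hU₃c : (E + 1) * m ≤ U₃.card := by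
    have h1 : U.card ≤ U₃.card + used.card := by
      rw [hU₃]
      have := le_card_sdiff used U
      omega
    rw [hst.card_used] at h1
    omega
  have hU₃JU : ∀ b ∈ U₃, b ∈ J₁ ∪ U := fun b hb => mem_union_right _ (hU₃U hb)
  have hcol₃ : ∀ b ∈ J₁ ∪ U, ∀ v ∈ S₃ b, col v = b := fun b hb => hA₃.col b (hIJ b hb)
  have hrC : Disjoint C used := hCJU.mono_right (hused.trans hJ₁U)
  have hanti : ∀ b ∈ J₁ ∪ U, b ≠ r → ∀ w ∈ S₂ b, ∀ x ∈ X r ∪ Low, ¬ G.Adj x w := by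
    intro b hb hbr w hw x hx
    rcases mem_union.1 hx with hx | hx
    · exact (hA₂.cov r hr).2.2 b hb hbr w hw x hx
    · exact hLow b (hJ₁U hb) w (hS₂S b hw) x hx
  have hcon : Connector G col (S₃ r) (S₃ b₀) (X r ∪ Low ∪ LowT) (insert r (C ∪ used)) (d + i) := by
    rw [hS₃b₀]
    refine connector_of_paths (by omega) (z := z) ?_ (hcol₃ r hrJU) hru hrC hst.path ?_ ?_ ?_
    · intro x hx
      have hx2 := hS₃S₂ r hx
      rw [hS₂J r (hJ₁J hr)] at hx2
      exact (mem_filter.1 hx2).2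
    · intro v hv
      rcases hst.low v hv with h1 | ⟨b, hb, hvb⟩
      · exact Or.inl h1
      · refine Or.inr ⟨?_, hanti b (hused hb) (ne_of_mem_of_not_mem hb hru) v hvb⟩
        rw [hA₂.col b (hIJ b (hused hb)) v hvb]
        exact hb
    · intro y hy
      refine ⟨?_, hanti b₀ hb₀JU hrb₀.symm y (hTS hy)⟩
      rw [hA₂.col b₀ (hIJ b₀ hb₀JU) y (hTS hy)]
      exact hb₀
    · intro x hx v hv
      rw [hS₃d r hrJU hru] at hx
      exact not_adj_of_mem_sdiff_nbrs hx hv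
  have hCU₃ : Disjoint (insert r (C ∪ used)) U₃ := by
    rw [disjoint_right]
    intro b hb hb'
    obtain ⟨h1, h2⟩ := mem_sdiff.1 hb
    simp only [mem_insert, mem_union] at hb'
    rcases hb' with rfl | h3 | h3
    · exact hUJ b h1 (hJ₁J hr)
    · exact disjoint_left.1 hCJU h3 (mem_union_right _ h1)
    · exact h2 h3
  have hR₃ : ∀ b ∈ U₃, ∀ w ∈ S₃ b, ∀ x ∈ X r ∪ Low ∪ LowT, ¬ G.Adj x w := by
    intro b hb w hw x hx
    obtain ⟨h1, h2⟩ := mem_sdiff.1 hb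
    rcases mem_union.1 hx with hx | hx
    · refine hanti b (hU₃JU b hb) ?_ w (hS₃S₂ b hw) x hx
      rintro rfl
      exact hUJ b h1 (hJ₁J hr)
    · rw [hS₃d b (hU₃JU b hb) h2] at hw
      exact not_adj_of_mem_sdiff_nbrs hw hx
  have hη₃1 : 4 * η₃ ≤ η₁ ^ (N + 1) := by rw [hη₃]; linarith
  have hqη : 2 ≤ q * η₁ ^ N := by
    have h1 : c₀ * 8 ≤ c₀ * (2 * n) := mul_le_mul_of_nonneg_left (by linarith) hc₀0.le
    have h2 : η₁ ^ (N + 1) * κ ≤ η₁ ^ N * 1 := by gcongr; linarith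
    have h3 := mul_le_mul_of_nonneg_left (h1.trans (hc₀n.le.trans h2)) hq0.le
    linarith
  have hfin : ∀ a ∈ J₁, ∀ c ∈ J₁ ∪ U, c ∉ U₃ → a ≠ c →
      (∀ w ∈ S₃ c, deg G w (S₃ a) ≤ D a) →
      Connector G col (S₃ a) (S₃ c) (X r ∪ Low ∪ LowT) (insert r (C ∪ used)) (d + i) →
      ∃ M ⊆ U₃, M.card = m ∧ ∃ A : ℤ → Finset V, (∀ b, A b ⊆ S₃ b) ∧
      (∀ b ∈ M, ((S₃ b).card : ℝ) ≤ q ^ (5 * m + 1) * (A b).card) ∧ Lk G M A η' ∧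
      Linked G col (insert r (C ∪ used)) M A (d + i + 2) := by
    intro a ha c hc hcU hac hD hcon'
    have haJU : a ∈ J₁ ∪ U := mem_union_left _ ha
    have hcne : ∀ b ∈ U₃, c ≠ b := fun b hb => (ne_of_mem_of_not_mem hb hcU).symm
    have hane : ∀ b ∈ U₃, b ≠ a := by
      rintro b hb rfl
      exact hUJ b (hU₃U hb) (hJ₁J ha)
    exact hcon'.exists_linked hG hγ hN hm hη₁0 hη₃0 hη₃1 hη₁m hη₁' hqm hqη hU₃c
      (fun b hb => hcol₃ b (hU₃JU b hb)) (by omega) hCU₃ hR₃ (hA₃.pos a ha)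
      (fun b hb b' hb' => hA₃.lk b (hIJ b (hU₃JU b hb)) b' (hIJ b' (hU₃JU b' hb')))
      (fun b hb w hw => ⟨(hA₃.pool a ha b (hU₃U hb)).1 w hw,
        hA₃.lk b (hIJ b (hU₃JU b hb)) a (hIJ a haJU) (hane b hb) w hw⟩)
      (fun w hw => ⟨hD w hw, hA₃.lk c (hIJ c hc) a (hIJ a haJU) hac.symm w hw⟩)
      (fun b hb => (hA₃.pool a ha b (hU₃U hb)).2)
      (fun b hb => by
        rw [disjoint_left]
        intro v hv hv'
        exact hcne b hb ((hcol₃ c hc v hv).symm.trans (hcol₃ b (hU₃JU b hb) v hv')))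
      (fun b hb => hA₃.lk c (hIJ c hc) b (hIJ b (hU₃JU b hb)) (hcne b hb))
      (fun w => hdeg w _) (hs₃ c (hIJ c hc)) (fun b hb => hs₃ b (hIJ b (hU₃JU b hb)))
  have hb₀U₃ : b₀ ∉ U₃ := fun h => (mem_sdiff.1 h).2 hb₀
  have hrU₃ : r ∉ U₃ := fun h => hUJ r (hU₃U h) (hJ₁J hr)
  have hexists : ∃ M ⊆ U₃, M.card = m ∧ ∃ A : ℤ → Finset V, (∀ b, A b ⊆ S₃ b) ∧
      (∀ b ∈ M, ((S₃ b).card : ℝ) ≤ q ^ (5 * m + 1) * (A b).card) ∧ Lk G M A η' ∧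
      Linked G col (insert r (C ∪ used)) M A (d + i + 2) := by
    -- The end playing `P` must be one into which the other end has degree at most its `D`. If both
    -- ends are covered sets, `Alt.pair` decides which; if `b₀` is in `U`, `r` always qualifies.
    rcases mem_union.1 hb₀JU with h | h
    · rcases hA₃.pair r hr b₀ h hrb₀ with h1 | h1
      · exact hfin r hr b₀ hb₀JU hb₀U₃ hrb₀ h1 hcon
      · exact hfin b₀ h r hrJU hrU₃ hrb₀.symm h1 hcon.symm
    · exact hfin r hr b₀ hb₀JU hb₀U₃ hrb₀ (hA₃.pool r hr b₀ h).1 hcon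
  obtain ⟨M, hM, hMm, A, hAS, hAc, hAlk, hAL⟩ := hexists
  refine ⟨M, hM.trans (hU₃U.trans hU₀), hMm, A, fun b => (hAS b).trans (hS₃S b), ?_, hAlk, ?_⟩
  swap
  · rw [hi]
    refine hAL.mono (insert_subset ?_ (union_subset_union Subset.rfl ?_))
    · exact mem_union_right _ (mem_union_left _ (hJ₁J hr))
    · exact hused.trans (hJ₁U.trans hJU₀)
  intro b hb
  have hbI := hIJ b (hU₃JU b (hM hb))
  have h1 := hκs b hbI
  have h2 := mul_le_mul_of_nonneg_right hpN'1 (mul_nonneg hκ0.le (hcard0 (S₂ b)))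
  have h3 := (hS₃c b hbI).trans (hAc b hb)
  have h4 : 0 < c₀ * s := by positivity
  have h5 : q * (c₀ * s) ≤ q * (q ^ (5 * m + 1) * (A b).card) :=
    mul_le_mul_of_nonneg_left (by linarith) hq0.le
  calc s ≤ q * (q ^ (5 * m + 1) * (A b).card) := hsc.trans h5
    _ = _ := by ring

end Link

/-! ### Linked blocks in a coherent graph. -/

section Blocks

/-- The composition of the three stages, losing q, then q^(3R), then q^(5m+2). The exponent `p` is
fixed before `E` and `η'`: later ε is chosen from `p`, and `E` from ε. -/
theorem exists_linked_blocks (t ℓ m : ℕ) (ht : 1 ≤ t) (hℓ : 3 * t + 3 ≤ ℓ) (hm : 1 ≤ m) :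
    ∃ p : ℕ, ∀ (E : ℕ) (η' : ℝ), 0 < η' → ∃ (K : ℕ) (η q₀ : ℝ), 0 < η ∧
    ∀ {V : Type u} (G : SimpleGraph V) (γ q s : ℝ) (col : V → ℤ) (I : Finset ℤ) (S : ℤ → Finset V),
    Coh G γ → 1 ≤ γ → q₀ ≤ q → 1 ≤ q → (∀ w X, deg G w X ≤ q ^ E) → γ * q ^ p ≤ s →
    γ ≤ (s / (γ * q ^ p)) ^ (t - 1) → K ≤ I.card → (∀ b ∈ I, s ≤ (S b).card) →
    (∀ b ∈ I, ∀ v ∈ S b, col v = b) → Lk G I S η →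
    ∃ M ⊆ I, M.card = m ∧ ∃ A : ℤ → Finset V, (∀ b, A b ⊆ S b) ∧
      (∀ b ∈ M, s ≤ q ^ p * (A b).card) ∧ Lk G M A η' ∧ Linked G col I M A ℓ := by
  set R := (2 * t + 2) * (ℓ + 1) with hR
  refine ⟨3 * R + 5 * m + 3, fun E η' hη' => ?_⟩
  obtain ⟨K₃, η₃, q₃, hη₃, h₃⟩ := Alt.exists_linked.{u} t ℓ E m ht hℓ hm η' hη'
  obtain ⟨K₂, η₂, q₂, hη₂, h₂⟩ := Alt.exists_of_large.{u} E R K₃ η₃ hη₃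
  obtain ⟨K₁, η₁, q₁, hη₁, h₁⟩ := exists_alt.{u} t E K₂ ht (min η₂ 1) (lt_min hη₂ one_pos)
    (min_le_right _ _)
  refine ⟨K₁, η₁, max q₁ (max q₂ q₃), hη₁, ?_⟩
  intro V G γ q s col I S hG hγ1 hq hq1 hdeg hγs hγt hK hs hcol hlk
  have hq0 : 0 < q := by linarith
  have hγ : 0 < γ := by linarith
  have hpow : ∀ i j : ℕ, i ≤ j → q ^ i ≤ q ^ j := fun i j hij => pow_le_pow_right₀ hq1 hij
  set p := 3 * R + 5 * m + 3 with hp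
  have hs0 : 0 < s := lt_of_lt_of_le (by positivity) hγs
  have hmono : ∀ i ≤ p, ∀ x, x = s / (γ * q ^ i) → γ ≤ x ^ (t - 1) := by
    rintro i hi x rfl
    refine hγt.trans (pow_le_pow_left₀ (by positivity) ?_ _)
    have := hpow i p hi
    gcongr
  obtain ⟨Λ, Low, C, ζ, U, S₁, X, D, D₀, hζC, hCI, hCU, hUI, hUK, hS₁, hs₁, hD₀, hA, hLow, hwalk⟩ :=
    h₁ G γ q s col I S hG hγ1 ((le_max_left _ _).trans hq) hq1 hdeg
    (by
      refine le_trans ?_ hγs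
      have := hpow 1 p (by omega)
      rw [pow_one] at this
      gcongr)
    (hmono 1 (by omega) _ (by rw [pow_one])) hK hs hcol hlk
  have hA' : Alt G q col Λ D₀ ζ ∅ U S₁ X D η₂ := hA.mono (θ := 1) Subset.rfl Subset.rfl
    (fun _ => Subset.rfl) le_rfl hη₂.le (by rw [mul_one]; exact min_le_left _ _) (fun _ _ => by simp)
  obtain ⟨J, U', S₂, X', D', hJR, hU'K, hJU, hS₂, hs₂, hA₂⟩ := h₂ G γ q (s / q) D₀ col Λ ζ U S₁ X D hG hγ
    ((le_max_left _ _).trans ((le_max_right _ _).trans hq)) hq1 hdeg hD₀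
    (by
      rw [le_div_iff₀ hq0]
      refine le_trans ?_ hγs
      have := hpow (3 * R + 1) p (by omega)
      rw [pow_succ] at this
      rw [mul_assoc]
      gcongr) hUK (fun b hb => by
      rw [div_le_iff₀ hq0]
      linarith [hs₁ b hb]) hA'
  obtain ⟨M, hM, hMm, A, hAS, hAc, hAlk, hAL⟩ := h₃ G γ q (s / q ^ (3 * R + 1)) col Λ D₀ ζ J U' S₂ X'
    D' Low C hG hγ1 ((le_max_right _ _).trans ((le_max_right _ _).trans hq)) hq1 hdeg
    (by
      rw [le_div_iff₀ (by positivity)]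
      refine le_trans ?_ hγs
      have := hpow (3 * R + 2) p (by omega)
      calc γ * q * q ^ (3 * R + 1) = γ * q ^ (3 * R + 2) := by ring
        _ ≤ _ := by gcongr)
    (hmono (3 * R + 2) (by omega) _ (by
      rw [div_div]
      congr 1
      ring)) hU'K hJR (fun b hb => by
      have := hs₂ b hb
      rw [div_le_iff₀ hq0] at this
      rw [div_le_iff₀ (by positivity), pow_succ]
      linarith) hA₂ hζC (hCU.mono_right hJU)
    (fun b hb w hw v hv => hLow b (hJU hb) w (hS₂ b hw) v hv)
    (fun x hx z hz => hwalk x hx z (hS₂ ζ hz))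
  have hU'I : J ∪ U' ⊆ I := hJU.trans hUI
  refine ⟨M, hM.trans (subset_union_right.trans hU'I), hMm, A,
    fun b => (hAS b).trans ((hS₂ b).trans (hS₁ b)), ?_, hAlk, hAL.mono (union_subset hCI hU'I)⟩
  intro b hb
  have := hAc b hb
  rw [div_le_iff₀ (by positivity)] at this
  calc s ≤ q ^ (5 * m + 2) * (A b).card * q ^ (3 * R + 1) := this
    _ = q ^ p * (A b).card := by rw [hp]; ring

end Blocks

/-! ### Blockades, rainbow copies and the induction. -/

section Blockades

variable {V : Type u} {G : SimpleGraph V}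

theorem Blockade.lk_of_linkage_le {B : Blockade V} {lam : ℝ} (h : (B.linkage G : ℝ) ≤ lam) :
    Lk G B.index B.block lam := by
  intro i hi j hj hij v hv
  have hpos : (0 : ℝ) < (B.block j).card := by exact_mod_cast (B.block_nonempty j hj).card_pos
  have h1 : (Blockade.maxDegree G (B.block i) (B.block j) : NNReal) / ((B.block j).card : NNReal) ≤
      B.linkage G :=
    le_sup (f := fun p : ℤ × ℤ => (Blockade.maxDegree G (B.block p.1) (B.block p.2) : NNReal) /
      ((B.block p.2).card : NNReal)) (b := (i, j)) (mem_offDiag.2 ⟨hi, hj, hij⟩)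
  have h2 : (Blockade.maxDegree G (B.block i) (B.block j) : ℝ) / ((B.block j).card : ℝ) ≤
      (B.linkage G : ℝ) := by exact_mod_cast h1
  rw [div_le_iff₀ hpos] at h2
  have h3 : ((B.block j).filter fun w => G.Adj v w).card ≤
      Blockade.maxDegree G (B.block i) (B.block j) :=
    le_sup (f := fun v => ((B.block j).filter fun w => G.Adj v w).card) hv
  have h4 : deg G v (B.block j) ≤ (Blockade.maxDegree G (B.block i) (B.block j) : ℝ) := by
    unfold deg
    exact_mod_cast h3
  have h5 := mul_le_mul_of_nonneg_right h hpos.le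
  linarith

theorem Blockade.linkage_le {B : Blockade V} {lam : ℝ} (hlam : 0 ≤ lam)
    (h : Lk G B.index B.block lam) : (B.linkage G : ℝ) ≤ lam := by
  lift lam to NNReal using hlam
  rw [NNReal.coe_le_coe]
  refine Finset.sup_le fun p hp => ?_
  obtain ⟨hi, hj, hij⟩ := mem_offDiag.1 hp
  have hpos : (0 : ℝ) < (B.block p.2).card := by exact_mod_cast (B.block_nonempty _ hj).card_pos
  rw [← NNReal.coe_le_coe]
  push_cast
  rw [div_le_iff₀ hpos]
  obtain ⟨v, hv, hmax⟩ := exists_mem_eq_sup (B.block p.1) (B.block_nonempty _ hi)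
    fun v => ((B.block p.2).filter fun w => G.Adj v w).card
  have := h _ hi _ hj hij v hv
  unfold deg at this
  unfold Blockade.maxDegree
  rw [hmax]
  exact this

theorem Blockade.rpow_le_card [Fintype V] {B : Blockade V} {σ : ℝ} (hV : 1 < Fintype.card V)
    (h : B.shrinkage ≤ σ) {i : ℤ} (hi : i ∈ B.index) :
    (Fintype.card V : ℝ) ^ (1 - σ) ≤ (B.block i).card := by
  have hV' : (1 : ℝ) < Fintype.card V := by exact_mod_cast hV
  have hw : 0 < B.width := B.width_pos (card_pos.2 ⟨i, hi⟩)
  have hw' : (0 : ℝ) < B.width := by exact_mod_cast hw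
  have h1 : B.width ≤ (B.block i).card := Nat.sInf_le ⟨i, hi, rfl⟩
  have h2 : 1 - σ ≤ Real.logb (Fintype.card V : ℝ) (B.width : ℝ) := by
    unfold Blockade.shrinkage at h
    linarith
  rw [Real.le_logb_iff_rpow_le hV' hw'] at h2
  have h1' : (B.width : ℝ) ≤ (B.block i).card := by exact_mod_cast h1
  linarith

theorem Blockade.shrinkage_le [Fintype V] {B : Blockade V} {σ : ℝ} (hV : 1 < Fintype.card V)
    (hB : 0 < B.length) (h : ∀ i ∈ B.index, (Fintype.card V : ℝ) ^ (1 - σ) ≤ (B.block i).card) :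
    B.shrinkage ≤ σ := by
  have hV' : (1 : ℝ) < Fintype.card V := by exact_mod_cast hV
  have hw' : (0 : ℝ) < B.width := by exact_mod_cast B.width_pos hB
  have hne : ((fun i => (B.block i).card) '' (B.index : Set ℤ)).Nonempty :=
    Set.Nonempty.image _ (Finset.coe_nonempty.mpr (Finset.card_pos.mp hB))
  obtain ⟨i, hi, hwi⟩ := Nat.sInf_mem hne
  have h1 : (Fintype.card V : ℝ) ^ (1 - σ) ≤ B.width := by
    have h2 := h i hi
    unfold Blockade.width
    rw [← hwi]
    exact h2
  rw [← Real.le_logb_iff_rpow_le hV' hw'] at h1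
  unfold Blockade.shrinkage
  linarith

theorem Blockade.exists_not_adj {B : Blockade V} (hB : B.length = 2)
    (h : (B.linkage G : ℝ) ≤ 1 / 2) : ∃ i ∈ B.index, ∃ j ∈ B.index, i ≠ j ∧ ∃ v ∈ B.block i,
      ∃ w ∈ B.block j, ¬ G.Adj v w := by
  obtain ⟨i, hi, j, hj, hij⟩ := one_lt_card.1 (by rw [← Blockade.length, hB]; omega : 1 < B.index.card)
  obtain ⟨v, hv⟩ := B.block_nonempty i hi
  refine ⟨i, hi, j, hj, hij, v, hv, ?_⟩
  by_contra hcon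
  push Not at hcon
  have h1 := Blockade.lk_of_linkage_le h i hi j hj hij v hv
  have h2 : deg G v (B.block j) = (B.block j).card := by
    unfold deg
    rw [filter_true_of_mem hcon]
  have hpos : (0 : ℝ) < (B.block j).card := by exact_mod_cast (B.block_nonempty j hj).card_pos
  linarith

theorem Blockade.disjoint_of_ne {B : Blockade V} {i j : ℤ} (hi : i ∈ B.index) (hj : j ∈ B.index)
    {v w : V} (hv : v ∈ B.block i) (hw : w ∈ B.block j) (hij : i ≠ j) : v ≠ w := by
  rintro rfl
  exact disjoint_left.1 (B.block_disjoint i hi j hj hij) hv hw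

theorem Blockade.eq_of_mem {B : Blockade V} {i j : ℤ} (hi : i ∈ B.index) (hj : j ∈ B.index)
    {v : V} (hv : v ∈ B.block i) (hw : v ∈ B.block j) : i = j := by
  by_contra hij
  exact Blockade.disjoint_of_ne hi hj hv hw hij rfl

/-- The index of the block containing a vertex. -/
theorem Blockade.exists_col (B : Blockade V) :
    ∃ col : V → ℤ, ∀ b ∈ B.index, ∀ v, v ∈ B.block b ↔ col v = b := by
  -- A default colour outside the index set, for the vertices that lie in no block.
  obtain ⟨z, hz⟩ := Infinite.exists_notMem_finset B.index
  refine ⟨fun v => if h : ∃ b ∈ B.index, v ∈ B.block b then h.choose else z, ?_⟩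
  intro b hb v
  by_cases h : ∃ b ∈ B.index, v ∈ B.block b
  · simp only [h, dif_pos]
    obtain ⟨h1, h2⟩ := h.choose_spec
    constructor
    · exact fun hv => Blockade.eq_of_mem h1 hb h2 hv
    · intro e
      rw [e] at h2
      exact h2
  · simp only [h, dif_neg, not_false_iff]
    constructor
    · exact fun hv => absurd ⟨b, hb, hv⟩ h
    · exact fun e => absurd hb (e ▸ hz)

theorem hasRainbowCopy_of_two {W : Type v} {H : SimpleGraph W} (hcard : Nat.card W = 2)
    (hedge : ∀ x y : W, ¬ H.Adj x y) {B : Blockade V} (hB : B.length = 2)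
    (h : (B.linkage G : ℝ) ≤ 1 / 2) : B.HasRainbowCopy G H := by
  obtain ⟨i, hi, j, hj, hij, v, hv, w, hw, hvw⟩ := B.exists_not_adj hB h
  have hne : v ≠ w := Blockade.disjoint_of_ne hi hj hv hw hij
  refine ⟨{v, w}, ⟨?_, ?_⟩, ?_⟩
  · rintro x (rfl | rfl)
    · exact ⟨i, hi, hv⟩
    · exact ⟨j, hj, hw⟩
  · rintro k hk x (rfl | rfl) y (rfl | rfl) hx hy
    · rfl
    · exact absurd ((Blockade.eq_of_mem hi hk hv hx).trans (Blockade.eq_of_mem hk hj hy hw)) hij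
    · exact absurd ((Blockade.eq_of_mem hi hk hv hy).trans (Blockade.eq_of_mem hk hj hx hw)) hij
    · rfl
  · have hc : Nat.card ({v, w} : Set V) = 2 := by
      rw [Nat.card_coe_set_eq, Set.ncard_pair hne]
    have hW : Finite W := Nat.finite_of_card_ne_zero (by omega)
    have hJ : Finite ({v, w} : Set V) := Nat.finite_of_card_ne_zero (by omega)
    obtain ⟨e⟩ : Nonempty (W ≃ ({v, w} : Set V)) := Finite.card_eq.1 (hcard.trans hc.symm)
    refine ⟨⟨e, ?_⟩⟩
    intro a b
    have h1 : ¬ (G.induce ({v, w} : Set V)).Adj (e a) (e b) := by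
      rw [SimpleGraph.comap_adj]
      have ha := (e a).2
      have hb := (e b).2
      simp only [Set.mem_insert_iff, Set.mem_singleton_iff] at ha hb
      simp only [Function.Embedding.subtype_apply]
      rcases ha with ha | ha <;> rcases hb with hb | hb <;> rw [ha, hb]
      · exact G.irrefl
      · exact hvw
      · exact fun e => hvw e.symm
      · exact G.irrefl
    simp only [h1, hedge a b]

/-- The two neighbours along the path already exhaust the degree. -/
theorem exists_eq_of_adj_interior {W : Type v} {H : SimpleGraph W} {ℓ : ℕ}
    {P : SimpleGraph.pathGraph (ℓ + 1) ↪g H} (hP : IsHandle H P) {a : Fin (ℓ + 1)} (h0 : a ≠ 0)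
    (hl : a ≠ Fin.last ℓ) {w : W} (hw : H.Adj (P a) w) : ∃ b, P b = w := by
  have ha0 : 0 < a.val := Nat.pos_of_ne_zero fun e => h0 (Fin.ext e)
  have hal : a.val < ℓ := lt_of_le_of_ne (Nat.le_of_lt_succ a.2) fun e => hl (Fin.ext e)
  set b : Fin (ℓ + 1) := ⟨a.val - 1, by omega⟩ with hb
  set c : Fin (ℓ + 1) := ⟨a.val + 1, by omega⟩ with hc
  have hbc : P b ≠ P c := by
    intro e
    have := congrArg Fin.val (P.injective e)
    simp only [hb, hc] at this
    omega
  have h2 := hP.2 (P a) ⟨a, h0, hl, rfl⟩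
  have hsub : ({P b, P c} : Set W) ⊆ H.neighborSet (P a) := by
    rintro x (rfl | rfl)
    · exact P.map_adj_iff.2 (SimpleGraph.pathGraph_adj.2 (Or.inr (by simp only [hb]; omega)))
    · exact P.map_adj_iff.2 (SimpleGraph.pathGraph_adj.2 (Or.inl (by simp only [hc])))
  have heq := Set.eq_of_subset_of_ncard_le hsub (by rw [h2, Set.ncard_pair hbc])
    (Set.finite_of_ncard_ne_zero (by omega))
  have hmem : w ∈ ({P b, P c} : Set W) := by
    rw [heq]
    exact hw
  rcases hmem with rfl | rfl
  · exact ⟨b, rfl⟩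
  · exact ⟨c, rfl⟩

/-- The ends of the handle are nonadjacent since its length is at least two, so their images are
linked. The interior of the linking path uses blocks outside `A`, hence is disjoint from the copy,
and it is anticomplete to the rest of the copy, matching the fact that interior vertices of a handle
have no neighbours off it. -/
theorem Linked.hasRainbowCopy {W : Type v} {H : SimpleGraph W} {ℓ : ℕ}
    {P : SimpleGraph.pathGraph (ℓ + 1) ↪g H} (hP : IsHandle H P) {B A : Blockade V} {col : V → ℤ}
    (hcol : ∀ b ∈ B.index, ∀ v, v ∈ B.block b ↔ col v = b) (hI : A.index ⊆ B.index)
    (hAB : ∀ b, A.block b ⊆ B.block b) (hL : Linked G col B.index A.index A.block ℓ)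
    (h : A.HasRainbowCopy G (H.induce (pathInterior P)ᶜ)) : B.HasRainbowCopy G H := by
  obtain ⟨J, ⟨hJ, hJ'⟩, ⟨e⟩⟩ := h
  have hℓ := hP.1
  have hPadj : ∀ a b : Fin (ℓ + 1), H.Adj (P a) (P b) ↔ (a.val + 1 = b.val ∨ b.val + 1 = a.val) :=
    fun a b => P.map_adj_iff.trans SimpleGraph.pathGraph_adj
  have hout : ∀ a : Fin (ℓ + 1), (a = 0 ∨ a = Fin.last ℓ) → P a ∉ pathInterior P := by
    rintro a ha ⟨b, hb0, hbl, he⟩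
    rw [P.injective he] at hb0 hbl
    tauto
  have h0 := hout 0 (Or.inl rfl)
  have hl := hout (Fin.last ℓ) (Or.inr rfl)
  have heJ : ∀ x, ∃ k ∈ A.index, (e x).1 ∈ A.block k := fun x => hJ _ (e x).2
  have headj : ∀ x y, G.Adj (e x).1 (e y).1 ↔ H.Adj x.1 y.1 := fun x y => e.map_adj_iff
  have hecol : ∀ x, ∀ k ∈ A.index, (e x).1 ∈ A.block k → col (e x).1 = k := fun x k hk hx =>
    (hcol k (hI hk) _).1 (hAB k hx)
  have heblock : ∀ x y, ∀ k ∈ A.index, (e x).1 ∈ A.block k → (e y).1 ∈ A.block k → x = y := by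
    intro x y k hk hx hy
    exact e.injective (Subtype.ext (hJ' k hk _ (e x).2 _ (e y).2 hx hy))
  obtain ⟨i, hi, hui⟩ := heJ ⟨P 0, h0⟩
  obtain ⟨j, hj, hvj⟩ := heJ ⟨P (Fin.last ℓ), hl⟩
  have hij : i ≠ j := by
    rintro rfl
    have h1 := heblock _ _ i hi hui hvj
    have h2 := P.injective (congrArg Subtype.val h1)
    have h3 := congrArg Fin.val h2
    simp at h3
    omega
  obtain ⟨f, hf, hf0, hfl, hfc, hfint⟩ := hL i hi j hj hij _ hui _ hvj (by
    rw [headj, hPadj]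
    simp
    omega)
  -- The linking path agrees with the copy at both ends of the handle, so `φ` follows `f` along all
  -- of `P`.
  set φ : W → V := fun w => if h : w ∈ pathInterior P then f (Classical.choose h).val
    else (e ⟨w, h⟩).1 with hφ
  have hφe : ∀ w (h : w ∉ pathInterior P), φ w = (e ⟨w, h⟩).1 := fun w h => dif_neg h
  have hφP : ∀ a : Fin (ℓ + 1), φ (P a) = f a := by
    intro a
    by_cases h : P a ∈ pathInterior P
    · have h1 : φ (P a) = f (Classical.choose h).val := dif_pos h
      rw [h1, P.injective (Classical.choose_spec h).2.2]
    · rw [hφe _ h]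
      by_cases ha0 : a = 0
      · subst ha0
        exact hf0.symm
      · by_cases hal : a = Fin.last ℓ
        · subst hal
          exact hfl.symm
        · exact absurd ⟨a, ha0, hal, rfl⟩ h
  have hbd : ∀ a : Fin (ℓ + 1), a ≠ 0 → a ≠ Fin.last ℓ → 0 < a.val ∧ a.val < ℓ := fun a ha0 hal =>
    ⟨Nat.pos_of_ne_zero fun e => ha0 (Fin.ext e),
      lt_of_le_of_ne (Nat.le_of_lt_succ a.2) fun e => hal (Fin.ext e)⟩
  have hale : ∀ a : Fin (ℓ + 1), a.val ≤ ℓ := fun a => Nat.le_of_lt_succ a.2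
  have hcolin : ∀ w ∈ pathInterior P, col (φ w) ∈ B.index ∧ col (φ w) ∉ A.index := by
    rintro w ⟨a, ha0, hal, rfl⟩
    obtain ⟨h1, h2⟩ := hbd a ha0 hal
    rw [hφP]
    exact ⟨(hfint a h1 h2).1, (hfint a h1 h2).2.1⟩
  have hcolout : ∀ w ∉ pathInterior P, col (φ w) ∈ A.index ∧ φ w ∈ A.block (col (φ w)) := by
    intro w hw
    rw [hφe w hw]
    obtain ⟨k, hk, hxk⟩ := heJ ⟨w, hw⟩
    rw [hecol _ k hk hxk]
    exact ⟨hk, hxk⟩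
  have hcolinj : ∀ w w', col (φ w) = col (φ w') → w = w' := by
    intro w w' he
    by_cases hw : w ∈ pathInterior P <;> by_cases hw' : w' ∈ pathInterior P
    · obtain ⟨a, -, -, rfl⟩ := hw
      obtain ⟨b, -, -, rfl⟩ := hw'
      rw [hφP, hφP] at he
      rw [Fin.ext (hfc a (hale a) b (hale b) he)]
    · exact absurd (he ▸ (hcolout w' hw').1) (hcolin w hw).2
    · exact absurd (he ▸ (hcolout w hw).1) (hcolin w' hw').2
    · obtain ⟨h1, h2⟩ := hcolout w hw
      have h3 := (hcolout w' hw').2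
      rw [← he] at h3
      rw [hφe w hw] at h1 h2
      rw [hφe w hw, hφe w' hw'] at h3
      exact congrArg Subtype.val (heblock _ _ _ h1 h2 h3)
  have hinj : Function.Injective φ := fun w w' he => hcolinj w w' (congrArg col he)
  have hmix : ∀ w ∈ pathInterior P, ∀ w', G.Adj (φ w) (φ w') ↔ H.Adj w w' := by
    rintro w ⟨a, ha0, hal, rfl⟩ w'
    by_cases hw' : ∃ b, P b = w'
    · obtain ⟨b, rfl⟩ := hw'
      rw [hφP, hφP, hPadj]
      exact hf.2 a (hale a) b (hale b)
    · have hw'o : w' ∉ pathInterior P := fun ⟨b, _, _, hb⟩ => hw' ⟨b, hb⟩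
      have h1 : ¬ H.Adj (P a) w' := fun h => hw' (exists_eq_of_adj_interior hP ha0 hal h)
      obtain ⟨h2, h3⟩ := hbd a ha0 hal
      obtain ⟨k, hk, hxk⟩ := heJ ⟨w', hw'o⟩
      have hki : k ≠ i := by
        rintro rfl
        have := congrArg Subtype.val (heblock _ _ k hk hxk hui)
        exact hw' ⟨0, this.symm⟩
      have hkj : k ≠ j := by
        rintro rfl
        have := congrArg Subtype.val (heblock _ _ k hk hxk hvj)
        exact hw' ⟨Fin.last ℓ, this.symm⟩
      have h4 := (hfint a h2 h3).2.2 k hk hki hkj _ hxk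
      rw [hφP, hφe w' hw'o]
      simp only [h1, h4]
  have hadj : ∀ w w', G.Adj (φ w) (φ w') ↔ H.Adj w w' := by
    intro w w'
    by_cases hw : w ∈ pathInterior P
    · exact hmix w hw w'
    · by_cases hw' : w' ∈ pathInterior P
      · rw [G.adj_comm, H.adj_comm]
        exact hmix w' hw' w
      · rw [hφe w hw, hφe w' hw', headj]
  have hblock : ∀ w, ∀ b ∈ B.index, φ w ∈ B.block b ↔ col (φ w) = b := fun w b hb => hcol b hb _
  refine ⟨Set.range φ, ⟨?_, ?_⟩, ⟨Equiv.ofInjective φ hinj, ?_⟩⟩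
  · rintro x ⟨w, rfl⟩
    have hmem : col (φ w) ∈ B.index := by
      by_cases hw : w ∈ pathInterior P
      · exact (hcolin w hw).1
      · exact hI (hcolout w hw).1
    exact ⟨col (φ w), hmem, (hblock w _ hmem).2 rfl⟩
  · rintro b hb x ⟨w, rfl⟩ y ⟨w', rfl⟩ hx hy
    rw [hblock w b hb] at hx
    rw [hblock w' b hb] at hy
    rw [hcolinj w w' (hx.trans hy.symm)]
  · intro w w'
    exact hadj w w'

/-- The scales are γ = n^(1-c), s = n^(1-σ), q = n^ε. With `ρ` the slack in c - σ > 1/t, the loss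
q^p is at most n^(ρ/2); half of the slack thus pays for the growth of the shrinkage. What is left of
the expansion factor is at least n^(1/t), whose power t-1 is n^(1-1/t) ≥ γ because c > 1/t. -/
theorem exists_forces_handle {t ℓ : ℕ} (ht : 1 ≤ t) (hℓ : 3 * t + 3 ≤ ℓ) {c σ : ℝ} (hc : c < 1)
    (hσ : 0 < σ) (hcσ : 1 / (t : ℝ) < c - σ) {W : Type v} {H : SimpleGraph W}
    {P : SimpleGraph.pathGraph (ℓ + 1) ↪g H} (hP : IsHandle H P)
    (ih : ∀ σ' : ℝ, 0 < σ' → 1 / (t : ℝ) < c - σ' → ∃ N K : ℕ, 0 < N ∧ 0 < K ∧ ∃ lam : ℝ, 0 < lam ∧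
      Forces.{u, v} N K σ' lam c (H.induce (pathInterior P)ᶜ)) :
    ∃ N K : ℕ, 0 < N ∧ 0 < K ∧ ∃ lam : ℝ, 0 < lam ∧ Forces.{u, v} N K σ lam c H := by
  set ρ := c - σ - 1 / (t : ℝ) with hρ
  have hρ0 : 0 < ρ := by linarith
  obtain ⟨N₁, m, hN₁, hm, lam₁, hlam₁, hF⟩ := ih (σ + ρ / 2) (by linarith) (by linarith)
  obtain ⟨p, hp⟩ := exists_linked_blocks.{u} t ℓ m ht hℓ hm
  set ε := ρ / (2 * (p + 1)) with hε
  have hε0 : 0 < ε := by positivity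
  have hεp : p * ε ≤ ρ / 2 := by
    rw [hε]
    have : (0 : ℝ) ≤ p := Nat.cast_nonneg _
    rw [mul_div_assoc', div_le_div_iff₀ (by positivity) (by positivity)]
    nlinarith
  -- Then q^E ≥ n bounds every degree, as the regularisation needs.
  obtain ⟨E, hE⟩ := exists_nat_ge (1 / ε)
  obtain ⟨K, η, q₀, hη, hlink⟩ := hp E lam₁ hlam₁
  -- For n at least this large, n^ε reaches `q₀`.
  obtain ⟨N₂, hN₂⟩ := exists_nat_ge ((max q₀ 1) ^ (1 / ε))
  refine ⟨max 2 (max N₁ N₂), K + 1, by positivity, Nat.succ_pos _, η, hη, ?_⟩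
  intro V _ G hG hN B hBK hBσ hBη
  have hn2 : 2 ≤ Fintype.card V := (le_max_left _ _).trans hN
  have hnN₁ : N₁ ≤ Fintype.card V := (le_max_left _ _).trans ((le_max_right _ _).trans hN)
  have hnN₂ : N₂ ≤ Fintype.card V := (le_max_right _ _).trans ((le_max_right _ _).trans hN)
  set n : ℝ := (Fintype.card V : ℝ) with hn
  have hn1 : 1 < n := by
    rw [hn]
    exact_mod_cast (by omega : 1 < Fintype.card V)
  have hn0 : 0 < n := by linarith
  set q := n ^ ε with hq
  have hq1 : 1 ≤ q := Real.one_le_rpow hn1.le hε0.le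
  have hqpow : ∀ k : ℕ, q ^ k = n ^ (k * ε) := by
    intro k
    rw [hq, ← Real.rpow_natCast, ← Real.rpow_mul hn0.le, mul_comm]
  have hqq₀ : q₀ ≤ q := by
    have h1 : (max q₀ 1) ^ (1 / ε) ≤ n := hN₂.trans (by rw [hn]; exact_mod_cast hnN₂)
    have h2 := Real.rpow_le_rpow (by positivity) h1 hε0.le
    rw [← Real.rpow_mul (by positivity), one_div_mul_cancel hε0.ne', Real.rpow_one] at h2
    exact (le_max_left _ _).trans h2
  have hnE : n ≤ q ^ E := by
    rw [hqpow]
    have h1 : 1 ≤ (E : ℝ) * ε := by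
      rw [div_le_iff₀ hε0] at hE
      exact hE
    calc n = n ^ (1 : ℝ) := (Real.rpow_one n).symm
      _ ≤ _ := Real.rpow_le_rpow_of_exponent_le hn1.le h1
  set γ := n ^ (1 - c) with hγ
  set s := n ^ (1 - σ) with hs
  have hγ0 : 0 < γ := Real.rpow_pos_of_pos hn0 _
  have hγ1 : 1 ≤ γ := Real.one_le_rpow hn1.le (by linarith)
  have hγq : γ * q ^ p = n ^ (1 - c + p * ε) := by rw [hqpow, hγ, ← Real.rpow_add hn0]
  have ht0 : (0 : ℝ) < t := by exact_mod_cast ht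
  have htinv : 0 < 1 / (t : ℝ) := by positivity
  obtain ⟨col, hcol⟩ := B.exists_col
  obtain ⟨M, hMI, hMm, A, hAB, hAc, hAlk, hAL⟩ := hlink G γ q s col B.index B.block
    (fun X Y hXY hadj hX hY => hG ⟨X, Y, ⟨hXY, hadj⟩, hX, hY⟩) hγ1 hqq₀ hq1
    (fun w X => ((deg_le_card w X).trans (by
      rw [hn]
      exact_mod_cast card_le_univ X)).trans hnE)
    (by
      rw [hγq, hs]
      exact Real.rpow_le_rpow_of_exponent_le hn1.le (by linarith))
    (by
      rw [hγq, hs, ← Real.rpow_sub hn0, ← Real.rpow_natCast, ← Real.rpow_mul hn0.le, hγ]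
      refine Real.rpow_le_rpow_of_exponent_le hn1.le ?_
      rw [Nat.cast_sub ht, Nat.cast_one]
      have h1 : 1 / (t : ℝ) ≤ 1 - σ - (1 - c + p * ε) := by linarith
      have h2 : (0 : ℝ) ≤ t - 1 := by
        have : (1 : ℝ) ≤ t := by exact_mod_cast ht
        linarith
      have h3 := mul_le_mul_of_nonneg_right h1 h2
      have h4 : 1 / (t : ℝ) * (t - 1) = 1 - 1 / t := by field_simp
      linarith)
    (by rw [← Blockade.length, hBK]; omega)
    (fun b hb => Blockade.rpow_le_card (by omega) hBσ hb)
    (fun b hb v hv => (hcol b hb v).1 hv) (Blockade.lk_of_linkage_le hBη)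
  have hAcard : ∀ b ∈ M, n ^ (1 - (σ + ρ / 2)) ≤ (A b).card := by
    intro b hb
    have h1 := hAc b hb
    rw [hqpow] at h1
    have h2 : n ^ ((p : ℝ) * ε) * n ^ (1 - (σ + ρ / 2)) ≤ s := by
      rw [← Real.rpow_add hn0, hs]
      exact Real.rpow_le_rpow_of_exponent_le hn1.le (by linarith)
    exact le_of_mul_le_mul_left (h2.trans h1) (Real.rpow_pos_of_pos hn0 _)
  let A' : Blockade V :=
    { index := M
      block := A
      block_nonempty := by
        intro b hb
        have h1 := hAcard b hb
        have h2 : 0 < n ^ (1 - (σ + ρ / 2)) := Real.rpow_pos_of_pos hn0 _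
        have h3 : (0 : ℝ) < (A b).card := by linarith
        exact card_pos.1 (by exact_mod_cast h3)
      block_disjoint := fun i hi j hj hij =>
        (B.block_disjoint i (hMI hi) j (hMI hj) hij).mono (hAB i) (hAB j) }
  have hcopy := hF V G hG hnN₁ A' hMm
    (Blockade.shrinkage_le (by omega) (by rw [Blockade.length, hMm]; exact hm) hAcard)
    (Blockade.linkage_le hlam₁.le hAlk)
  exact Linked.hasRainbowCopy (A := A') hP hcol hMI hAB hAL hcopy

/-- `σ` is quantified inside the induction because each handle step calls on a larger value. -/
theorem IsBuildable.exists_forces {β t : ℕ} (ht : 1 ≤ t) (hβ : 3 * t + 3 ≤ β) {c : ℝ} (hc : c < 1)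
    {W : Type v} {H : SimpleGraph W} (hH : IsBuildable β H) : ∀ σ : ℝ, 0 < σ →
    1 / (t : ℝ) < c - σ → ∃ N K : ℕ, 0 < N ∧ 0 < K ∧ ∃ lam : ℝ, 0 < lam ∧
      Forces.{u, v} N K σ lam c H := by
  induction hH with
  | base H hcard hedge =>
    intro σ _ _
    exact ⟨1, 2, one_pos, two_pos, 1 / 2, by norm_num, fun V _ G _ _ B hB _ hlk =>
      hasRainbowCopy_of_two hcard hedge hB hlk⟩
  | handle H ℓ hℓ P hP _ ih =>
    intro σ hσ hcσ
    exact exists_forces_handle ht (hβ.trans hℓ) hc hσ hcσ hP ih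

/-- Here the coherence threshold is at most 1, so a single nonadjacent pair violates it, and small
linkage always provides one. This case is separate because the tree argument needs γ ≥ 1. -/
theorem forces_of_one_le {c : ℝ} (hc : 1 ≤ c) (σ : ℝ) {W : Type v} (H : SimpleGraph W) :
    Forces.{u, v} 1 2 σ (1 / 2) c H := by
  intro V _ G hG hN B hB _ hlk
  exfalso
  obtain ⟨i, hi, j, hj, hij, v, hv, w, hw, hvw⟩ := B.exists_not_adj hB hlk
  have hn : (1 : ℝ) ≤ Fintype.card V := by exact_mod_cast hN
  have h1 : (Fintype.card V : ℝ) ^ (1 - c) ≤ 1 := Real.rpow_le_one_of_one_le_of_nonpos hn (by linarith)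
  refine hG ⟨{v}, {w}, ⟨?_, ?_⟩, by simpa using h1, by simpa using h1⟩
  · rw [disjoint_singleton]
    exact Blockade.disjoint_of_ne hi hj hv hw hij
  · simpa using hvw

end Blockades

end PurePairs

theorem theorem10p1 (β : ℕ) (hβ : 6 ≤ β) (c : ℝ) (hc : 1 / (((β - 3) / 3 : ℕ) : ℝ) < c)
    {W : Type v} (H : SimpleGraph W) (hH : PurePairs.IsBuildable β H)
    (σ : ℝ) (hσ : 0 < σ) (hcσ : 1 / (((β - 3) / 3 : ℕ) : ℝ) < c - σ) :
    ∃ N K : ℕ, 0 < N ∧ 0 < K ∧ ∃ lam : ℝ, 0 < lam ∧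
      PurePairs.Forces.{u, v} N K σ lam c H := by
  rcases lt_or_ge c 1 with hc1 | hc1
  -- The parameter t is the natural-number quotient (β - 3)/3, so β ≥ 6 gives 1 ≤ t as well as 3t +
  -- 3 ≤ β.
  · exact PurePairs.IsBuildable.exists_forces (by omega) (by omega) hc1 hH σ hσ hcσ
  · exact ⟨1, 2, one_pos, two_pos, 1 / 2, by norm_num, PurePairs.forces_of_one_le hc1 σ H⟩
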